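/- **Conventions.** Let $n\ge 1$. Everything is smooth and local: all objects are considered near a base point, and all identities are required in a neighbourhood of it. "Local function" means a smooth function of finitely many coordinates. On the infinite jet space $\mathcal J$ with coordinates $x^a$ ($a=1,\dots,n$) and $\phi^i_I$ (finitely many fields $\phi^i$, multi-indices $I$), with total derivatives $D_a=\partial_{x^a}+\phi^i_{aI}\,\partial_{\phi^i_I}$, let $d_h=dx^aD_a$ and $d_v=d-d_h$. For a Lagrangian $\mathcal L=L\,(dx)^n$ with $L$ a local function, let $E_i=\sum_I(-1)^{|I|}D_I(\partial L/\partial\phi^i_I)$, let $\mathcal M=\{D_IE_i=0\}\subset\mathcal J$ be the stationary surface (equation manifold), and let the base point lie on $\mathcal M$. We assume that $\mathcal M$ is regular near the base point: it has coordinates $(x^a,\psi^A)$ (possibly infinitely many $\psi^A$) that are restrictions of local functions on $\mathcal J$, such that the $\phi^i_I$ are local functions of $(x^a,\psi^A)$ on $\mathcal M$ and the $D_a$ are tangent to $\mathcal M$; thus on $\mathcal M$ one has $D_a=\partial_{x^a}+Y_a^A\,\partial_{\psi^A}$, and $d_h,d_v$ restrict to $\mathcal M$. **Equivalence.** Two Lagrangians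 (each near a base point of its stationary surface) are *equivalent* if they are related by a finite chain of the following steps and their inverses: (i) an invertible local field redefinition $\phi'=f[\phi]$, $\phi=g[\phi']$ (derivatives allowed), together with the addition of a total derivative $D_aJ^a[\phi]$; (ii) the addition of auxiliary fields, $L'[u,v]=L[u]+L_a(x,v)$, where the $v^\alpha$ enter undifferentiated and $\partial L_a/\partial v^\alpha=0$ is solved algebraically by $v=v_0(x)$, with nondegenerate Hessian in $v$. **Natural systems.** $L$ is *natural* if it is equivalent to some $L_1=V^a_i(\varphi,x)\,\varphi^i_a-H(\varphi,x)$ whose stationary surface $\mathcal M_1$ is regular and whose equations of motion impose no algebraic constraints on the $\varphi^i$: the functions $\varphi^i$ restricted to $\mathcal M_1$ are independent, i.e. the vertical differentials $d_v\varphi^i|_{\mathcal M_1}$ are linearly independent at the base point. **Presymplectic structures.** The equivalence class of presymplectic structures determined by $L$ consists of the $(n-1,2)$-forms on $\mathcal M$ $$\sigma=d_v\hat\chi\big|_{\mathcal M}+d_vd_h\beta,$$ where $\hat\chi$ is any local $(n-1,1)$-form on $\mathcal J$ with $d_v\mathcal L=d_v\phi^i\,E_i\,(dx)^n-d_h\hat\chi$,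 and $\beta$ is any local $(n-2,1)$-form on $\mathcal M$ ($\beta=0$ if $n=1$). **Intrinsic Lagrangian.** If $\sigma=d(\chi+l)$ on $\mathcal M$ with an $(n-1,1)$-form $\chi=d_v\psi^A\,\chi_A^a\,(dx)^{n-1}_a$ and an $(n,0)$-form $l$ (where $(dx)^{n-1}_a=\partial_a\lrcorner\, dx^1\cdots dx^n$), the intrinsic Lagrangian is the first-order Lagrangian on the jet space $J^\infty(\mathcal M)$, in the fields $\psi^A$, $$\mathcal L^C=\mathrm{Hor}(\pi^*(\chi+l))=(\psi^A_a-Y^A_a)\,\chi^a_A\,(dx)^n+l,$$ where $\pi:J^\infty(\mathcal M)\to\mathcal M$ is the projection and $\mathrm{Hor}(dx^a)=dx^a$, $\mathrm{Hor}(d\psi^A)=\psi^A_a\,dx^a$. **Gauging away.** $\mathcal L^C$ *becomes $L'[\varphi]$ after gauging away Stueckelberg variables* if there are new coordinates $(x^a,\varphi^i,w^\mu)$ on $\mathcal M$ (an invertible local change of the $\psi^A$ over $x$-space, with $w^\mu=0$ at the base point) such that the Euler–Lagrange derivatives of $\mathcal L^C$ with respect to all $w^\mu$ vanish identically, and setting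 $w^\mu=0$ in $\mathcal L^C$ gives $L'[\varphi]$; the base point of $L'$ has $\varphi^i_I=D_I\varphi^i$, evaluated at the base point of $\mathcal M$. **Proposition.** Let $L[\phi]$ be the Lagrangian of a natural system, near a base point on its regular stationary surface $\mathcal M$. Then there is a representative $\sigma$ of the equivalence class of presymplectic structures determined by $L$ which is of the form $\sigma=d(\chi+l)$, and such that for every choice of such a potential $\chi+l$ the intrinsic Lagrangian $\mathcal L^C=\mathrm{Hor}(\pi^*(\chi+l))$ is equivalent to $L$ in the following sense: after gauging away Stueckelberg variables it becomes a Lagrangian $L'$ in finitely many fields that is equivalent to $L$. -/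

import Mathlib

open Filter Topology
open scoped ContDiff

noncomputable section

namespace IntrinsicLagrangian

/-! ## Coordinate spaces, local functions, derivatives

Everything is local: objects are considered near a base point, and all identities are required on a
neighbourhood of it.  A bundle over the space of independent variables `x¹, …, xⁿ`, with a possibly
infinite family `K` of fibre coordinates, is represented by its coordinate space `ℝⁿ × ℝ^K`.  The
topology is the product topology, so an open condition involves finitely many coordinates. -/

/-- Points `(x^a, ψ^A)`, with `a : Fin n` and `A : K`. -/
abbrev Pt (n : ℕ) (K : Type) : Type := (Fin n → ℝ) × (K → ℝ)

/-- `f` is a local function near `p`: there it is a smooth function of the `x^a` and of finitely many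
of the fibre coordinates. -/
def IsLocalAt {n : ℕ} {K : Type} (f : Pt n K → ℝ) (p : Pt n K) : Prop :=
  ∃ (S : Finset K) (g : (Fin n → ℝ) × (S → ℝ) → ℝ),
    ∀ᶠ q in 𝓝 p, ContDiffAt ℝ ∞ g (q.1, fun A : S => q.2 A) ∧ f q = g (q.1, fun A : S => q.2 A)

/-- `Φ` is a map of bundles over `x`-space near `p`, with local functions as components. -/
def IsLocalMapAt {n : ℕ} {K K' : Type} (Φ : Pt n K → Pt n K') (p : Pt n K) : Prop :=
  ∀ᶠ q in 𝓝 p, (Φ q).1 = q.1 ∧ ∀ k, IsLocalAt (fun r => (Φ r).2 k) q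

/-- The partial derivative `∂f/∂ψ^A`. -/
def vderiv {n : ℕ} {K : Type} (A : K) (f : Pt n K → ℝ) (p : Pt n K) : ℝ :=
  open Classical in lineDeriv ℝ f p ((0, Pi.single A 1) : Pt n K)

/-- The derivative `D_a f = ∂f/∂x^a + ∑_A Y_a^A ∂f/∂ψ^A` along the vector field
`D_a = ∂/∂x^a + Y_a^A ∂/∂ψ^A`.  The fields `D_a` span the Cartan distribution, and the horizontal
differential is `d_h = dx^a D_a`. -/
def totalD {n : ℕ} {K : Type} (Y : Fin n → K → Pt n K → ℝ) (a : Fin n) (f : Pt n K → ℝ) :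
    Pt n K → ℝ :=
  fun p => lineDeriv ℝ f p ((Pi.single a 1, fun A => Y a A p) : Pt n K)

/-- The iterated derivative `D_I = D_1^{I 1} ⋯ D_n^{I n}` for a multi-index `I`. -/
def iterD {n : ℕ} {K : Type} (Y : Fin n → K → Pt n K → ℝ) (I : Fin n → ℕ) (f : Pt n K → ℝ) :
    Pt n K → ℝ :=
  (List.finRange n).foldr (fun a g => (totalD Y a)^[I a] g) f

/-! ## Local forms

With `(dx)^{n-1}_a = ∂_a ⌟ dx¹…dxⁿ` as a basis of the horizontal `(n-1)`-forms, and with the vertical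
factors written on the left,

* an `(n,0)`-form `l (dx)^n` is its coefficient function `l`;
* an `(n-1,1)`-form `χ = d_vψ^A χ^a_A (dx)^{n-1}_a` is the family `χ a A`;
* an `(n-1,2)`-form `σ = ½ d_vψ^A d_vψ^B σ^a_{AB} (dx)^{n-1}_a` is the family `σ a A B`;
* an `(n-2,1)`-form `β = ½ d_vψ^A β^{ab}_A (dx)^{n-2}_{ab}` is the family `β a b A`, antisymmetric
  in `a, b` (hence zero if `n = 1`).

Then `d_v χ` has the coefficients `∂_A χ^a_B - ∂_B χ^a_A`, one has `d_h χ = -(D_a χ^a) (dx)^n` with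
`D_a` acting on the vertical one-forms `χ^a` as Lie derivative, and `d_h β` has, up to a common sign,
the components `∑_b D_b β^{ab}`. -/

/-- Vertical one-forms `d_vψ^A ρ_A`. -/
abbrev VForm (n : ℕ) (K : Type) : Type := K → Pt n K → ℝ

/-- `ρ` is a local form near `p`: finitely many nonzero coefficients, all of them local functions. -/
def IsLocalFormAt {n : ℕ} {K : Type} (ρ : VForm n K) (p : Pt n K) : Prop :=
  ∃ S : Finset K, ∀ᶠ q in 𝓝 p, ∀ A, IsLocalAt (ρ A) q ∧ (A ∉ S → ρ A q = 0)

/-- The vertical differential of a vertical one-form, `(d_v ρ)_{AB} = ∂_A ρ_B - ∂_B ρ_A`. -/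
def dvForm {n : ℕ} {K : Type} (ρ : VForm n K) (A B : K) (p : Pt n K) : ℝ :=
  vderiv A (ρ B) p - vderiv B (ρ A) p

/-- The Lie derivative of `d_vψ^A ρ_A` along `D_a`; since `D_a d_vψ^A = d_v Y_a^A`, its coefficients
are `D_a ρ_B + ∑_A ρ_A ∂_B Y_a^A`. -/
def lieD {n : ℕ} {K : Type} (Y : Fin n → K → Pt n K → ℝ) (a : Fin n) (ρ : VForm n K) : VForm n K :=
  fun B p => totalD Y a (ρ B) p + ∑ᶠ A, ρ A p * vderiv B (Y a A) p

/-- The divergence `∑_a D_a ρ^a` of a family of vertical one-forms. -/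
def divForm {n : ℕ} {K : Type} (Y : Fin n → K → Pt n K → ℝ) (ρ : Fin n → VForm n K) : VForm n K :=
  fun B p => ∑ a, lieD Y a (ρ a) B p

/-- The pullback of a vertical one-form along `Φ`, where `Φ` sends `D_a` to `D_a`, so that
`Φ^* d_vψ^k = ∑_B d_vψ^B ∂_B Φ^k`. -/
def pullForm {n : ℕ} {K K' : Type} (Φ : Pt n K → Pt n K') (ρ : VForm n K') : VForm n K :=
  fun B q => ∑ᶠ k, ρ k (Φ q) * vderiv B (fun r => (Φ r).2 k) q

/-! ## Jet spaces and Euler–Lagrange equations -/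

/-- The fibre coordinates `φ^i_I` of the infinite jet space of a bundle with dependent variables
`φ^i`, `i : ι`; `I` runs over the multi-indices. -/
abbrev JetIdx (n : ℕ) (ι : Type) : Type := ι × (Fin n → ℕ)

/-- The infinite jet space. -/
abbrev Jet (n : ℕ) (ι : Type) : Type := Pt n (JetIdx n ι)

/-- The components of the total derivatives `D_a = ∂/∂x^a + φ^i_{aI} ∂/∂φ^i_I` of the jet space. -/
def jetY (n : ℕ) (ι : Type) : Fin n → JetIdx n ι → Jet n ι → ℝ :=
  fun a k p => p.2 (k.1, k.2 + Pi.single a 1)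

/-- The projection of the jet space to the underlying bundle, which forgets all derivatives. -/
def jetProj {n : ℕ} {ι : Type} (p : Jet n ι) : Pt n ι := (p.1, fun i => p.2 (i, 0))

/-- The prolongation `φ^j_I = D_I f^j` of `φ^j = f^j[u]` to a map of jet spaces. -/
def prolong {n : ℕ} {ι κ : Type} (f : κ → Jet n ι → ℝ) (p : Jet n ι) : Jet n κ :=
  (p.1, fun k => iterD (jetY n ι) k.2 (f k.1) p)

/-- The Euler–Lagrange derivative `∑_I (-1)^{|I|} D_I (∂L/∂φ^i_I)`. -/
def euler {n : ℕ} {ι : Type} (L : Jet n ι → ℝ) (i : ι) (p : Jet n ι) : ℝ :=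
  ∑ᶠ I : Fin n → ℕ, (-1 : ℝ) ^ (∑ a, I a) * iterD (jetY n ι) I (vderiv (i, I) L) p

/-- The stationary surface: all prolonged Euler–Lagrange equations hold. -/
def stationary {n : ℕ} {ι : Type} (L : Jet n ι → ℝ) : Set (Jet n ι) :=
  {p | ∀ i I, iterD (jetY n ι) I (euler L i) p = 0}

/-- A Lagrangian system with finitely many fields, considered near a point of its stationary
surface. -/
structure LagSystem (n : ℕ) where
  ι : Type
  fintype : Fintype ι
  L : Jet n ι → ℝ
  pt : Jet n ι
  isLocal : IsLocalAt L pt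
  onShell : pt ∈ stationary L

attribute [instance] LagSystem.fintype

/-! ## The equation manifold -/

/-- The total derivatives restricted to a submanifold with coordinates `ψ` and embedding `emb`, in
these coordinates: `Y_a^A = (D_a ψ^A)` on the submanifold. -/
def restrictedY {n : ℕ} {ι K : Type} (emb : Pt n K → Jet n ι) (ψ : Jet n ι → Pt n K) :
    Fin n → K → Pt n K → ℝ :=
  fun a A q => totalD (jetY n ι) a (fun p => (ψ p).2 A) (emb q)

/-- Coordinates `(x^a, ψ^A)` on the stationary surface near the base point.  Their existence is the
regularity of the equations: the stationary surface is a manifold, fibred over `x`-space, to which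
the total derivatives are tangent. -/
structure EqChart {n : ℕ} (S : LagSystem n) where
  A : Type
  q₀ : Pt n A
  emb : Pt n A → Jet n S.ι
  ψ : Jet n S.ι → Pt n A
  emb_base : emb q₀ = S.pt
  emb_local : IsLocalMapAt emb q₀
  ψ_local : IsLocalMapAt ψ S.pt
  ψ_emb : ∀ᶠ q in 𝓝 q₀, ψ (emb q) = q
  emb_mem : ∀ᶠ q in 𝓝 q₀, emb q ∈ stationary S.L
  emb_ψ : ∀ᶠ p in 𝓝 S.pt, p ∈ stationary S.L → emb (ψ p) = p
  tangent : ∀ᶠ q in 𝓝 q₀, ∀ a k,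
    totalD (restrictedY emb ψ) a (fun r => (emb r).2 k) q = jetY n S.ι a k (emb q)

namespace EqChart

variable {n : ℕ} {S : LagSystem n}

/-- The total derivatives of the equation manifold, i.e. its horizontal differential. -/
def Y (c : EqChart S) : Fin n → c.A → Pt n c.A → ℝ := restrictedY c.emb c.ψ

end EqChart

/-! ## Presymplectic structures -/

/-- `χ` is an `(n-1,1)`-form on the jet space with `d_v L = d_vφ^i E_i - d_h χ`, near the base
point. -/
def LagSystem.IsPresympPotential {n : ℕ} (S : LagSystem n) (χ : Fin n → VForm n (JetIdx n S.ι)) :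
    Prop :=
  (∀ a, IsLocalFormAt (χ a) S.pt) ∧
    ∀ᶠ p in 𝓝 S.pt, ∀ (i : S.ι) (I : Fin n → ℕ),
      vderiv (i, I) S.L p =
        (if I = 0 then euler S.L i p else 0) + divForm (jetY n S.ι) χ (i, I) p

namespace EqChart

variable {n : ℕ} {S : LagSystem n}

/-- `σ` belongs to the equivalence class of presymplectic structures which the Lagrangian determines
on its equation manifold: `σ` is the pullback of `d_v χ`, with `d_v L = d_vφ^i E_i - d_h χ`, up to
`d_v d_h β` for an arbitrary `(n-2,1)`-form `β` (pullback to the equation manifold commutes with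
`d_v`). -/
def IsPresymplectic (c : EqChart S) (σ : Fin n → c.A → c.A → Pt n c.A → ℝ) : Prop :=
  ∃ (χ : Fin n → VForm n (JetIdx n S.ι)) (β : Fin n → Fin n → VForm n c.A),
    S.IsPresympPotential χ ∧
    (∀ a b, IsLocalFormAt (β a b) c.q₀) ∧
    (∀ a b, β a b = -β b a) ∧
    ∀ᶠ q in 𝓝 c.q₀, ∀ a A B,
      σ a A B q = dvForm (pullForm c.emb (χ a)) A B q + dvForm (divForm c.Y (β a)) A B q

/-- `σ = d (χ + l)` with an `(n-1,1)`-form `χ` and an `(n,0)`-form `l`: the components of this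
equation are `d_v χ = σ` and `d_h χ + d_v l = 0`, that is, `∑_a D_a χ^a = d_v l`. -/
def IsPotential (c : EqChart S) (σ : Fin n → c.A → c.A → Pt n c.A → ℝ) (χ : Fin n → VForm n c.A)
    (l : Pt n c.A → ℝ) : Prop :=
  (∀ a, IsLocalFormAt (χ a) c.q₀) ∧ IsLocalAt l c.q₀ ∧
    ∀ᶠ q in 𝓝 c.q₀, (∀ a A B, dvForm (χ a) A B q = σ a A B q) ∧
      ∀ B, divForm c.Y χ B q = vderiv B l q

/-- The intrinsic Lagrangian `Hor (π^* (χ + l))` on the jet space of the equation manifold itself,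
whose dependent variables are the coordinates `ψ^A`: as `d_vψ^A = dψ^A - Y_a^A dx^a` and
`Hor (dψ^A) = ψ^A_a dx^a`, it is `(ψ^A_a - Y_a^A) χ^a_A + l`. -/
def intrinsicLagrangian (c : EqChart S) (χ : Fin n → VForm n c.A) (l : Pt n c.A → ℝ) :
    Jet n c.A → ℝ :=
  fun p => ∑ a, (∑ᶠ A, (p.2 (A, Pi.single a 1) - c.Y a A (jetProj p)) * χ a A (jetProj p))
    + l (jetProj p)

end EqChart

/-! ## Equivalence of Lagrangians -/

/-- `S` and `S'` are identified by an invertible local field redefinition `φ' = f[φ]`, `φ = g[φ']`,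
modulo total derivatives: `L'[f[φ]] = L[φ] + D_a J^a[φ]`. -/
def IsRedefinition {n : ℕ} (S S' : LagSystem n) : Prop :=
  ∃ (f : S'.ι → Jet n S.ι → ℝ) (g : S.ι → Jet n S'.ι → ℝ) (J : Fin n → Jet n S.ι → ℝ),
    (∀ j, IsLocalAt (f j) S.pt) ∧ (∀ i, IsLocalAt (g i) S'.pt) ∧ (∀ a, IsLocalAt (J a) S.pt) ∧
    prolong f S.pt = S'.pt ∧ prolong g S'.pt = S.pt ∧
    (∀ᶠ p in 𝓝 S.pt, prolong g (prolong f p) = p) ∧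
    (∀ᶠ p in 𝓝 S'.pt, prolong f (prolong g p) = p) ∧
    ∀ᶠ p in 𝓝 S.pt, S'.L (prolong f p) = S.L p + ∑ a, totalD (jetY n S.ι) a (J a) p

/-- `S'` is `S` with auxiliary fields added: its fields are those of `S` together with fields `v^α`,
which enter only undifferentiated, `L'[u,v] = L[u] + Lₐ(x,v)`, and whose own equations
`∂Lₐ/∂v^α = 0` are solved algebraically, in the regular way (nondegenerate Hessian), by
`v = v₀(x)`. -/
def IsAuxiliaryExtension {n : ℕ} (S S' : LagSystem n) : Prop :=
  ∃ (α : Type) (_ : Fintype α) (e : S'.ι ≃ S.ι ⊕ α)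
    (La : (Fin n → ℝ) × (α → ℝ) → ℝ) (v₀ : (Fin n → ℝ) → α → ℝ),
    let u : Jet n S'.ι → Jet n S.ι := fun p => (p.1, fun k => p.2 (e.symm (Sum.inl k.1), k.2))
    let v : Jet n S'.ι → α → ℝ := fun p j => p.2 (e.symm (Sum.inr j), 0)
    u S'.pt = S.pt ∧
    (∀ᶠ p in 𝓝 S'.pt, S'.L p = S.L (u p) + La (p.1, v p)) ∧
    (∀ᶠ y in 𝓝 (S'.pt.1, v S'.pt), ContDiffAt ℝ ∞ La y) ∧
    (∀ᶠ x in 𝓝 S'.pt.1, ContDiffAt ℝ ∞ v₀ x) ∧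
    (∀ᶠ y in 𝓝 (S'.pt.1, v S'.pt), fderiv ℝ (fun w => La (y.1, w)) y.2 = 0 ↔ y.2 = v₀ y.1) ∧
    ∀ w, fderiv ℝ (fun w' => fderiv ℝ (fun w'' => La (S'.pt.1, w'')) w') (v S'.pt) w = 0 → w = 0

/-- Equivalence of Lagrangians: the equivalence relation generated by invertible local field
redefinitions, addition of total derivatives, and addition (or elimination) of auxiliary fields. -/
def LagEquiv {n : ℕ} : LagSystem n → LagSystem n → Prop :=
  Relation.EqvGen fun S S' => IsRedefinition S S' ∨ IsAuxiliaryExtension S S'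

/-! ## Natural systems -/

/-- The Lagrangian is of the form `V^a_i(φ,x) φ^i_a - H(φ,x)` near the base point. -/
def LagSystem.IsFirstOrder {n : ℕ} (S : LagSystem n) : Prop :=
  ∃ (V : Fin n → S.ι → Pt n S.ι → ℝ) (H : Pt n S.ι → ℝ),
    (∀ a i, IsLocalAt (V a i) (jetProj S.pt)) ∧ IsLocalAt H (jetProj S.pt) ∧
    ∀ᶠ p in 𝓝 S.pt,
      S.L p = ∑ a, ∑ i, V a i (jetProj p) * p.2 (i, Pi.single a 1) - H (jetProj p)

/-- The equations of motion impose no algebraic constraints on the undifferentiated fields: the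
stationary surface is regular, and the functions `φ^i` restricted to it remain independent (together
with the `x^a`), i.e. their vertical differentials are linearly independent. -/
def LagSystem.FieldsUnconstrained {n : ℕ} (S : LagSystem n) : Prop :=
  ∃ c : EqChart S, LinearIndependent ℝ
    (fun (i : S.ι) (A : c.A) => vderiv A (fun q => (c.emb q).2 (i, 0)) c.q₀)

/-- Natural systems: equivalent to a first-order system of the above form, whose equations of motion
do not constrain the undifferentiated fields algebraically. -/
def LagSystem.IsNatural {n : ℕ} (S : LagSystem n) : Prop :=
  ∃ S₁ : LagSystem n, LagEquiv S S₁ ∧ S₁.IsFirstOrder ∧ S₁.FieldsUnconstrained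

/-! ## Gauging away -/

/-- `θ`, with inverse `η`, is an invertible change of coordinates near `q₀`, over `x`-space. -/
def IsCoordChange {n : ℕ} {K K' : Type} (θ : Pt n K → Pt n K') (η : Pt n K' → Pt n K)
    (q₀ : Pt n K) : Prop :=
  IsLocalMapAt θ q₀ ∧ IsLocalMapAt η (θ q₀) ∧
    (∀ᶠ q in 𝓝 q₀, η (θ q) = q) ∧ ∀ᶠ r in 𝓝 (θ q₀), θ (η r) = r

/-- The Lagrangian `LC[ψ]`, whose fields are the coordinates `ψ^A` of the equation manifold of `S`,
becomes `S'` upon gauging away shift (Stueckelberg) variables.  That is, after an invertible change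
of the coordinates on the equation manifold these split into the fields `φ^i` of `S'` and further
variables `w^μ` (vanishing at the base point) such that the Euler–Lagrange derivatives of `LC` with
respect to the `w^μ` vanish identically, and setting `w^μ = 0` gives the Lagrangian of `S'`.  The
base point of `S'` is the jet `φ^i_I = D_I φ^i` given by the base point of the equation manifold. -/
def EqChart.GaugesAwayTo {n : ℕ} {S : LagSystem n} (c : EqChart S) (LC : Jet n c.A → ℝ)
    (S' : LagSystem n) : Prop :=
  ∃ (M : Type) (θ : Pt n c.A → Pt n (S'.ι ⊕ M)) (η : Pt n (S'.ι ⊕ M) → Pt n c.A),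
    IsCoordChange θ η c.q₀ ∧
    (∀ μ, (θ c.q₀).2 (Sum.inr μ) = 0) ∧
    let LC' : Jet n (S'.ι ⊕ M) → ℝ := fun p => LC (prolong (fun A p' => (η (jetProj p')).2 A) p)
    (∀ᶠ r in 𝓝 (θ c.q₀), ∀ p, jetProj p = r → ∀ μ, euler LC' (Sum.inr μ) p = 0) ∧
    S'.pt = (c.q₀.1, fun k => iterD c.Y k.2 (fun q => (θ q).2 (Sum.inl k.1)) c.q₀) ∧
    ∀ᶠ p in 𝓝 S'.pt,
      S'.L p = LC' (p.1, fun k => Sum.elim (fun i => p.2 (i, k.2)) (fun _ => 0) k.1)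

end IntrinsicLagrangian

end

/-! The theorem is easy for a first-order Lagrangian `L₁ = V^a_i φ^i_a - H`; the rest of the proof
carries that case over to every natural system.

For `L₁` the form `V^a_i d_vφ^i` is a presymplectic potential. On shell the first variational
formula loses its Euler–Lagrange term and becomes `∑ D_a χ^a = d_v L₁`, which says that the
restriction of `V^a_i d_vφ^i + L₁` is a potential `χ + l` for its own vertical differential. In its
intrinsic Lagrangian `V^a_i (φ^i_a - D_aφ^i) + L₁` the on-shell derivatives `D_aφ^i` cancel against
those in the restriction of `L₁`. What remains is `V^a_i φ^i_a - H` with free `φ^i_a`, in which only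
the functions `φ^i` on the equation manifold occur. Since these are independent, they can be
completed to a coordinate system; the complementary coordinates are the Stueckelberg variables, and
setting them to zero returns `L₁`.

Three facts make this general.

Transport: equivalent Lagrangians have isomorphic stationary surfaces, and presymplectic potentials
correspond up to vertically exact forms (`LagEquiv.areIsomorphic`). The engine is
`IsPresympPotentialAt.transfer`: the variational formula is pulled back along a map commuting with
the `D_a`, and the pulled-back source is integrated by parts. The boundary term so produced vanishes
on shell, because its coefficients are built from total derivatives of equations of motion. The
source part of a variational formula is unique, because the Euler operator kills divergences
(`eulerSum_divForm`).

Uniqueness: two potentials of one `σ` differ by an exact form (`exists_eq_add_of_potentials`), so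
the choice of `χ + l` changes the intrinsic Lagrangian by a total derivative only. This rests on a
vertical Poincaré lemma and, for a leftover function of `x`, on `n ≥ 1`.

Coordinates: independent local functions extend to a chart (`exists_isCoordChange`), by the inverse
function theorem with parameters.

`EqChart.exists_gaugesAwayTo` combines these. Every local function factors through finitely many
coordinates near a point, so the analysis takes place on finite-dimensional spaces. -/

namespace IntrinsicLagrangian

noncomputable section

/-! ## Smooth functions of finitely many variables -/

section FiniteDimensional

/-- A smooth germ on a finite-dimensional space extends to a global smooth function. -/
theorem exists_contDiff_eventuallyEq {E F : Type} [NormedAddCommGroup E] [NormedSpace ℝ E]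
    [FiniteDimensional ℝ E] [NormedAddCommGroup F] [NormedSpace ℝ F] {g : E → F} {y : E}
    (hg : ∀ᶠ z in 𝓝 y, ContDiffAt ℝ ∞ g z) :
    ∃ g' : E → F, ContDiff ℝ ∞ g' ∧ g' =ᶠ[𝓝 y] g := by
  obtain ⟨r, hr, hball⟩ := Metric.eventually_nhds_iff_ball.1 hg
  -- The outer radius stays below `r`, so the product with the bump vanishes near every point
  -- outside the ball on which `g` is smooth.
  let b : ContDiffBump y := ⟨r / 4, r / 2, by positivity, by linarith⟩
  refine ⟨fun z => b z • g z, ?_, ?_⟩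
  · rw [contDiff_iff_contDiffAt]
    intro z
    by_cases hz : z ∈ Metric.ball y r
    · exact b.contDiff.contDiffAt.smul (hball z hz)
    · have hz' : z ∉ tsupport b := by
        rw [b.tsupport_eq, Metric.mem_closedBall]
        rw [Metric.mem_ball] at hz
        have : b.rOut = r / 2 := rfl
        rw [this]
        linarith
      have h0 : (fun z => b z • g z) =ᶠ[𝓝 z] fun _ => 0 := by
        filter_upwards [notMem_tsupport_iff_eventuallyEq.1 hz'] with w hw
        simp [hw]
      exact contDiffAt_const.congr_of_eventuallyEq h0
  · filter_upwards [b.eventuallyEq_one] with z hz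
    simp [hz]

/-- The integral of a smooth function over a parameter interval is smooth. -/
theorem contDiff_intervalIntegral {E F : Type} [NormedAddCommGroup E] [NormedSpace ℝ E]
    [FiniteDimensional ℝ E] [NormedAddCommGroup F] [NormedSpace ℝ F] [CompleteSpace F]
    {f : E × ℝ → F} (hf : ContDiff ℝ ∞ f) :
    ContDiff ℝ ∞ (fun e => ∫ t in (0 : ℝ)..1, f (e, t)) ∧
      ∀ e, HasFDerivAt (fun e => ∫ t in (0 : ℝ)..1, f (e, t))
        (∫ t in (0 : ℝ)..1, (fderiv ℝ f (e, t)).comp (ContinuousLinearMap.inl ℝ E ℝ)) e := by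
  -- The derivative is an integral of the same kind with values in `E →L[ℝ] F`. Allowing every
  -- target space lets the formula be iterated in the induction on the order of smoothness.
  have key : ∀ (F : Type) [NormedAddCommGroup F] [NormedSpace ℝ F] [CompleteSpace F]
      (f : E × ℝ → F), ContDiff ℝ ∞ f → ∀ e,
      HasFDerivAt (fun e => ∫ t in (0 : ℝ)..1, f (e, t))
        (∫ t in (0 : ℝ)..1, (fderiv ℝ f (e, t)).comp (ContinuousLinearMap.inl ℝ E ℝ)) e := by
    intro F _ _ _ f hf e
    have hc : Continuous f := hf.continuous
    have hd : Continuous (fun z : E × ℝ =>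
        (fderiv ℝ f z).comp (ContinuousLinearMap.inl ℝ E ℝ)) :=
      (hf.continuous_fderiv (by simp)).clm_comp continuous_const
    have : ProperSpace E := FiniteDimensional.proper ℝ E
    obtain ⟨C, hC⟩ := ((isCompact_closedBall e 1).prod (isCompact_Icc (a := (0 : ℝ))
      (b := 1))).exists_bound_of_continuousOn hd.continuousOn
    refine (intervalIntegral.hasFDerivAt_integral_of_dominated_of_fderiv_le
      (F := fun e t => f (e, t)) (bound := fun _ => C)
      (F' := fun e t => (fderiv ℝ f (e, t)).comp (ContinuousLinearMap.inl ℝ E ℝ))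
      (Metric.closedBall_mem_nhds e one_pos) ?_ ?_ ?_ ?_ ?_ ?_)
    · exact Eventually.of_forall fun x =>
        (hc.comp (Continuous.prodMk_right x)).aestronglyMeasurable
    · exact (hc.comp (Continuous.prodMk_right e)).intervalIntegrable _ _
    · exact (hd.comp (Continuous.prodMk_right e)).aestronglyMeasurable
    · refine Eventually.of_forall fun t ht x hx => hC (x, t) ⟨hx, ?_⟩
      rw [Set.uIoc_of_le zero_le_one] at ht
      exact ⟨ht.1.le, ht.2⟩
    · exact intervalIntegrable_const
    · refine Eventually.of_forall fun t _ x _ => ?_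
      have h1 : HasFDerivAt f (fderiv ℝ f (x, t)) (x, t) :=
        (hf.differentiable (by simp) _).hasFDerivAt
      exact h1.comp x (hasFDerivAt_prodMk_left x t)
  refine ⟨?_, key F f hf⟩
  rw [contDiff_infty]
  intro m
  have : ∀ (m : ℕ) (F : Type) [NormedAddCommGroup F] [NormedSpace ℝ F] [CompleteSpace F]
      (f : E × ℝ → F), ContDiff ℝ ∞ f →
      ContDiff ℝ m (fun e => ∫ t in (0 : ℝ)..1, f (e, t)) := by
    intro m
    induction m with
    | zero =>
      intro F _ _ _ f hf
      exact contDiff_zero.2 (continuous_iff_continuousAt.2 fun e =>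
        (key F f hf e).continuousAt)
    | succ m ih =>
      intro F _ _ _ f hf
      have := (contDiff_succ_iff_hasFDerivAt (𝕜 := ℝ) (n := m)
        (f := fun e => ∫ t in (0 : ℝ)..1, f (e, t))).2
        ⟨_, ih _ (fun z => (fderiv ℝ f z).comp (ContinuousLinearMap.inl ℝ E ℝ))
          ((hf.fderiv_right (by simp)).clm_comp contDiff_const), key F f hf⟩
      exact_mod_cast this
  exact this m F f hf

/-- The Poincaré lemma along the range of a projection `P`: the remaining variables are
parameters. -/
theorem exists_primitive_along {E : Type} [NormedAddCommGroup E] [NormedSpace ℝ E]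
    [FiniteDimensional ℝ E] {α : E → E →L[ℝ] ℝ} (hα : ContDiff ℝ ∞ α) (P : E →L[ℝ] E)
    (hP : ∀ v, P (P v) = P v) (e₀ : E)
    (hclosed : ∀ᶠ e in 𝓝 e₀, ∀ u v, fderiv ℝ α e (P u) (P v) = fderiv ℝ α e (P v) (P u)) :
    ∃ J : E → ℝ, ContDiff ℝ ∞ J ∧ ∀ᶠ e in 𝓝 e₀, ∀ v, fderiv ℝ J e (P v) = α e (P v) := by
  -- The homotopy moves only along the range of `P`: `h (e, 1) = e`, while `h (e, 0)` has the
  -- `P`-component of `e₀`. The primitive is the integral of `α` along this path.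
  let h : E × ℝ → E := fun z => z.1 - (1 - z.2) • P (z.1 - e₀)
  have hh : ContDiff ℝ ∞ h := by fun_prop
  have hf : ContDiff ℝ ∞ (fun z : E × ℝ => α (h z) (P (z.1 - e₀))) :=
    (hα.comp hh).clm_apply (by fun_prop)
  obtain ⟨h1, h2⟩ := contDiff_intervalIntegral hf
  refine ⟨_, h1, ?_⟩
  -- Closedness is needed along the whole path from `e`. It holds for `e` near `e₀` because `h (e₀,
  -- t) = e₀` for all `t` and `[0, 1]` is compact.
  have hnear : ∀ᶠ e in 𝓝 e₀, ∀ t ∈ Set.Icc (0 : ℝ) 1, ∀ u v,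
      fderiv ℝ α (h (e, t)) (P u) (P v) = fderiv ℝ α (h (e, t)) (P v) (P u) := by
    refine isCompact_Icc.eventually_forall_of_forall_eventually fun t _ => ?_
    have : Tendsto h (𝓝 (e₀, t)) (𝓝 e₀) := by
      have := hh.continuous.tendsto (e₀, t)
      simpa [h] using this
    exact this.eventually hclosed
  filter_upwards [hnear] with e he v
  rw [(h2 e).fderiv]
  have hdh : ∀ t, HasFDerivAt h
      (ContinuousLinearMap.fst ℝ E ℝ - ((1 - t) • P.comp (ContinuousLinearMap.fst ℝ E ℝ) +
        (-ContinuousLinearMap.snd ℝ E ℝ).smulRight (P (e - e₀)))) (e, t) := by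
    intro t
    have h1 : HasFDerivAt (fun z : E × ℝ => (1 - z.2)) (-ContinuousLinearMap.snd ℝ E ℝ) (e, t) :=
      (hasFDerivAt_snd).const_sub 1
    have h3 : HasFDerivAt (fun z : E × ℝ => P (z.1 - e₀))
        (P.comp (ContinuousLinearMap.fst ℝ E ℝ)) (e, t) :=
      P.hasFDerivAt.comp (e, t) (hasFDerivAt_fst.sub_const e₀)
    exact hasFDerivAt_fst.sub (h1.smul h3)
  have h_integral : ∀ t, ((fderiv ℝ (fun z : E × ℝ => α (h z) (P (z.1 - e₀))) (e, t)).comp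
      (ContinuousLinearMap.inl ℝ E ℝ)) (P v) =
        fderiv ℝ α (h (e, t)) (t • P v) (P (e - e₀)) + α (h (e, t)) (P v) := by
    intro t
    have h3 : HasFDerivAt (fun z : E × ℝ => P (z.1 - e₀))
        (P.comp (ContinuousLinearMap.fst ℝ E ℝ)) (e, t) :=
      P.hasFDerivAt.comp (e, t) (hasFDerivAt_fst.sub_const e₀)
    have h4 : HasFDerivAt (fun z => α (h z)) _ (e, t) :=
      ((hα.differentiable (by simp) (h (e, t))).hasFDerivAt).comp (e, t) (hdh t)
    rw [(h4.clm_apply h3).fderiv]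
    simp [hP]
    ring
  -- Closedness along `P` turns the derivative of the integrand in the direction `P v` into the
  -- total `t`-derivative of `t * α (h (e, t)) (P v)`.
  have hder : ∀ t ∈ Set.uIcc (0 : ℝ) 1, HasDerivAt (fun t => t * α (h (e, t)) (P v))
      (fderiv ℝ α (h (e, t)) (t • P v) (P (e - e₀)) + α (h (e, t)) (P v)) t := by
    intro t ht
    rw [Set.uIcc_of_le zero_le_one] at ht
    have h5 : HasDerivAt (fun t => h (e, t)) (P (e - e₀)) t := by
      have := (((hasDerivAt_id t).const_sub 1).smul_const (P (e - e₀))).const_sub e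
      simpa [h] using this
    have h6 : HasDerivAt (fun t => α (h (e, t))) (fderiv ℝ α (h (e, t)) (P (e - e₀))) t :=
      ((hα.differentiable (by simp) (h (e, t))).hasFDerivAt).comp_hasDerivAt t h5
    have h7 := (hasDerivAt_id t).mul (h6.clm_apply (hasDerivAt_const t (P v)))
    refine h7.congr_deriv ?_
    simp only [one_mul, id, map_zero, add_zero, map_smul, smul_apply,
      smul_eq_mul, he t ht (e - e₀) v]
    ring
  have hcont : Continuous (fun t => (fderiv ℝ (fun z : E × ℝ => α (h z) (P (z.1 - e₀))) (e, t)).comp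
      (ContinuousLinearMap.inl ℝ E ℝ)) :=
    ((hf.continuous_fderiv (by simp)).comp (Continuous.prodMk_right e)).clm_comp continuous_const
  rw [ContinuousLinearMap.intervalIntegral_apply (hcont.intervalIntegrable _ _)]
  have hcont2 := hcont.clm_apply (continuous_const (y := P v))
  simp only [h_integral] at hcont2 ⊢
  rw [intervalIntegral.integral_eq_sub_of_hasDerivAt hder (hcont2.intervalIntegrable _ _)]
  simp [h]

/-- The inverse function theorem with parameters, for smooth functions. -/
theorem exists_parametric_inverse {P U W : Type} [NormedAddCommGroup P] [NormedSpace ℝ P]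
    [NormedAddCommGroup U] [NormedSpace ℝ U] [NormedAddCommGroup W] [NormedSpace ℝ W]
    [FiniteDimensional ℝ P] [FiniteDimensional ℝ U] [FiniteDimensional ℝ W]
    {h : P × U → W} (hh : ContDiff ℝ ∞ h) (p : P) (u : U)
    (hbij : Function.Bijective (fun v : U => fderiv ℝ h (p, u) (0, v))) :
    ∃ R : P × W → U, ContDiff ℝ ∞ R ∧ R (p, h (p, u)) = u ∧
      (∀ᶠ z in 𝓝 (p, u), R (z.1, h z) = z.2) ∧
      ∀ᶠ z in 𝓝 (p, h (p, u)), h (z.1, R z) = z.2 := by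
  have : CompleteSpace P := FiniteDimensional.complete ℝ P
  have : CompleteSpace U := FiniteDimensional.complete ℝ U
  have : CompleteSpace W := FiniteDimensional.complete ℝ W
  -- Carrying the parameter along as a component reduces the claim to the ordinary inverse function
  -- theorem.
  let H : P × U → P × W := fun z => (z.1, h z)
  have hH : ContDiff ℝ ∞ H := contDiff_fst.prodMk hh
  let L : P × U →L[ℝ] P × W := (ContinuousLinearMap.fst ℝ P U).prod (fderiv ℝ h (p, u))
  have hL : HasFDerivAt H L (p, u) :=
    hasFDerivAt_fst.prodMk (hh.differentiable (by simp) _).hasFDerivAt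
  have hsplit : ∀ a b, fderiv ℝ h (p, u) (a, b) = fderiv ℝ h (p, u) (a, 0) +
      fderiv ℝ h (p, u) (0, b) := by
    intro a b
    rw [← map_add]
    simp
  have hLbij : Function.Bijective L := by
    constructor
    · rintro ⟨a, b⟩ ⟨a', b'⟩ hab
      simp only [L, ContinuousLinearMap.prod_apply, ContinuousLinearMap.coe_fst',
        Prod.mk.injEq] at hab
      obtain ⟨rfl, h2⟩ := hab
      rw [hsplit a b, hsplit a b'] at h2
      rw [hbij.1 (add_left_cancel h2)]
    · rintro ⟨a, w⟩
      obtain ⟨b, hb⟩ := hbij.2 (w - fderiv ℝ h (p, u) (a, 0))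
      refine ⟨(a, b), ?_⟩
      simp only [L, ContinuousLinearMap.prod_apply, ContinuousLinearMap.coe_fst']
      rw [hsplit a b]
      simp only at hb
      rw [hb]
      simp
  let L' : (P × U) ≃L[ℝ] (P × W) := ContinuousLinearEquiv.ofBijective L
    (LinearMap.ker_eq_bot.2 hLbij.1) (LinearMap.range_eq_top.2 hLbij.2)
  have hL' : HasFDerivAt H (L' : P × U →L[ℝ] P × W) (p, u) := hL
  let e := (hH.contDiffAt (x := (p, u))).toOpenPartialHomeomorph H hL' (by simp)
  have hsrc : (p, u) ∈ e.source :=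
    (hH.contDiffAt (x := (p, u))).mem_toOpenPartialHomeomorph_source hL' (by simp)
  have htgt : (p, h (p, u)) ∈ e.target :=
    (hH.contDiffAt (x := (p, u))).image_mem_toOpenPartialHomeomorph_target hL' (by simp)
  have hsymm0 : e.symm (p, h (p, u)) = (p, u) := e.left_inv hsrc
  -- Invertible operators form an open set, so the inverse is smooth on a whole neighbourhood and
  -- not only at one point; this is what the global extension of its second component requires.
  have hinv : ∀ᶠ z in 𝓝 (p, u), ∃ M : (P × U) ≃L[ℝ] (P × W),
      (M : P × U →L[ℝ] P × W) = fderiv ℝ H z := by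
    have hc : Tendsto (fderiv ℝ H) (𝓝 (p, u)) (𝓝 (L' : P × U →L[ℝ] P × W)) := by
      rw [← hL'.fderiv]
      exact (hH.continuous_fderiv (by simp)).tendsto _
    exact hc.eventually (ContinuousLinearEquiv.nhds L')
  have hsm : ∀ᶠ z in 𝓝 (p, h (p, u)), ContDiffAt ℝ ∞ e.symm z := by
    have hc : Tendsto e.symm (𝓝 (p, h (p, u))) (𝓝 (p, u)) := by
      have := e.continuousAt_symm htgt
      rw [ContinuousAt, hsymm0] at this
      exact this
    filter_upwards [hc.eventually hinv, e.open_target.mem_nhds htgt] with z ⟨M, hM⟩ hz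
    refine e.contDiffAt_symm (f₀' := M) hz ?_ hH.contDiffAt
    rw [hM]
    exact (hH.differentiable (by simp) _).hasFDerivAt
  obtain ⟨R, hR, hRe⟩ := exists_contDiff_eventuallyEq (hsm.mono fun z hz => hz.snd)
  have hHt : Tendsto H (𝓝 (p, u)) (𝓝 (p, h (p, u))) := hH.continuous.tendsto _
  refine ⟨R, hR, ?_, ?_, ?_⟩
  · rw [hRe.eq_of_nhds, hsymm0]
  · filter_upwards [hHt.eventually hRe, e.open_source.mem_nhds hsrc] with z h1 h2
    change R (H z) = _
    rw [h1]
    have : e.symm (H z) = z := e.left_inv h2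
    rw [this]
  · filter_upwards [hRe, e.open_target.mem_nhds htgt] with z h1 h2
    have h3 : H (e.symm z) = z := e.right_inv h2
    have h4 : (e.symm z).1 = z.1 := congrArg Prod.fst h3
    rw [h1, ← h4]
    exact congrArg Prod.snd h3

end FiniteDimensional

/-! ## Calculus of local functions -/

section LocalFunctions

variable {n : ℕ} {K K' : Type} {p : Pt n K}

/-- The projection to the independent variables and finitely many fibre coordinates. -/
def proj (s : Finset K) : Pt n K →L[ℝ] (Fin n → ℝ) × (s → ℝ) :=
  (ContinuousLinearMap.fst ℝ _ _).prod
    (ContinuousLinearMap.pi fun A : s =>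
      (ContinuousLinearMap.proj (R := ℝ) (φ := fun _ : K => ℝ) A.1).comp
        (ContinuousLinearMap.snd ℝ _ _))

theorem proj_apply (s : Finset K) (q : Pt n K) : proj s q = (q.1, fun A : s => q.2 A) := rfl

/-- The projection has a continuous section through `p`, which freezes the remaining coordinates at
their values at `p`. -/
theorem eventually_nhds_proj {s : Finset K} {P : (Fin n → ℝ) × (s → ℝ) → Prop}
    (h : ∀ᶠ q in 𝓝 p, P (proj s q)) : ∀ᶠ y in 𝓝 (proj s p), P y := by
  classical
  let j : (Fin n → ℝ) × (s → ℝ) → Pt n K :=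
    fun z => (z.1, fun A => if h : A ∈ s then z.2 ⟨A, h⟩ else p.2 A)
  have hj : Continuous j := by
    refine continuous_fst.prodMk (continuous_pi fun A => ?_)
    by_cases h : A ∈ s
    · simp only [h, dite_true]
      exact (continuous_apply _).comp continuous_snd
    · simp only [h, dite_false]
      exact continuous_const
  have hjp : j (proj s p) = p := by
    ext <;> simp [j, proj_apply]
  have ht : Tendsto j (𝓝 (proj s p)) (𝓝 p) := by
    have := hj.tendsto (proj s p)
    rwa [hjp] at this
  filter_upwards [ht.eventually h] with z hz
  have hpj : proj s (j z) = z := by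
    ext <;> simp [j, proj_apply]
  rwa [hpj] at hz

/-- `F` coincides near `p` with a smooth function of the `x^a` and finitely many fibre
coordinates. -/
def IsCylindricalAt {E : Type} [NormedAddCommGroup E] [NormedSpace ℝ E] (F : Pt n K → E)
    (p : Pt n K) : Prop :=
  ∃ (s : Finset K) (g : (Fin n → ℝ) × (s → ℝ) → E),
    ContDiff ℝ ∞ g ∧ F =ᶠ[𝓝 p] fun q => g (proj s q)

section Cylindrical

variable {E E' : Type} [NormedAddCommGroup E] [NormedSpace ℝ E] [NormedAddCommGroup E']
  [NormedSpace ℝ E']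

/-- Cutting off the germ yields a representative that is smooth on the entire finite-dimensional
space, so that domains of smoothness need not be tracked afterwards. -/
theorem isLocalAt_iff {f : Pt n K → ℝ} : IsLocalAt f p ↔ IsCylindricalAt f p := by
  constructor
  · rintro ⟨s, g, h⟩
    obtain ⟨g', hg', he⟩ := exists_contDiff_eventuallyEq
      (eventually_nhds_proj (h.mono fun q hq => hq.1))
    refine ⟨s, g', hg', ?_⟩
    filter_upwards [h, (proj s).continuous.continuousAt.eventually he] with q h1 h2
    rw [h1.2, h2]
    rfl
  · rintro ⟨s, g, hg, h⟩
    exact ⟨s, g, h.mono fun q hq => ⟨hg.contDiffAt, hq⟩⟩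

namespace IsCylindricalAt

variable {F F' : Pt n K → E}

theorem eventually (h : IsCylindricalAt F p) : ∀ᶠ q in 𝓝 p, IsCylindricalAt F q := by
  obtain ⟨s, g, hg, he⟩ := h
  exact he.eventually_nhds.mono fun q hq => ⟨s, g, hg, hq⟩

theorem congr (h : IsCylindricalAt F p) (he : F' =ᶠ[𝓝 p] F) : IsCylindricalAt F' p := by
  obtain ⟨s, g, hg, he'⟩ := h
  exact ⟨s, g, hg, he.trans he'⟩

theorem mono {s t : Finset K} (hst : s ⊆ t) {g : (Fin n → ℝ) × (s → ℝ) → E}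
    (hg : ContDiff ℝ ∞ g) :
    ∃ g' : (Fin n → ℝ) × (t → ℝ) → E, ContDiff ℝ ∞ g' ∧ ∀ q, g' (proj t q) = g (proj s q) := by
  refine ⟨fun z => g (z.1, fun A => z.2 ⟨A.1, hst A.2⟩), ?_, fun q => rfl⟩
  exact hg.comp (by fun_prop)

theorem continuousAt (h : IsCylindricalAt F p) : ContinuousAt F p := by
  obtain ⟨s, g, hg, he⟩ := h
  exact (hg.continuous.comp (proj s).continuous).continuousAt.congr he.symm

theorem comp {h : E → E'} (hh : ContDiff ℝ ∞ h) (hF : IsCylindricalAt F p) :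
    IsCylindricalAt (fun q => h (F q)) p := by
  obtain ⟨s, g, hg, he⟩ := hF
  exact ⟨s, fun y => h (g y), hh.comp hg, he.mono fun q hq => by simp only [hq]⟩

theorem prodMk {G : Pt n K → E'} (hF : IsCylindricalAt F p) (hG : IsCylindricalAt G p) :
    IsCylindricalAt (fun q => (F q, G q)) p := by
  classical
  obtain ⟨s, f, hf, hfe⟩ := hF
  obtain ⟨t, g, hg, hge⟩ := hG
  obtain ⟨f', hf', hf'e⟩ := mono (t := s ∪ t) Finset.subset_union_left hf
  obtain ⟨g', hg', hg'e⟩ := mono (t := s ∪ t) Finset.subset_union_right hg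
  refine ⟨s ∪ t, fun y => (f' y, g' y), hf'.prodMk hg', ?_⟩
  filter_upwards [hfe, hge] with q h1 h2
  rw [h1, h2, hf'e, hg'e]

theorem pi {ι : Type} [Fintype ι] {F : ι → Pt n K → E} (hF : ∀ i, IsCylindricalAt (F i) p) :
    IsCylindricalAt (fun q i => F i q) p := by
  classical
  choose s g hg he using hF
  choose g' hg' hg'e using fun i =>
    mono (t := Finset.univ.biUnion s) (Finset.subset_biUnion_of_mem s (Finset.mem_univ i)) (hg i)
  refine ⟨Finset.univ.biUnion s, fun y i => g' i y, contDiff_pi.2 hg', ?_⟩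
  filter_upwards [eventually_all.2 he] with q hq
  ext i
  rw [hq i, hg'e]

theorem const (c : E) : IsCylindricalAt (fun _ : Pt n K => c) p :=
  ⟨∅, fun _ => c, contDiff_const, .rfl⟩

theorem fst : IsCylindricalAt (fun q : Pt n K => q.1) p :=
  ⟨∅, fun y => y.1, contDiff_fst, .rfl⟩

theorem coord (A : K) : IsCylindricalAt (fun q : Pt n K => q.2 A) p :=
  ⟨{A}, fun y => y.2 ⟨A, Finset.mem_singleton_self A⟩, by fun_prop, .rfl⟩

end IsCylindricalAt

end Cylindrical

variable {f f' g : Pt n K → ℝ}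

theorem tendsto_line (p v : Pt n K) : Tendsto (fun t : ℝ => p + t • v) (𝓝 0) (𝓝 p) := by
  have : Continuous (fun t : ℝ => p + t • v) := by fun_prop
  simpa using this.tendsto 0

theorem lineDeriv_congr {v : Pt n K} (h : f =ᶠ[𝓝 p] f') : lineDeriv ℝ f p v = lineDeriv ℝ f' p v :=
  Filter.EventuallyEq.deriv_eq ((tendsto_line p v).eventually h)

/-- For infinite `K` the space `Pt n K` carries no norm and only line derivatives are at hand.
Linearity in the direction, the chain rule and the symmetry of second derivatives are all imported
from the Fréchet derivative of `g` through this identity. -/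
theorem hasLineDerivAt_of_eventuallyEq {E : Type} [NormedAddCommGroup E] [NormedSpace ℝ E]
    {F : Pt n K → E} {s : Finset K} {g : (Fin n → ℝ) × (s → ℝ) → E}
    (hg : ContDiff ℝ ∞ g) (he : F =ᶠ[𝓝 p] fun q => g (proj s q)) (v : Pt n K) :
    HasLineDerivAt ℝ F (fderiv ℝ g (proj s p) (proj s v)) p v := by
  have h1 : HasDerivAt (fun t : ℝ => proj s (p + t • v)) (proj s v) 0 := by
    have := ((hasDerivAt_id (0 : ℝ)).smul_const (proj s v)).const_add (proj s p)
    simpa using this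
  have h2 : HasFDerivAt g (fderiv ℝ g (proj s p)) (proj s (p + (0 : ℝ) • v)) := by
    simpa using (hg.differentiable (by simp) (proj s p)).hasFDerivAt
  exact (h2.comp_hasDerivAt 0 h1).congr_of_eventuallyEq ((tendsto_line p v).eventually he)

namespace IsLocalAt

theorem eventually (h : IsLocalAt f p) : ∀ᶠ q in 𝓝 p, IsLocalAt f q := by
  simp only [isLocalAt_iff] at h ⊢
  exact h.eventually

theorem congr (h : IsLocalAt f p) (he : f' =ᶠ[𝓝 p] f) : IsLocalAt f' p :=
  isLocalAt_iff.2 ((isLocalAt_iff.1 h).congr he)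

theorem continuousAt (h : IsLocalAt f p) : ContinuousAt f p :=
  (isLocalAt_iff.1 h).continuousAt

theorem const (c : ℝ) : IsLocalAt (fun _ : Pt n K => c) p := isLocalAt_iff.2 (.const c)

theorem coord (A : K) : IsLocalAt (fun q : Pt n K => q.2 A) p := isLocalAt_iff.2 (.coord A)

theorem of_fst {k : (Fin n → ℝ) → ℝ} (hk : ∀ᶠ x in 𝓝 p.1, ContDiffAt ℝ ∞ k x) :
    IsLocalAt (fun q : Pt n K => k q.1) p := by
  obtain ⟨k', hk', he⟩ := exists_contDiff_eventuallyEq hk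
  refine (isLocalAt_iff.2 (IsCylindricalAt.fst.comp hk')).congr ?_
  exact (continuous_fst.continuousAt.eventually he).mono fun q hq => hq.symm

theorem add (hf : IsLocalAt f p) (hg : IsLocalAt g p) : IsLocalAt (fun q => f q + g q) p :=
  isLocalAt_iff.2 (((isLocalAt_iff.1 hf).prodMk (isLocalAt_iff.1 hg)).comp
    (contDiff_fst.add contDiff_snd))

theorem mul (hf : IsLocalAt f p) (hg : IsLocalAt g p) : IsLocalAt (fun q => f q * g q) p :=
  isLocalAt_iff.2 (((isLocalAt_iff.1 hf).prodMk (isLocalAt_iff.1 hg)).comp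
    (contDiff_fst.mul contDiff_snd))

theorem neg (hf : IsLocalAt f p) : IsLocalAt (fun q => -f q) p :=
  isLocalAt_iff.2 ((isLocalAt_iff.1 hf).comp contDiff_neg)

theorem sub (hf : IsLocalAt f p) (hg : IsLocalAt g p) : IsLocalAt (fun q => f q - g q) p := by
  simpa only [sub_eq_add_neg] using hf.add hg.neg

theorem sum {ι : Type} {s : Finset ι} {f : ι → Pt n K → ℝ} (hf : ∀ i ∈ s, IsLocalAt (f i) p) :
    IsLocalAt (fun q => ∑ i ∈ s, f i q) p := by
  classical
  induction s using Finset.induction_on with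
  | empty => simpa using const 0
  | insert i s hi ih =>
    simp only [Finset.sum_insert hi]
    exact (hf i (Finset.mem_insert_self i s)).add
      (ih fun j hj => hf j (Finset.mem_insert_of_mem hj))

theorem hasLineDerivAt (h : IsLocalAt f p) (v : Pt n K) :
    HasLineDerivAt ℝ f (lineDeriv ℝ f p v) p v := by
  obtain ⟨s, g, hg, he⟩ := isLocalAt_iff.1 h
  have := hasLineDerivAt_of_eventuallyEq hg he v
  rwa [this.lineDeriv]

theorem lineDeriv_add_right (h : IsLocalAt f p) (v w : Pt n K) :
    lineDeriv ℝ f p (v + w) = lineDeriv ℝ f p v + lineDeriv ℝ f p w := by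
  obtain ⟨s, g, hg, he⟩ := isLocalAt_iff.1 h
  simp only [(hasLineDerivAt_of_eventuallyEq hg he _).lineDeriv, map_add]

theorem lineDeriv_sub_right (h : IsLocalAt f p) (v w : Pt n K) :
    lineDeriv ℝ f p (v - w) = lineDeriv ℝ f p v - lineDeriv ℝ f p w := by
  obtain ⟨s, g, hg, he⟩ := isLocalAt_iff.1 h
  simp only [(hasLineDerivAt_of_eventuallyEq hg he _).lineDeriv, map_sub]

/-- Derivatives along vector fields with local components are local. -/
theorem lineDeriv_field (h : IsLocalAt f p) {X : Pt n K → Pt n K}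
    (h1 : ∀ a, IsLocalAt (fun q => (X q).1 a) p) (h2 : ∀ A, IsLocalAt (fun q => (X q).2 A) p) :
    IsLocalAt (fun q => lineDeriv ℝ f q (X q)) p := by
  obtain ⟨s, g, hg, he⟩ := isLocalAt_iff.1 h
  have hX : IsCylindricalAt (fun q => proj s (X q)) p :=
    (IsCylindricalAt.pi fun a => isLocalAt_iff.1 (h1 a)).prodMk
      (IsCylindricalAt.pi fun A : s => isLocalAt_iff.1 (h2 A))
  have hp : IsCylindricalAt (fun q => proj s q) p := ⟨s, fun y => y, contDiff_id, .rfl⟩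
  refine isLocalAt_iff.2 (((hp.prodMk hX).comp
    (h := fun z => fderiv ℝ g z.1 z.2) ?_).congr ?_)
  · exact ((hg.fderiv_right (by simp)).comp contDiff_fst).clm_apply contDiff_snd
  · filter_upwards [he.eventually_nhds] with q hq
    exact (hasLineDerivAt_of_eventuallyEq hg hq _).lineDeriv

protected theorem vderiv (h : IsLocalAt f p) (A : K) : IsLocalAt (vderiv A f) p := by
  classical
  exact h.lineDeriv_field (fun _ => const _) (fun _ => const _)

protected theorem totalD (h : IsLocalAt f p) {Y : Fin n → K → Pt n K → ℝ}
    (hY : ∀ a A, IsLocalAt (Y a A) p) (a : Fin n) : IsLocalAt (totalD Y a f) p :=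
  h.lineDeriv_field (fun _ => const _) (fun A => hY a A)

end IsLocalAt

theorem lineDeriv_mul (hf : IsLocalAt f p) (hg : IsLocalAt g p) (v : Pt n K) :
    lineDeriv ℝ (fun q => f q * g q) p v =
      lineDeriv ℝ f p v * g p + f p * lineDeriv ℝ g p v := by
  have h := (hf.hasLineDerivAt v).mul (hg.hasLineDerivAt v)
  simp only [zero_smul, add_zero] at h
  exact HasLineDerivAt.lineDeriv h

theorem lineDeriv_add (hf : IsLocalAt f p) (hg : IsLocalAt g p) (v : Pt n K) :
    lineDeriv ℝ (fun q => f q + g q) p v = lineDeriv ℝ f p v + lineDeriv ℝ g p v :=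
  HasLineDerivAt.lineDeriv ((hf.hasLineDerivAt v).add (hg.hasLineDerivAt v))

theorem lineDeriv_const_fun (c : ℝ) (v : Pt n K) : lineDeriv ℝ (fun _ : Pt n K => c) p v = 0 := by
  simp [lineDeriv]

theorem lineDeriv_neg_fun (f : Pt n K → ℝ) (v : Pt n K) :
    lineDeriv ℝ (fun q => -f q) p v = -lineDeriv ℝ f p v := by
  simp [lineDeriv]

theorem lineDeriv_sub (hf : IsLocalAt f p) (hg : IsLocalAt g p) (v : Pt n K) :
    lineDeriv ℝ (fun q => f q - g q) p v = lineDeriv ℝ f p v - lineDeriv ℝ g p v :=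
  HasLineDerivAt.lineDeriv ((hf.hasLineDerivAt v).sub (hg.hasLineDerivAt v))

theorem lineDeriv_sum {ι : Type} {s : Finset ι} {f : ι → Pt n K → ℝ}
    (hf : ∀ i ∈ s, IsLocalAt (f i) p) (v : Pt n K) :
    lineDeriv ℝ (fun q => ∑ i ∈ s, f i q) p v = ∑ i ∈ s, lineDeriv ℝ (f i) p v :=
  HasLineDerivAt.lineDeriv (HasDerivAt.fun_sum fun i hi => (hf i hi).hasLineDerivAt v)

theorem lineDeriv_coord (A : K) (v : Pt n K) : lineDeriv ℝ (fun q : Pt n K => q.2 A) p v = v.2 A := by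
  have : HasDerivAt (fun t : ℝ => (p + t • v).2 A) (v.2 A) 0 := by
    simpa using ((hasDerivAt_id (0 : ℝ)).mul_const (v.2 A)).const_add (p.2 A)
  exact HasLineDerivAt.lineDeriv this

theorem vderiv_coord [DecidableEq K] (A B : K) :
    vderiv B (fun q : Pt n K => q.2 A) p = if A = B then 1 else 0 := by
  rw [vderiv, lineDeriv_coord]
  simp [Pi.single_apply]

theorem totalD_coord (Y : Fin n → K → Pt n K → ℝ) (a : Fin n) (A : K) :
    totalD Y a (fun q : Pt n K => q.2 A) p = Y a A p :=
  lineDeriv_coord A _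

/-- The derivative along an arbitrary vector in terms of partial derivatives. -/
theorem IsLocalAt.exists_lineDeriv_eq_sum (hf : IsLocalAt f p) :
    ∃ s : Finset K, ∀ᶠ q in 𝓝 p, (∀ A ∉ s, vderiv A f q = 0) ∧
      ∀ v : K → ℝ, lineDeriv ℝ f q (0, v) = ∑ A ∈ s, v A * vderiv A f q := by
  classical
  obtain ⟨s, g, hg, he⟩ := isLocalAt_iff.1 hf
  refine ⟨s, he.eventually_nhds.mono fun q hq => ⟨fun A hA => ?_, fun v => ?_⟩⟩
  · have : proj s ((0, Pi.single A 1) : Pt n K) = 0 := by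
      rw [proj_apply]
      ext B
      · rfl
      · have : (B : K) ≠ A := fun h => hA (h ▸ B.2)
        simp [this]
    rw [vderiv, (hasLineDerivAt_of_eventuallyEq hg hq _).lineDeriv]
    convert map_zero (fderiv ℝ g (proj s q))
  · have : proj s ((0, v) : Pt n K) =
        ∑ A ∈ s, v A • proj s ((0, Pi.single A 1) : Pt n K) := by
      simp only [← map_smul, ← map_sum]
      ext B
      · simp [proj_apply, Prod.fst_sum]
      · simp [proj_apply, Prod.snd_sum, Finset.sum_apply, Pi.single_apply]
    rw [(hasLineDerivAt_of_eventuallyEq hg hq _).lineDeriv, this, map_sum]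
    refine Finset.sum_congr rfl fun A _ => ?_
    rw [map_smul, vderiv, (hasLineDerivAt_of_eventuallyEq hg hq _).lineDeriv, smul_eq_mul]

theorem IsLocalAt.finite_support_vderiv (hf : IsLocalAt f p) :
    (Function.support fun A => vderiv A f p).Finite := by
  obtain ⟨s, hs⟩ := hf.exists_lineDeriv_eq_sum
  exact s.finite_toSet.subset fun A hA => by
    by_contra h
    exact hA (hs.self_of_nhds.1 A h)

theorem IsLocalAt.lineDeriv_eq_finsum (hf : IsLocalAt f p) (v : K → ℝ) :
    lineDeriv ℝ f p (0, v) = ∑ᶠ A, v A * vderiv A f p := by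
  obtain ⟨s, hs⟩ := hf.exists_lineDeriv_eq_sum
  rw [hs.self_of_nhds.2, finsum_eq_sum_of_support_subset]
  intro A hA
  by_contra h
  exact hA (by simp [hs.self_of_nhds.1 A h])

/-- The commutator of a vector field with local components and a coordinate vector field. -/
theorem lineDeriv_field_comm (hf : IsLocalAt f p) {X : K → Pt n K → ℝ}
    (hX : ∀ A, IsLocalAt (X A) p) (c : Fin n → ℝ) (w : Pt n K) :
    lineDeriv ℝ (fun q => lineDeriv ℝ f q (c, fun A => X A q)) p w =
      lineDeriv ℝ (fun q => lineDeriv ℝ f q w) p (c, fun A => X A p) +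
        lineDeriv ℝ f p (0, fun A => lineDeriv ℝ (X A) p w) := by
  obtain ⟨s, g, hg, he⟩ := isLocalAt_iff.1 hf
  have hd : ContDiff ℝ ∞ (fderiv ℝ g) := hg.fderiv_right (by simp)
  have hdg : ∀ v, HasDerivAt (fun t : ℝ => fderiv ℝ g (proj s (p + t • v)))
      (fderiv ℝ (fderiv ℝ g) (proj s p) (proj s v)) 0 := fun v =>
    hasLineDerivAt_of_eventuallyEq (F := fun q => fderiv ℝ g (proj s q)) hd .rfl v
  have hXd : HasDerivAt (fun t : ℝ => ((c, fun A : s => X A (p + t • w)) : (Fin n → ℝ) × (s → ℝ)))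
      (0, fun A : s => lineDeriv ℝ (X A) p w) 0 :=
    (hasDerivAt_const _ _).prodMk (hasDerivAt_pi.2 fun A => (hX A).hasLineDerivAt w)
  have h1 : lineDeriv ℝ (fun q => lineDeriv ℝ f q (c, fun A => X A q)) p w =
      fderiv ℝ (fderiv ℝ g) (proj s p) (proj s w) (c, fun A : s => X A p) +
        fderiv ℝ g (proj s p) (0, fun A : s => lineDeriv ℝ (X A) p w) := by
    have e : (fun q => lineDeriv ℝ f q (c, fun A => X A q)) =ᶠ[𝓝 p]
        fun q => fderiv ℝ g (proj s q) (c, fun A : s => X A q) :=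
      he.eventually_nhds.mono fun q hq => (hasLineDerivAt_of_eventuallyEq hg hq _).lineDeriv
    rw [lineDeriv_congr e]
    have := (hdg w).clm_apply hXd
    simp only [zero_smul, add_zero] at this
    exact HasLineDerivAt.lineDeriv this
  have h2 : lineDeriv ℝ (fun q => lineDeriv ℝ f q w) p (c, fun A => X A p) =
      fderiv ℝ (fderiv ℝ g) (proj s p) (c, fun A : s => X A p) (proj s w) := by
    have e : (fun q => lineDeriv ℝ f q w) =ᶠ[𝓝 p] fun q => fderiv ℝ g (proj s q) (proj s w) :=
      he.eventually_nhds.mono fun q hq => (hasLineDerivAt_of_eventuallyEq hg hq _).lineDeriv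
    rw [lineDeriv_congr e]
    have := (hdg (c, fun A => X A p)).clm_apply (hasDerivAt_const _ (proj s w))
    simp only [map_zero, add_zero] at this
    exact HasLineDerivAt.lineDeriv this
  rw [h1, h2, (hasLineDerivAt_of_eventuallyEq hg he _).lineDeriv]
  have hsymm : IsSymmSndFDerivAt ℝ g (proj s p) :=
    hg.contDiffAt.isSymmSndFDerivAt (by
      rw [minSmoothness_of_isRCLikeNormedField]
      exact WithTop.coe_le_coe.2 le_top)
  rw [hsymm (proj s w)]
  rfl

theorem lineDeriv_comm (hf : IsLocalAt f p) (v w : Pt n K) :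
    lineDeriv ℝ (fun q => lineDeriv ℝ f q v) p w =
      lineDeriv ℝ (fun q => lineDeriv ℝ f q w) p v := by
  have := lineDeriv_field_comm hf (X := fun A _ => v.2 A) (fun A => .const _) v.1 w
  simpa only [lineDeriv_const_fun, Prod.mk.eta, show ((0, fun _ => 0) : Pt n K) = 0 from rfl,
    lineDeriv_zero, add_zero] using this

/-! ### Maps with local components -/

section Maps

variable {Φ : Pt n K → Pt n K'} {h : Pt n K' → ℝ}

theorem IsLocalMapAt.eventually (hΦ : IsLocalMapAt Φ p) : ∀ᶠ q in 𝓝 p, IsLocalMapAt Φ q :=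
  hΦ.eventually_nhds

theorem IsLocalMapAt.fst_eq (hΦ : IsLocalMapAt Φ p) : (Φ p).1 = p.1 :=
  hΦ.self_of_nhds.1

theorem IsLocalMapAt.component (hΦ : IsLocalMapAt Φ p) (k : K') :
    IsLocalAt (fun r => (Φ r).2 k) p :=
  hΦ.self_of_nhds.2 k

theorem IsLocalMapAt.continuousAt (hΦ : IsLocalMapAt Φ p) : ContinuousAt Φ p := by
  have h1 : ContinuousAt (fun q => (Φ q).1) p :=
    continuousAt_fst.congr (hΦ.mono fun q hq => hq.1.symm)
  exact h1.prodMk (continuousAt_pi.2 fun k => (hΦ.component k).continuousAt)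

theorem IsLocalMapAt.isCylindricalAt_proj (hΦ : IsLocalMapAt Φ p) (s : Finset K') :
    IsCylindricalAt (fun q => proj s (Φ q)) p :=
  (IsCylindricalAt.fst.congr (hΦ.mono fun _ hq => hq.1)).prodMk
    (IsCylindricalAt.pi fun A : s => isLocalAt_iff.1 (hΦ.component A))

theorem IsLocalAt.comp_map (hΦ : IsLocalMapAt Φ p) (hh : IsLocalAt h (Φ p)) :
    IsLocalAt (fun q => h (Φ q)) p := by
  obtain ⟨s, g, hg, he⟩ := isLocalAt_iff.1 hh
  exact isLocalAt_iff.2 (((hΦ.isCylindricalAt_proj s).comp hg).congr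
    (hΦ.continuousAt.eventually he))

/-- The chain rule. -/
theorem lineDeriv_comp_map (hΦ : IsLocalMapAt Φ p) (hh : IsLocalAt h (Φ p)) (v : Pt n K) :
    lineDeriv ℝ (fun q => h (Φ q)) p v =
      lineDeriv ℝ h (Φ p) (v.1, fun k => lineDeriv ℝ (fun r => (Φ r).2 k) p v) := by
  obtain ⟨s, g, hg, he⟩ := isLocalAt_iff.1 hh
  rw [(hasLineDerivAt_of_eventuallyEq hg he _).lineDeriv]
  rw [lineDeriv_congr (f' := fun q => g (proj s (Φ q))) (hΦ.continuousAt.eventually he)]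
  have h1 : HasDerivAt (fun t : ℝ => (Φ (p + t • v)).1) v.1 0 := by
    have : HasDerivAt (fun t : ℝ => (p + t • v).1) v.1 0 := by
      simpa using ((hasDerivAt_id (0 : ℝ)).smul_const v.1).const_add p.1
    exact this.congr_of_eventuallyEq ((tendsto_line p v).eventually (hΦ.mono fun _ hq => hq.1))
  have h2 : HasDerivAt (fun t : ℝ => proj s (Φ (p + t • v)))
      (v.1, fun k : s => lineDeriv ℝ (fun r => (Φ r).2 k) p v) 0 :=
    h1.prodMk (hasDerivAt_pi.2 fun k : s => (hΦ.component k).hasLineDerivAt v)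
  have h3 : HasFDerivAt g (fderiv ℝ g (proj s (Φ p))) (proj s (Φ (p + (0 : ℝ) • v))) := by
    simpa using (hg.differentiable (by simp) (proj s (Φ p))).hasFDerivAt
  exact HasLineDerivAt.lineDeriv (h3.comp_hasDerivAt 0 h2)

theorem vderiv_comp_map (hΦ : IsLocalMapAt Φ p) (hh : IsLocalAt h (Φ p)) (B : K) :
    vderiv B (fun q => h (Φ q)) p =
      ∑ᶠ k, vderiv k h (Φ p) * vderiv B (fun r => (Φ r).2 k) p := by
  rw [vderiv, lineDeriv_comp_map hΦ hh, hh.lineDeriv_eq_finsum]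
  exact finsum_congr fun k => mul_comm _ _

theorem IsLocalMapAt.comp {K'' : Type} {Ψ : Pt n K' → Pt n K''} (hΨ : IsLocalMapAt Ψ (Φ p))
    (hΦ : IsLocalMapAt Φ p) : IsLocalMapAt (fun q => Ψ (Φ q)) p := by
  filter_upwards [hΦ.eventually, hΦ.continuousAt.eventually hΨ.eventually] with q h1 h2
  exact ⟨h2.fst_eq.trans h1.fst_eq, fun k => (h2.component k).comp_map h1⟩

end Maps

end LocalFunctions

/-! ## Total derivatives and local forms -/

section Fields

variable {n : ℕ} {K K' K'' : Type} {p : Pt n K} {f f' g : Pt n K → ℝ}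
  {Y : Fin n → K → Pt n K → ℝ} {Y' : Fin n → K' → Pt n K' → ℝ} {Y'' : Fin n → K'' → Pt n K'' → ℝ}

/-- The components of the total derivatives are local functions near `p`. -/
def IsLocalFieldAt (Y : Fin n → K → Pt n K → ℝ) (p : Pt n K) : Prop :=
  ∀ᶠ q in 𝓝 p, ∀ a A, IsLocalAt (Y a A) q

theorem IsLocalFieldAt.eventually (hY : IsLocalFieldAt Y p) : ∀ᶠ q in 𝓝 p, IsLocalFieldAt Y q :=
  hY.eventually_nhds

theorem IsLocalFieldAt.component (hY : IsLocalFieldAt Y p) (a : Fin n) (A : K) :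
    IsLocalAt (Y a A) p :=
  hY.self_of_nhds a A

theorem totalD_congr (a : Fin n) (h : f =ᶠ[𝓝 p] f') : totalD Y a f =ᶠ[𝓝 p] totalD Y a f' :=
  h.eventually_nhds.mono fun _ hq => lineDeriv_congr hq

theorem vderiv_congr (A : K) (h : f =ᶠ[𝓝 p] f') : vderiv A f =ᶠ[𝓝 p] vderiv A f' :=
  h.eventually_nhds.mono fun _ hq => lineDeriv_congr hq

/-- This commutator is what makes `d_v` commute with the Lie derivative along `D_a`. -/
theorem vderiv_totalD (hf : IsLocalAt f p) (hY : IsLocalFieldAt Y p) (a : Fin n) (B : K) :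
    vderiv B (totalD Y a f) p =
      totalD Y a (vderiv B f) p + ∑ᶠ A, vderiv A f p * vderiv B (Y a A) p := by
  have := lineDeriv_field_comm hf (hY.component a) (Pi.single a 1)
    ((0, open Classical in Pi.single B 1) : Pt n K)
  rw [hf.lineDeriv_eq_finsum] at this
  refine this.trans (congrArg₂ _ rfl (finsum_congr fun A => mul_comm _ _))

/-- `Φ` is a local map of bundles which sends the fields `D_a` to the fields `D_a`. -/
structure IsCartanMapAt (Y : Fin n → K → Pt n K → ℝ) (Y' : Fin n → K' → Pt n K' → ℝ)
    (Φ : Pt n K → Pt n K') (p : Pt n K) : Prop where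
  isLocalMapAt : IsLocalMapAt Φ p
  comm : ∀ᶠ q in 𝓝 p, ∀ a k, totalD Y a (fun r => (Φ r).2 k) q = Y' a k (Φ q)

section Cartan

variable {Φ : Pt n K → Pt n K'} {Ψ : Pt n K' → Pt n K''} {h : Pt n K' → ℝ}

theorem IsCartanMapAt.eventually (hΦ : IsCartanMapAt Y Y' Φ p) :
    ∀ᶠ q in 𝓝 p, IsCartanMapAt Y Y' Φ q := by
  filter_upwards [hΦ.isLocalMapAt.eventually, hΦ.comm.eventually_nhds] with q h1 h2
  exact ⟨h1, h2⟩

theorem IsCartanMapAt.continuousAt (hΦ : IsCartanMapAt Y Y' Φ p) : ContinuousAt Φ p :=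
  hΦ.isLocalMapAt.continuousAt

theorem totalD_comp_map (hΦ : IsCartanMapAt Y Y' Φ p) (hh : IsLocalAt h (Φ p)) (a : Fin n) :
    totalD Y a (fun q => h (Φ q)) p = totalD Y' a h (Φ p) := by
  rw [totalD, lineDeriv_comp_map hΦ.isLocalMapAt hh]
  exact congrArg (fun w => lineDeriv ℝ h (Φ p) (Pi.single a 1, w))
    (funext fun k => hΦ.comm.self_of_nhds a k)

theorem IsCartanMapAt.comp (hΨ : IsCartanMapAt Y' Y'' Ψ (Φ p)) (hΦ : IsCartanMapAt Y Y' Φ p) :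
    IsCartanMapAt Y Y'' (fun q => Ψ (Φ q)) p := by
  refine ⟨hΨ.isLocalMapAt.comp hΦ.isLocalMapAt, ?_⟩
  filter_upwards [hΦ.eventually, hΦ.continuousAt.eventually hΨ.eventually] with q h1 h2 a k
  rw [totalD_comp_map h1 (h2.isLocalMapAt.component k), h2.comm.self_of_nhds]

end Cartan

/-! ### Iterated total derivatives -/

/-- The composition of total derivatives along a word of indices. -/
def wordD (Y : Fin n → K → Pt n K → ℝ) (l : List (Fin n)) (f : Pt n K → ℝ) : Pt n K → ℝ :=
  l.foldr (totalD Y) f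

/-- The sorted word of a multi-index. -/
def word (I : Fin n → ℕ) : List (Fin n) :=
  (List.finRange n).flatMap fun a => List.replicate (I a) a

/-- Words can be concatenated and peeled off at either end, which suits induction. For general `Y`
the fields `D_a` are not known to commute, so the word must respect the fixed order. -/
theorem iterD_eq_wordD (I : Fin n → ℕ) (f : Pt n K → ℝ) : iterD Y I f = wordD Y (word I) f := by
  have h1 : ∀ (a : Fin n) (m : ℕ) (f : Pt n K → ℝ),
      (totalD Y a)^[m] f = wordD Y (List.replicate m a) f := by
    intro a m f
    induction m with
    | zero => rfl
    | succ m ih => rw [Function.iterate_succ_apply', ih]; rfl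
  rw [iterD, word]
  generalize List.finRange n = L
  induction L with
  | nil => rfl
  | cons a L ih =>
    rw [List.foldr_cons, ih, h1, List.flatMap_cons, wordD, wordD, wordD, List.foldr_append]

theorem count_word (I : Fin n → ℕ) (a : Fin n) : (word I).count a = I a := by
  rw [word, List.count_flatMap]
  have : (List.count a ∘ fun b => List.replicate (I b) b) = fun b => if b = a then I b else 0 := by
    ext b
    simp [List.count_replicate]
  rw [this, ← Fin.sum_univ_def]
  simp

theorem wordD_congr (l : List (Fin n)) (h : f =ᶠ[𝓝 p] f') : wordD Y l f =ᶠ[𝓝 p] wordD Y l f' := by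
  induction l with
  | nil => exact h
  | cons a l ih => exact totalD_congr a ih

theorem iterD_congr (I : Fin n → ℕ) (h : f =ᶠ[𝓝 p] f') : iterD Y I f =ᶠ[𝓝 p] iterD Y I f' := by
  simp only [iterD_eq_wordD]
  exact wordD_congr _ h

theorem IsLocalAt.wordD (hf : IsLocalAt f p) (hY : IsLocalFieldAt Y p) (l : List (Fin n)) :
    IsLocalAt (wordD Y l f) p := by
  induction l with
  | nil => exact hf
  | cons a l ih => exact ih.totalD hY.component a

protected theorem IsLocalAt.iterD (hf : IsLocalAt f p) (hY : IsLocalFieldAt Y p)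
    (I : Fin n → ℕ) : IsLocalAt (iterD Y I f) p := by
  rw [iterD_eq_wordD]
  exact hf.wordD hY _

theorem wordD_comp_map {Φ : Pt n K → Pt n K'} {h : Pt n K' → ℝ} (hY' : IsLocalFieldAt Y' (Φ p))
    (hΦ : IsCartanMapAt Y Y' Φ p) (hh : IsLocalAt h (Φ p)) (l : List (Fin n)) :
    wordD Y l (fun q => h (Φ q)) =ᶠ[𝓝 p] fun q => wordD Y' l h (Φ q) := by
  induction l with
  | nil => exact .rfl
  | cons a l ih =>
    refine (totalD_congr a ih).trans ?_
    filter_upwards [hΦ.eventually, hΦ.continuousAt.eventually (hh.wordD hY' l).eventually]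
      with q h1 h2
    exact totalD_comp_map h1 h2 a

theorem iterD_comp_map {Φ : Pt n K → Pt n K'} {h : Pt n K' → ℝ} (hY' : IsLocalFieldAt Y' (Φ p))
    (hΦ : IsCartanMapAt Y Y' Φ p) (hh : IsLocalAt h (Φ p)) (I : Fin n → ℕ) :
    iterD Y I (fun q => h (Φ q)) p = iterD Y' I h (Φ p) := by
  simp only [iterD_eq_wordD]
  exact (wordD_comp_map hY' hΦ hh _).self_of_nhds

theorem iterD_zero (f : Pt n K → ℝ) : iterD Y 0 f = f := by
  rw [iterD_eq_wordD]
  have : word (0 : Fin n → ℕ) = [] := by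
    simp [word]
  rw [this]
  rfl

theorem totalD_add (hf : IsLocalAt f p) (hg : IsLocalAt g p) (a : Fin n) :
    totalD Y a (fun q => f q + g q) p = totalD Y a f p + totalD Y a g p :=
  lineDeriv_add hf hg _

theorem wordD_add (hY : IsLocalFieldAt Y p) (hf : IsLocalAt f p) (hg : IsLocalAt g p)
    (l : List (Fin n)) :
    wordD Y l (fun q => f q + g q) =ᶠ[𝓝 p] fun q => wordD Y l f q + wordD Y l g q := by
  induction l with
  | nil => exact .rfl
  | cons a l ih =>
    refine (totalD_congr a ih).trans ?_
    filter_upwards [(hf.wordD hY l).eventually, (hg.wordD hY l).eventually] with q h1 h2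
    exact totalD_add h1 h2 a

theorem iterD_add (hY : IsLocalFieldAt Y p) (hf : IsLocalAt f p) (hg : IsLocalAt g p)
    (I : Fin n → ℕ) : iterD Y I (fun q => f q + g q) p = iterD Y I f p + iterD Y I g p := by
  simp only [iterD_eq_wordD]
  exact (wordD_add hY hf hg _).self_of_nhds

theorem iterD_const_zero (I : Fin n → ℕ) (q : Pt n K) : iterD Y I (fun _ => (0 : ℝ)) q = 0 := by
  rw [iterD_eq_wordD]
  have : ∀ l, wordD Y l (fun _ => (0 : ℝ)) = fun _ => 0 := by
    intro l
    induction l with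
    | nil => rfl
    | cons a l ih =>
      change totalD Y a (wordD Y l _) = _
      rw [ih]
      ext q
      exact lineDeriv_const_fun _ _
  rw [this]

/-! ### Representations of local forms -/

/-- `ρ = ∑_j g_j d_v f_j` near `p`, with local functions `g_j` and `f_j`. -/
structure FormRep {J : Type} [Fintype J] (ρ : VForm n K) (p : Pt n K)
    (g f : J → Pt n K → ℝ) : Prop where
  left : ∀ j, IsLocalAt (g j) p
  right : ∀ j, IsLocalAt (f j) p
  eq : ∀ᶠ q in 𝓝 p, ∀ B, ρ B q = ∑ j, g j q * vderiv B (f j) q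

section FormRep

variable {J : Type} [Fintype J] {ρ ρ' : VForm n K} {u w : J → Pt n K → ℝ}

theorem FormRep.eventually (h : FormRep ρ p u w) : ∀ᶠ q in 𝓝 p, FormRep ρ q u w := by
  filter_upwards [eventually_all.2 fun j => (h.left j).eventually,
    eventually_all.2 fun j => (h.right j).eventually, h.eq.eventually_nhds] with q h1 h2 h3
  exact ⟨h1, h2, h3⟩

theorem FormRep.of_sum (hu : ∀ j, IsLocalAt (u j) p) (hw : ∀ j, IsLocalAt (w j) p) :
    FormRep (fun B q => ∑ j, u j q * vderiv B (w j) q) p u w :=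
  ⟨hu, hw, .of_forall fun _ _ => rfl⟩

theorem FormRep.isLocalFormAt (h : FormRep ρ p u w) : IsLocalFormAt ρ p := by
  classical
  choose s hs using fun j => (h.right j).exists_lineDeriv_eq_sum
  refine ⟨Finset.univ.biUnion s, ?_⟩
  filter_upwards [h.eventually, eventually_all.2 hs] with q h1 h2 A
  constructor
  · exact (IsLocalAt.sum fun j _ => (h1.left j).mul ((h1.right j).vderiv A)).congr
      (h1.eq.mono fun r hr => hr A)
  · intro hA
    rw [h1.eq.self_of_nhds]
    refine Finset.sum_eq_zero fun j hj => ?_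
    rw [(h2 j).1 A fun hAj => hA (Finset.mem_biUnion.2 ⟨j, hj, hAj⟩), mul_zero]

theorem IsLocalFormAt.eventually (h : IsLocalFormAt ρ p) : ∀ᶠ q in 𝓝 p, IsLocalFormAt ρ q := by
  obtain ⟨s, hs⟩ := h
  exact hs.eventually_nhds.mono fun q hq => ⟨s, hq⟩

theorem IsLocalFormAt.coeff (h : IsLocalFormAt ρ p) (A : K) : IsLocalAt (ρ A) p := by
  obtain ⟨s, hs⟩ := h
  exact (hs.self_of_nhds A).1

theorem IsLocalFormAt.finite_support (h : IsLocalFormAt ρ p) :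
    (Function.support fun A => ρ A p).Finite := by
  obtain ⟨s, hs⟩ := h
  exact s.finite_toSet.subset fun A hA => by
    by_contra h
    exact hA ((hs.self_of_nhds A).2 h)

theorem IsLocalFormAt.exists_rep (h : IsLocalFormAt ρ p) :
    ∃ s : Finset K, FormRep ρ p (fun A : s => ρ A) (fun A q => q.2 A) := by
  classical
  have hc := h.coeff
  obtain ⟨s, hs⟩ := h
  refine ⟨s, fun A => hc A, fun A => .coord _, ?_⟩
  filter_upwards [hs] with q hq B
  simp only [vderiv_coord, mul_ite, mul_one, mul_zero]
  rw [Finset.sum_coe_sort s (fun A => if A = B then ρ A q else 0), Finset.sum_ite_eq']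
  split_ifs with hB
  · rfl
  · exact (hq B).2 hB

theorem FormRep.add {J' : Type} [Fintype J'] {u' w' : J' → Pt n K → ℝ}
    (h : FormRep ρ p u w) (h' : FormRep ρ' p u' w') :
    FormRep (fun B q => ρ B q + ρ' B q) p (Sum.elim u u') (Sum.elim w w') := by
  refine ⟨by simpa using ⟨h.left, h'.left⟩, by simpa using ⟨h.right, h'.right⟩, ?_⟩
  filter_upwards [h.eq, h'.eq] with q h1 h2 B
  simp [Fintype.sum_sum_type, h1, h2]

theorem FormRep.neg (h : FormRep ρ p u w) :
    FormRep (fun B q => -ρ B q) p (fun j q => -u j q) w := by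
  refine ⟨fun j => (h.left j).neg, h.right, ?_⟩
  filter_upwards [h.eq] with q h1 B
  simp [h1]

theorem FormRep.vderiv (hf : IsLocalAt f p) :
    FormRep (fun B => vderiv B f) p (fun (_ : Unit) _ => 1) (fun _ => f) :=
  ⟨fun _ => .const 1, fun _ => hf, .of_forall fun q B => by simp⟩

/-- Leibniz rule together with `D_a d_v w = d_v (D_a w)`. In this form the components of `Y` no
longer appear explicitly, which makes the Lie derivative easy to compare across maps. -/
theorem FormRep.lieD_eq (hY : IsLocalFieldAt Y p) (h : FormRep ρ p u w) (a : Fin n) (B : K) :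
    lieD Y a ρ B p = ∑ j, (totalD Y a (u j) p * IntrinsicLagrangian.vderiv B (w j) p +
      u j p * IntrinsicLagrangian.vderiv B (totalD Y a (w j)) p) := by
  have h1 : totalD Y a (ρ B) p =
      ∑ j, (totalD Y a (u j) p * IntrinsicLagrangian.vderiv B (w j) p +
        u j p * totalD Y a (IntrinsicLagrangian.vderiv B (w j)) p) := by
    have he : ρ B =ᶠ[𝓝 p] fun q => ∑ j, u j q * IntrinsicLagrangian.vderiv B (w j) q :=
      h.eq.mono fun q hq => hq B
    rw [(totalD_congr a he).self_of_nhds, totalD,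
      lineDeriv_sum fun j _ => (h.left j).mul ((h.right j).vderiv B)]
    exact Finset.sum_congr rfl fun j _ => lineDeriv_mul (h.left j) ((h.right j).vderiv B) _
  have h2 : ∑ᶠ A, ρ A p * IntrinsicLagrangian.vderiv B (Y a A) p =
      ∑ j, u j p * ∑ᶠ A, IntrinsicLagrangian.vderiv A (w j) p *
        IntrinsicLagrangian.vderiv B (Y a A) p := by
    have hfin : ∀ j, (Function.support fun A => IntrinsicLagrangian.vderiv A (w j) p *
        IntrinsicLagrangian.vderiv B (Y a A) p).Finite := fun j =>
      (h.right j).finite_support_vderiv.subset fun A hA hA' => hA (by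
        simp only at hA'
        simp [hA'])
    simp only [h.eq.self_of_nhds, Finset.sum_mul, mul_assoc]
    rw [finsum_sum_comm]
    · exact Finset.sum_congr rfl fun j _ => (mul_finsum _ _).symm
    · exact fun j _ => (hfin j).subset fun A hA hA' => hA (by
        simp only at hA'
        simp [hA'])
  rw [lieD, h1, h2, ← Finset.sum_add_distrib]
  refine Finset.sum_congr rfl fun j _ => ?_
  rw [vderiv_totalD (h.right j) hY]
  ring

theorem FormRep.lieD (hY : IsLocalFieldAt Y p) (h : FormRep ρ p u w) (a : Fin n) :
    FormRep (lieD Y a ρ) p (Sum.elim (fun j => totalD Y a (u j)) u)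
      (Sum.elim w (fun j => totalD Y a (w j))) := by
  refine ⟨?_, ?_, ?_⟩
  · simpa using ⟨fun j => (h.left j).totalD hY.component a, h.left⟩
  · simpa using ⟨h.right, fun j => (h.right j).totalD hY.component a⟩
  · filter_upwards [h.eventually, hY.eventually] with q h1 h2 B
    rw [h1.lieD_eq h2, Fintype.sum_sum_type, Finset.sum_add_distrib]
    rfl

theorem IsLocalFormAt.add (h : IsLocalFormAt ρ p) (h' : IsLocalFormAt ρ' p) :
    IsLocalFormAt (fun B q => ρ B q + ρ' B q) p := by
  obtain ⟨s, hs⟩ := h.exists_rep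
  obtain ⟨t, ht⟩ := h'.exists_rep
  exact (hs.add ht).isLocalFormAt

theorem IsLocalFormAt.neg (h : IsLocalFormAt ρ p) : IsLocalFormAt (fun B q => -ρ B q) p := by
  obtain ⟨s, hs⟩ := h.exists_rep
  exact hs.neg.isLocalFormAt

theorem IsLocalFormAt.vderiv (hf : IsLocalAt f p) : IsLocalFormAt (fun B => vderiv B f) p :=
  (FormRep.vderiv hf).isLocalFormAt

theorem IsLocalFormAt.zero : IsLocalFormAt (fun _ _ => 0 : VForm n K) p :=
  ⟨∅, .of_forall fun _ _ => ⟨.const 0, fun _ => rfl⟩⟩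

theorem IsLocalFormAt.divForm (hY : IsLocalFieldAt Y p) {χ : Fin n → VForm n K}
    (h : ∀ a, IsLocalFormAt (χ a) p) : IsLocalFormAt (divForm Y χ) p := by
  have : ∀ s : Finset (Fin n), IsLocalFormAt (fun B q => ∑ a ∈ s, lieD Y a (χ a) B q) p := by
    intro s
    induction s using Finset.induction_on with
    | empty => simpa using IsLocalFormAt.zero
    | insert a s ha ih =>
      simp only [Finset.sum_insert ha]
      obtain ⟨t, ht⟩ := (h a).exists_rep
      exact (ht.lieD hY a).isLocalFormAt.add ih
  exact this Finset.univ

theorem lieD_congr (a : Fin n) (he : ∀ᶠ q in 𝓝 p, ∀ B, ρ' B q = ρ B q) (B : K) :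
    lieD Y a ρ' B p = lieD Y a ρ B p := by
  rw [IntrinsicLagrangian.lieD, IntrinsicLagrangian.lieD,
    (totalD_congr a (he.mono fun q hq => hq B)).self_of_nhds]
  simp only [he.self_of_nhds]

theorem lieD_vderiv (hY : IsLocalFieldAt Y p) (hf : IsLocalAt f p) (a : Fin n) (B : K) :
    lieD Y a (fun B => vderiv B f) B p = vderiv B (totalD Y a f) p := by
  rw [(FormRep.vderiv hf).lieD_eq hY]
  simp [totalD, lineDeriv_const_fun]

/-- Adding `d_v J` to a potential therefore changes its divergence by the vertical differential of
`∑ D_a J^a`. -/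
theorem divForm_vderiv (hY : IsLocalFieldAt Y p) {j : Fin n → Pt n K → ℝ}
    (hj : ∀ a, IsLocalAt (j a) p) (B : K) :
    divForm Y (fun a B => vderiv B (j a)) B p = vderiv B (fun q => ∑ a, totalD Y a (j a) q) p := by
  rw [divForm, vderiv, lineDeriv_sum fun a _ => (hj a).totalD hY.component a]
  exact Finset.sum_congr rfl fun a _ => lieD_vderiv hY (hj a) a B

theorem divForm_add (hY : IsLocalFieldAt Y p) {χ χ' : Fin n → VForm n K}
    (h : ∀ a, IsLocalFormAt (χ a) p) (h' : ∀ a, IsLocalFormAt (χ' a) p) (B : K) :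
    divForm Y (fun a B q => χ a B q + χ' a B q) B p = divForm Y χ B p + divForm Y χ' B p := by
  rw [divForm, divForm, divForm, ← Finset.sum_add_distrib]
  refine Finset.sum_congr rfl fun a _ => ?_
  obtain ⟨s, hs⟩ := (h a).exists_rep
  obtain ⟨t, ht⟩ := (h' a).exists_rep
  rw [(hs.add ht).lieD_eq hY, hs.lieD_eq hY, ht.lieD_eq hY, Fintype.sum_sum_type]
  rfl

theorem divForm_neg {χ : Fin n → VForm n K} (B : K) :
    divForm Y (fun a B q => -χ a B q) B p = -divForm Y χ B p := by
  rw [divForm, divForm, ← Finset.sum_neg_distrib]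
  refine Finset.sum_congr rfl fun a _ => ?_
  rw [IntrinsicLagrangian.lieD, IntrinsicLagrangian.lieD, neg_add, ← finsum_neg_distrib]
  simp only [neg_mul, totalD, lineDeriv_neg_fun]

theorem divForm_congr {χ χ' : Fin n → VForm n K} (he : ∀ᶠ q in 𝓝 p, ∀ a B, χ' a B q = χ a B q)
    (B : K) : divForm Y χ' B p = divForm Y χ B p :=
  Finset.sum_congr rfl fun a _ => lieD_congr a (he.mono fun _ hq => hq a) B

end FormRep

/-! ### Pullbacks of forms -/

section Pull

variable {J : Type} [Fintype J] {Φ : Pt n K → Pt n K'} {ρ : VForm n K'} {u w : J → Pt n K' → ℝ}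

/-- Pullback is a pointwise operation on coefficients, so the `c j` are plain numbers. Later they
are coefficient functions frozen at one point. -/
theorem pullForm_eq_sum (hΦ : IsLocalMapAt Φ p) (hw : ∀ j, IsLocalAt (w j) (Φ p))
    {c : J → ℝ} (h : ∀ k, ρ k (Φ p) = ∑ j, c j * vderiv k (w j) (Φ p)) (B : K) :
    pullForm Φ ρ B p = ∑ j, c j * vderiv B (fun q => w j (Φ q)) p := by
  have hfin : ∀ j, (Function.support fun k => vderiv k (w j) (Φ p) *
      vderiv B (fun r => (Φ r).2 k) p).Finite := fun j =>
    (hw j).finite_support_vderiv.subset fun A hA hA' => hA (by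
      simp only at hA'
      simp [hA'])
  simp only [pullForm, h, Finset.sum_mul, mul_assoc]
  rw [finsum_sum_comm]
  · refine Finset.sum_congr rfl fun j _ => ?_
    rw [vderiv_comp_map hΦ (hw j), mul_finsum _ _]
  · exact fun j _ => (hfin j).subset fun A hA hA' => hA (by
      simp only at hA'
      simp [hA'])

theorem FormRep.pull (hΦ : IsLocalMapAt Φ p) (h : FormRep ρ (Φ p) u w) :
    FormRep (pullForm Φ ρ) p (fun j q => u j (Φ q)) (fun j q => w j (Φ q)) := by
  refine ⟨fun j => (h.left j).comp_map hΦ, fun j => (h.right j).comp_map hΦ, ?_⟩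
  filter_upwards [hΦ.eventually, hΦ.continuousAt.eventually h.eventually] with q h1 h2 B
  exact pullForm_eq_sum h1 h2.right h2.eq.self_of_nhds B

theorem IsLocalFormAt.pull (hΦ : IsLocalMapAt Φ p) (h : IsLocalFormAt ρ (Φ p)) :
    IsLocalFormAt (pullForm Φ ρ) p := by
  obtain ⟨s, hs⟩ := h.exists_rep
  exact (hs.pull hΦ).isLocalFormAt

theorem pullForm_vderiv (hΦ : IsLocalMapAt Φ p) {h : Pt n K' → ℝ} (hh : IsLocalAt h (Φ p))
    (B : K) : pullForm Φ (fun k => vderiv k h) B p = vderiv B (fun q => h (Φ q)) p :=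
  (vderiv_comp_map hΦ hh B).symm

theorem pullForm_comp {Ψ : Pt n K' → Pt n K''} {ρ : VForm n K''} (hΦ : IsLocalMapAt Φ p)
    (hΨ : IsLocalMapAt Ψ (Φ p)) (hρ : IsLocalFormAt ρ (Ψ (Φ p))) (B : K) :
    pullForm Φ (pullForm Ψ ρ) B p = pullForm (fun q => Ψ (Φ q)) ρ B p := by
  obtain ⟨s, hs⟩ := hρ.exists_rep
  have h1 := (hs.pull hΨ).pull hΦ
  have h2 := hs.pull (Φ := fun q => Ψ (Φ q)) (hΨ.comp hΦ)
  rw [h1.eq.self_of_nhds, h2.eq.self_of_nhds]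

theorem pullForm_add {ρ' : VForm n K'} (h : IsLocalFormAt ρ (Φ p)) (h' : IsLocalFormAt ρ' (Φ p))
    (B : K) : pullForm Φ (fun B q => ρ B q + ρ' B q) B p = pullForm Φ ρ B p + pullForm Φ ρ' B p := by
  rw [pullForm, pullForm, pullForm, ← finsum_add_distrib]
  · simp only [add_mul]
  · exact h.finite_support.subset fun A hA hA' => hA (by
      simp only at hA'
      simp [hA'])
  · exact h'.finite_support.subset fun A hA hA' => hA (by
      simp only at hA'
      simp [hA'])

theorem pullForm_congr {ρ' : VForm n K'} (h : ∀ k, ρ' k (Φ p) = ρ k (Φ p)) (B : K) :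
    pullForm Φ ρ' B p = pullForm Φ ρ B p := by
  simp only [pullForm, h]

/-- Pullback along Cartan maps commutes with the horizontal differential. -/
theorem divForm_pullForm (hY : IsLocalFieldAt Y p) (hY' : IsLocalFieldAt Y' (Φ p))
    (hΦ : IsCartanMapAt Y Y' Φ p) {χ : Fin n → VForm n K'}
    (hχ : ∀ a, IsLocalFormAt (χ a) (Φ p)) (B : K) :
    divForm Y (fun a => pullForm Φ (χ a)) B p = pullForm Φ (divForm Y' χ) B p := by
  choose s hs using fun a => (hχ a).exists_rep
  have hfin : ∀ a, (Function.support fun k => lieD Y' a (χ a) k (Φ p) *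
      vderiv B (fun r => (Φ r).2 k) p).Finite := fun a =>
    ((hs a).lieD hY' a).isLocalFormAt.finite_support.subset fun A hA hA' => hA (by
      simp only at hA'
      simp [hA'])
  have h1 : pullForm Φ (divForm Y' χ) B p = ∑ a, pullForm Φ (lieD Y' a (χ a)) B p := by
    simp only [pullForm, divForm, Finset.sum_mul]
    exact finsum_sum_comm _ _ fun a _ => hfin a
  rw [h1, divForm]
  refine Finset.sum_congr rfl fun a _ => ?_
  rw [((hs a).pull hΦ.isLocalMapAt).lieD_eq hY,
    (((hs a).lieD hY' a).pull hΦ.isLocalMapAt).eq.self_of_nhds, Fintype.sum_sum_type,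
    ← Finset.sum_add_distrib]
  refine Finset.sum_congr rfl fun j _ => ?_
  -- With both sides expanded in representations `g d_v f`, it remains to see that composition with
  -- `Φ` commutes with `D_a`, on `g` as well as on `f`.
  have e1 := totalD_comp_map hΦ ((hs a).left j) a
  have e2 : (fun q => totalD Y' a (fun r => r.2 j.1) (Φ q)) =ᶠ[𝓝 p]
      totalD Y a (fun q => (Φ q).2 j) := by
    filter_upwards [hΦ.eventually] with q hq
    exact (totalD_comp_map hq (.coord j.1) a).symm
  rw [Sum.elim_inl, Sum.elim_inl, Sum.elim_inr, Sum.elim_inr, e1,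
    (vderiv_congr B e2).self_of_nhds]

end Pull

end Fields

/-! ## Jet spaces -/

section Jets

variable {n : ℕ} {ι κ : Type} {p : Jet n ι} {f g h : Jet n ι → ℝ}

theorem isLocalFieldAt_jetY (p : Jet n ι) : IsLocalFieldAt (jetY n ι) p :=
  .of_forall fun _ _ _ => .coord _

theorem totalD_jet_coord (a : Fin n) (k : JetIdx n ι) :
    totalD (jetY n ι) a (fun q => q.2 k) = fun q => q.2 (k.1, k.2 + Pi.single a 1) := by
  ext q
  exact totalD_coord _ _ _

/-- By the commutator formula the two sides differ by the fields with components `D_a φ_{I+b}` and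
`D_b φ_{I+a}`, both of which are `φ_{I+a+b}`. -/
theorem totalD_jet_comm (hf : IsLocalAt f p) (a b : Fin n) :
    totalD (jetY n ι) a (totalD (jetY n ι) b f) p =
      totalD (jetY n ι) b (totalD (jetY n ι) a f) p := by
  have h1 := fun (a b : Fin n) => lineDeriv_field_comm hf
    ((isLocalFieldAt_jetY p).component b) (Pi.single b 1)
    ((Pi.single a 1, fun k => jetY n ι a k p) : Jet n ι)
  refine (h1 a b).trans (Eq.trans ?_ (h1 b a).symm)
  rw [lineDeriv_comm hf]
  congr 3
  ext k
  change lineDeriv ℝ (fun q : Jet n ι => q.2 (k.1, k.2 + Pi.single b 1)) p _ =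
    lineDeriv ℝ (fun q : Jet n ι => q.2 (k.1, k.2 + Pi.single a 1)) p _
  rw [lineDeriv_coord, lineDeriv_coord]
  simp only [jetY, add_right_comm]

theorem wordD_jet_perm {l l' : List (Fin n)} (hl : l.Perm l') (hf : IsLocalAt f p) :
    wordD (jetY n ι) l f =ᶠ[𝓝 p] wordD (jetY n ι) l' f := by
  induction hl with
  | nil => exact .rfl
  | cons a _ ih => exact totalD_congr a ih
  | swap a b l =>
    filter_upwards [(hf.wordD (isLocalFieldAt_jetY p) l).eventually] with q hq
    exact totalD_jet_comm hq b a
  | trans _ _ ih ih' => exact ih.trans ih'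

theorem wordD_eq_iterD (hf : IsLocalAt f p) (l : List (Fin n)) :
    wordD (jetY n ι) l f =ᶠ[𝓝 p] iterD (jetY n ι) (fun a => l.count a) f := by
  rw [iterD_eq_wordD]
  exact wordD_jet_perm
    (List.perm_iff_count.2 fun a => (count_word (fun a => l.count a) a).symm) hf

theorem totalD_iterD (hf : IsLocalAt f p) (a : Fin n) (I : Fin n → ℕ) :
    totalD (jetY n ι) a (iterD (jetY n ι) I f) =ᶠ[𝓝 p]
      iterD (jetY n ι) (I + Pi.single a 1) f := by
  rw [iterD_eq_wordD I]
  refine (wordD_eq_iterD hf (a :: word I)).trans (.of_eq ?_)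
  congr 1
  ext b
  by_cases hb : a = b
  · subst hb
    simp [count_word]
  · simp [count_word, hb, Ne.symm hb]

theorem iterD_totalD (hf : IsLocalAt f p) (a : Fin n) (I : Fin n → ℕ) :
    iterD (jetY n ι) I (totalD (jetY n ι) a f) =ᶠ[𝓝 p]
      iterD (jetY n ι) (I + Pi.single a 1) f := by
  rw [iterD_eq_wordD I]
  have : wordD (jetY n ι) (word I) (totalD (jetY n ι) a f) =
      wordD (jetY n ι) (word I ++ [a]) f := by
    simp [wordD]
  rw [this]
  refine (wordD_eq_iterD hf _).trans (.of_eq ?_)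
  congr 1
  ext b
  by_cases hb : a = b
  · subst hb
    simp [count_word]
  · simp [count_word, hb, Ne.symm hb]

theorem iterD_single (a : Fin n) (hf : IsLocalAt f p) :
    iterD (jetY n ι) (Pi.single a 1) f p = totalD (jetY n ι) a f p := by
  have := (totalD_iterD hf a 0).self_of_nhds
  rw [iterD_zero, zero_add] at this
  exact this.symm

theorem multiIndex_induction {P : (Fin n → ℕ) → Prop} (zero : P 0)
    (succ : ∀ I a, P I → P (I + Pi.single a 1)) (I : Fin n → ℕ) : P I := by
  have : ∀ m, ∀ I : Fin n → ℕ, ∑ a, I a = m → P I := by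
    intro m
    induction m with
    | zero =>
      intro I hI
      have : I = 0 := by
        ext a
        exact (Finset.sum_eq_zero_iff.1 hI) a (Finset.mem_univ a)
      rwa [this]
    | succ m ih =>
      intro I hI
      obtain ⟨a, -, ha⟩ : ∃ a ∈ Finset.univ, I a ≠ 0 := by
        by_contra! hcon
        rw [Finset.sum_eq_zero hcon] at hI
        omega
      have hIa : I - Pi.single a 1 + Pi.single a 1 = I := by
        ext b
        by_cases hb : b = a
        · subst hb
          simp
          omega
        · simp [hb]
      rw [← hIa]
      refine succ _ a (ih _ ?_)
      have : ∑ b, (I - Pi.single a 1 + Pi.single a 1 : Fin n → ℕ) b = m + 1 := by rw [hIa, hI]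
      simp only [Pi.add_apply, Finset.sum_add_distrib, Finset.sum_pi_single', Finset.mem_univ,
        if_true] at this
      omega
  exact this _ I rfl

theorem iterD_coord (I : Fin n → ℕ) (k : JetIdx n ι) :
    iterD (jetY n ι) I (fun q => q.2 k) p = p.2 (k.1, k.2 + I) := by
  have : ∀ I : Fin n → ℕ, ∀ p, iterD (jetY n ι) I (fun q => q.2 k) p = p.2 (k.1, k.2 + I) := by
    intro I
    induction I using multiIndex_induction with
    | zero => intro p; rw [iterD_zero, add_zero]
    | succ I a ih =>
      intro p
      rw [← (totalD_iterD (.coord k) a I).self_of_nhds,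
        show iterD (jetY n ι) I (fun q => q.2 k) = fun q => q.2 (k.1, k.2 + I) from funext ih,
        totalD_jet_coord, add_assoc]
  exact this I p

/-- Compatibility with the Cartan distribution is `D_a D_I F = D_{I+a} F`, which rests on the
commutativity of total derivatives on jet space. -/
theorem isCartanMapAt_prolong {F : κ → Jet n ι → ℝ} (hF : ∀ᶠ q in 𝓝 p, ∀ j, IsLocalAt (F j) q) :
    IsCartanMapAt (jetY n ι) (jetY n κ) (prolong F) p := by
  constructor
  · filter_upwards [hF] with q hq
    exact ⟨rfl, fun k => (hq k.1).iterD (isLocalFieldAt_jetY q) k.2⟩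
  · filter_upwards [hF] with q hq a k
    exact (totalD_iterD (hq k.1) a k.2).self_of_nhds

theorem prolong_coord (p : Jet n ι) : prolong (fun i (q : Jet n ι) => q.2 (i, 0)) p = p := by
  refine Prod.ext rfl (funext fun k => ?_)
  change iterD _ _ _ _ = _
  rw [iterD_coord, zero_add]

/-! ### Functions which vanish with all their total derivatives -/

/-- All total derivatives of `h` vanish at `p`. -/
def IsFlatAt (h : Jet n ι → ℝ) (p : Jet n ι) : Prop := ∀ I, iterD (jetY n ι) I h p = 0

namespace IsFlatAt

theorem congr (hh : IsFlatAt h p) (he : f =ᶠ[𝓝 p] h) : IsFlatAt f p := fun I => by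
  rw [(iterD_congr I he).self_of_nhds, hh]

theorem eq_zero (hh : IsFlatAt h p) : h p = 0 := by
  simpa [iterD_zero] using hh 0

theorem zero (p : Jet n ι) : IsFlatAt (fun _ => 0) p := fun I => iterD_const_zero I p

theorem wordD (hl : IsLocalAt h p) (hh : IsFlatAt h p) (l : List (Fin n)) :
    wordD (jetY n ι) l h p = 0 := by
  rw [(wordD_eq_iterD hl l).self_of_nhds, hh]

theorem of_wordD (hh : ∀ l, IntrinsicLagrangian.wordD (jetY n ι) l h p = 0) : IsFlatAt h p :=
  fun I => by rw [iterD_eq_wordD, hh]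

theorem totalD (hl : IsLocalAt h p) (hh : IsFlatAt h p) (a : Fin n) :
    IsFlatAt (totalD (jetY n ι) a h) p := fun I => by
  rw [(iterD_totalD hl a I).self_of_nhds, hh]

theorem iterD (hl : IsLocalAt h p) (hh : IsFlatAt h p) (I : Fin n → ℕ) :
    IsFlatAt (iterD (jetY n ι) I h) p := by
  refine of_wordD fun l => ?_
  have := hh.wordD hl (l ++ word I)
  rwa [IntrinsicLagrangian.wordD, List.foldr_append, ← IntrinsicLagrangian.wordD,
    ← IntrinsicLagrangian.wordD, ← iterD_eq_wordD] at this

theorem add (hfl : IsLocalAt f p) (hf : IsFlatAt f p) (hgl : IsLocalAt g p) (hg : IsFlatAt g p) :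
    IsFlatAt (fun q => f q + g q) p := fun I => by
  rw [iterD_add (isLocalFieldAt_jetY p) hfl hgl, hf, hg, add_zero]

theorem sum {J : Type} {s : Finset J} {f : J → Jet n ι → ℝ} (hl : ∀ j ∈ s, IsLocalAt (f j) p)
    (hf : ∀ j ∈ s, IsFlatAt (f j) p) : IsFlatAt (fun q => ∑ j ∈ s, f j q) p := by
  classical
  induction s using Finset.induction_on with
  | empty => simpa using zero p
  | insert j s hj ih =>
    simp only [Finset.sum_insert hj]
    simp only [Finset.forall_mem_insert] at hl hf
    exact add hl.1 hf.1 (IsLocalAt.sum hl.2) (ih hl.2 hf.2)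

/-- Flat functions at a point form an ideal stable under total derivatives; with flatness, arguments
modulo the equations of motion become pointwise. The innermost derivative is split off, so that the
product rule acts first and the induction hypothesis covers both resulting products. -/
theorem mul_left (hgl : IsLocalAt g p) (hl : IsLocalAt h p) (hh : IsFlatAt h p) :
    IsFlatAt (fun q => g q * h q) p := by
  refine of_wordD fun l => ?_
  induction l using List.reverseRecOn generalizing g h with
  | nil => simp [IntrinsicLagrangian.wordD, hh.eq_zero]
  | append_singleton l a ih =>
    have hY := isLocalFieldAt_jetY p
    have e1 : IntrinsicLagrangian.wordD (jetY n ι) (l ++ [a]) (fun q => g q * h q) =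
        IntrinsicLagrangian.wordD (jetY n ι) l
          (IntrinsicLagrangian.totalD (jetY n ι) a fun q => g q * h q) := by
      simp [IntrinsicLagrangian.wordD]
    have e2 : (IntrinsicLagrangian.totalD (jetY n ι) a fun q => g q * h q) =ᶠ[𝓝 p]
        fun q => IntrinsicLagrangian.totalD (jetY n ι) a g q * h q +
          g q * IntrinsicLagrangian.totalD (jetY n ι) a h q := by
      filter_upwards [hgl.eventually, hl.eventually] with q h1 h2
      exact lineDeriv_mul h1 h2 _
    have hga := hgl.totalD hY.component a
    have hha := hl.totalD hY.component a
    rw [e1, (wordD_congr l e2).self_of_nhds,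
      (wordD_add hY (hga.mul hl) (hgl.mul hha) l).self_of_nhds]
    change _ + _ = _
    rw [ih hga hl hh, ih hgl hha (hh.totalD hl a), add_zero]

/-- Flatness is preserved by substitution into functions that vanish at zero. -/
theorem comp_fields {α : Type} [Fintype α] {R : Pt n α → ℝ} {h : α → Jet n ι → ℝ}
    (hR : IsLocalAt R (p.1, 0)) (hR0 : ∀ᶠ x in 𝓝 p.1, R (x, 0) = 0)
    (hl : ∀ j, IsLocalAt (h j) p) (hh : ∀ j, IsFlatAt (h j) p) :
    IsFlatAt (fun q => R (q.1, fun j => h j q)) p := by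
  have hΦ : IsLocalMapAt (fun q : Jet n ι => ((q.1, fun j => h j q) : Pt n α)) p := by
    filter_upwards [eventually_all.2 fun j => (hl j).eventually] with q hq
    exact ⟨rfl, hq⟩
  have hΦp : ((p.1, fun j => h j p) : Pt n α) = (p.1, 0) :=
    Prod.ext rfl (funext fun j => (hh j).eq_zero)
  refine of_wordD fun l => ?_
  induction l using List.reverseRecOn generalizing R with
  | nil => simpa [IntrinsicLagrangian.wordD, hΦp] using hR0.self_of_nhds
  | append_singleton l a ih =>
    classical
    have hY := isLocalFieldAt_jetY p
    have e1 : IntrinsicLagrangian.wordD (jetY n ι) (l ++ [a])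
        (fun q => R (q.1, fun j => h j q)) = IntrinsicLagrangian.wordD (jetY n ι) l
          (IntrinsicLagrangian.totalD (jetY n ι) a fun q => R (q.1, fun j => h j q)) := by
      simp [IntrinsicLagrangian.wordD]
    have hR' : IsLocalAt R ((p.1, fun j => h j p) : Pt n α) := by rwa [hΦp]
    let Ra : Pt n α → ℝ := fun y => lineDeriv ℝ R y (Pi.single a 1, 0)
    have hRa : IsLocalAt Ra (p.1, 0) :=
      hR.lineDeriv_field (fun _ => .const _) (fun _ => .const _)
    have hRa' : IsLocalAt Ra ((p.1, fun j => h j p) : Pt n α) := by rwa [hΦp]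
    -- Chain rule: the explicit `x`-derivative of `R` again vanishes on the zero section and is
    -- handled by induction, while every other term is a multiple of the flat function `D_a h_j`.
    have e2 : (IntrinsicLagrangian.totalD (jetY n ι) a fun q => R (q.1, fun j => h j q)) =ᶠ[𝓝 p]
        fun q => Ra (q.1, fun j => h j q) + ∑ j, vderiv j R (q.1, fun j => h j q) *
          IntrinsicLagrangian.totalD (jetY n ι) a (h j) q := by
      filter_upwards [hΦ.eventually, hΦ.continuousAt.eventually hR'.eventually] with q h1 h2
      rw [IntrinsicLagrangian.totalD, lineDeriv_comp_map h1 h2]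
      have : ((Pi.single a 1, fun k => lineDeriv ℝ (h k) q
          (Pi.single a 1, fun A => jetY n ι a A q)) : Pt n α) =
          (Pi.single a 1, 0) + (0, fun k => IntrinsicLagrangian.totalD (jetY n ι) a (h k) q) := by
        simp [IntrinsicLagrangian.totalD]
      simp only
      rw [this, h2.lineDeriv_add_right, h2.lineDeriv_eq_finsum, finsum_eq_sum_of_fintype]
      exact congrArg₂ _ rfl (Finset.sum_congr rfl fun j _ => mul_comm _ _)
    have hcoef : ∀ j, IsLocalAt (fun q => vderiv j R (q.1, fun j => h j q)) p := fun j =>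
      (hR'.vderiv j).comp_map hΦ
    have hha := fun j => (hl j).totalD hY.component a
    have hterm := fun j => (hcoef j).mul (hha j)
    have hRa0 : ∀ᶠ x in 𝓝 p.1, Ra (x, 0) = 0 := by
      filter_upwards [hR0.eventually_nhds] with x hx
      have ht : Tendsto (fun t : ℝ => x + t • (Pi.single a 1 : Fin n → ℝ)) (𝓝 0) (𝓝 x) := by
        have : Continuous (fun t : ℝ => x + t • (Pi.single a 1 : Fin n → ℝ)) := by fun_prop
        simpa using this.tendsto 0
      have : (fun t : ℝ => R (((x, 0) : Pt n α) + t • ((Pi.single a 1, 0) : Pt n α))) =ᶠ[𝓝 0]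
          fun _ => 0 := by
        filter_upwards [ht.eventually hx] with t ht'
        simpa using ht'
      exact this.deriv_eq.trans (deriv_const _ _)
    rw [e1, (wordD_congr l e2).self_of_nhds, (wordD_add hY (hRa'.comp_map hΦ)
      (IsLocalAt.sum fun j _ => hterm j) l).self_of_nhds]
    change _ + _ = _
    rw [ih hRa hRa0, (IsFlatAt.sum (fun j _ => hterm j) fun j _ =>
        mul_left (hcoef j) (hha j) ((hh j).totalD (hl j) a)).wordD
          (IsLocalAt.sum fun j _ => hterm j), add_zero]

theorem comp_map {F : Jet n ι → Jet n κ} {h : Jet n κ → ℝ}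
    (hF : IsCartanMapAt (jetY n ι) (jetY n κ) F p) (hl : IsLocalAt h (F p))
    (hh : IsFlatAt h (F p)) : IsFlatAt (fun q => h (F q)) p := fun I => by
  rw [iterD_comp_map (isLocalFieldAt_jetY _) hF hl, hh]

end IsFlatAt

end Jets

/-! ## Euler–Lagrange derivatives and integration by parts -/

section Euler

variable {n : ℕ} {ι κ : Type} {p : Jet n ι}

/-- A family of local functions indexed by multi-indices, finitely many of them nonzero. -/
def IsLocalFamilyAt (r : (Fin n → ℕ) → Jet n ι → ℝ) (p : Jet n ι) : Prop :=
  ∃ s : Finset (Fin n → ℕ), ∀ᶠ q in 𝓝 p, ∀ I, IsLocalAt (r I) q ∧ (I ∉ s → r I q = 0)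

/-- The alternating sum `∑_I (-1)^{|I|} D_I r_I`. -/
def eulerSum (r : (Fin n → ℕ) → Jet n ι → ℝ) (p : Jet n ι) : ℝ :=
  ∑ᶠ I : Fin n → ℕ, (-1 : ℝ) ^ (∑ a, I a) * iterD (jetY n ι) I (r I) p

theorem euler_eq_eulerSum (L : Jet n ι → ℝ) (i : ι) :
    euler L i = eulerSum fun I => vderiv (i, I) L := rfl

theorem IsLocalFormAt.family {ρ : VForm n (JetIdx n ι)} (h : IsLocalFormAt ρ p) (i : ι) :
    IsLocalFamilyAt (fun I => ρ (i, I)) p := by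
  classical
  obtain ⟨s, hs⟩ := h
  refine ⟨s.image Prod.snd, hs.mono fun q hq I => ⟨(hq (i, I)).1, fun hI => (hq (i, I)).2 ?_⟩⟩
  exact fun h => hI (Finset.mem_image_of_mem Prod.snd h)

section Family

variable {r r' : (Fin n → ℕ) → Jet n ι → ℝ}

theorem IsLocalFamilyAt.coeff (h : IsLocalFamilyAt r p) (I : Fin n → ℕ) : IsLocalAt (r I) p := by
  obtain ⟨s, hs⟩ := h
  exact (hs.self_of_nhds I).1

theorem IsLocalFamilyAt.finite_support (h : IsLocalFamilyAt r p) :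
    (Function.support fun I : Fin n → ℕ =>
      (-1 : ℝ) ^ (∑ a, I a) * iterD (jetY n ι) I (r I) p).Finite := by
  obtain ⟨s, hs⟩ := h
  refine s.finite_toSet.subset fun I hI => ?_
  by_contra hIs
  refine hI ?_
  have : r I =ᶠ[𝓝 p] fun _ => 0 := hs.mono fun q hq => (hq I).2 hIs
  simp only
  rw [(iterD_congr I this).self_of_nhds, iterD_const_zero, mul_zero]

theorem eulerSum_congr (h : ∀ I, r I =ᶠ[𝓝 p] r' I) : eulerSum r p = eulerSum r' p :=
  finsum_congr fun I => by rw [(iterD_congr I (h I)).self_of_nhds]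

theorem eulerSum_add (h : IsLocalFamilyAt r p) (h' : IsLocalFamilyAt r' p) :
    eulerSum (fun I q => r I q + r' I q) p = eulerSum r p + eulerSum r' p := by
  rw [eulerSum, eulerSum, eulerSum, ← finsum_add_distrib h.finite_support h'.finite_support]
  refine finsum_congr fun I => ?_
  rw [iterD_add (isLocalFieldAt_jetY p) (h.coeff I) (h'.coeff I), mul_add]

theorem IsLocalFamilyAt.source {B : Jet n ι → ℝ} (hB : IsLocalAt B p) :
    IsLocalFamilyAt (fun (I : Fin n → ℕ) q => if I = 0 then B q else 0) p := by
  refine ⟨{0}, hB.eventually.mono fun q hq I => ⟨?_, fun hI => ?_⟩⟩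
  · dsimp only
    split_ifs
    · exact hq
    · exact .const 0
  · exact if_neg (by simpa using hI)

theorem eulerSum_source (B : Jet n ι → ℝ) :
    eulerSum (fun (I : Fin n → ℕ) q => if I = 0 then B q else 0) p = B p := by
  rw [eulerSum, finsum_eq_single _ 0]
  · simp [iterD_zero]
  · intro I hI
    simp [hI, iterD_const_zero]

end Family

/-- On jet space `D_a d_vφ_I = d_vφ_{I+a}`. The case distinction guards the truncated subtraction `I
- Pi.single a 1`. -/
theorem lieD_jet {ρ : VForm n (JetIdx n ι)} (a : Fin n) (i : ι) (I : Fin n → ℕ) :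
    lieD (jetY n ι) a ρ (i, I) p = totalD (jetY n ι) a (ρ (i, I)) p +
      if I a = 0 then 0 else ρ (i, I - Pi.single a 1) p := by
  classical
  rw [lieD]
  congr 1
  have : ∀ k : JetIdx n ι, ρ k p * vderiv (i, I) (jetY n ι a k) p =
      if (k.1, k.2 + Pi.single a 1) = (i, I) then ρ k p else 0 := by
    intro k
    change ρ k p * vderiv (i, I) (fun q : Jet n ι => q.2 (k.1, k.2 + Pi.single a 1)) p = _
    rw [vderiv_coord]
    split_ifs <;> simp
  simp only [this]
  split_ifs with hI
  · refine (finsum_congr fun k => if_neg fun hk => ?_).trans finsum_zero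
    have : k.2 a + 1 = I a := by
      have := congrFun (congrArg Prod.snd hk) a
      simpa using this
    omega
  · have hIa : I - Pi.single a 1 + Pi.single a 1 = I := by
      ext b
      by_cases hb : b = a
      · subst hb
        simp
        omega
      · simp [hb]
    rw [finsum_eq_single _ ((i, I - Pi.single a 1) : JetIdx n ι)]
    · rw [if_pos (by rw [hIa])]
    · intro k hk
      refine if_neg fun hk' => hk ?_
      have h1 : k.1 = i := congrArg Prod.fst hk'
      have h2 : k.2 + Pi.single a 1 = I := congrArg Prod.snd hk'
      refine Prod.ext h1 ?_
      rw [← h2]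
      simp

/-- The Euler operator annihilates horizontally exact forms. -/
theorem eulerSum_lieD {ρ : VForm n (JetIdx n ι)} (hρ : IsLocalFormAt ρ p) (a : Fin n) (i : ι) :
    eulerSum (fun I => lieD (jetY n ι) a ρ (i, I)) p = 0 := by
  have hY := isLocalFieldAt_jetY p
  have h1 : IsLocalFamilyAt (fun I => totalD (jetY n ι) a (ρ (i, I))) p := by
    obtain ⟨s, hs⟩ := hρ.family i
    refine ⟨s, hs.eventually_nhds.mono fun q hq I => ⟨?_, fun hI => ?_⟩⟩
    · exact (hq.self_of_nhds I).1.totalD (isLocalFieldAt_jetY q).component a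
    · have : ρ (i, I) =ᶠ[𝓝 q] fun _ => 0 := hq.mono fun r hr => (hr I).2 hI
      exact (totalD_congr a this).self_of_nhds.trans (lineDeriv_const_fun _ _)
  have h2 : IsLocalFamilyAt (fun (I : Fin n → ℕ) q =>
      if I a = 0 then 0 else ρ (i, I - Pi.single a 1) q) p := by
    classical
    obtain ⟨s, hs⟩ := hρ.family i
    refine ⟨s.image fun I => I + Pi.single a 1, hs.mono fun q hq I => ?_⟩
    by_cases hI : I a = 0
    · simp only [hI, if_true]
      exact ⟨.const 0, fun _ => trivial⟩
    · simp only [hI, if_false]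
      refine ⟨(hq _).1, fun hIs => (hq _).2 fun hmem => hIs ?_⟩
      refine Finset.mem_image.2 ⟨_, hmem, ?_⟩
      ext b
      by_cases hb : b = a
      · subst hb
        simp
        omega
      · simp [hb]
  -- Reindexing by `I ↦ I + Pi.single a 1` raises `|I|` by one and thereby flips the sign, so the
  -- two halves of the Lie derivative cancel in the alternating sum.
  have h3 : eulerSum (fun (I : Fin n → ℕ) q =>
      if I a = 0 then 0 else ρ (i, I - Pi.single a 1) q) p =
      -eulerSum (fun I => totalD (jetY n ι) a (ρ (i, I))) p := by
    rw [eulerSum, eulerSum, ← finsum_neg_distrib]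
    have hinj : Function.Injective fun I : Fin n → ℕ => I + Pi.single a 1 :=
      add_left_injective _
    have hsupp : (Function.support fun I : Fin n → ℕ => (-1 : ℝ) ^ (∑ b, I b) *
        iterD (jetY n ι) I (fun q => if I a = 0 then 0 else ρ (i, I - Pi.single a 1) q) p) ⊆
        Set.range fun I : Fin n → ℕ => I + Pi.single a 1 := by
      intro I hI
      by_cases hIa : I a = 0
      · exact absurd (by simp [hIa, iterD_const_zero]) hI
      · refine ⟨I - Pi.single a 1, ?_⟩
        ext b
        by_cases hb : b = a
        · subst hb
          simp
          omega
        · simp [hb]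
    rw [← finsum_mem_univ, ← finsum_mem_inter_support, Set.univ_inter,
      ← Set.inter_eq_right.2 hsupp, finsum_mem_inter_support, finsum_mem_range hinj]
    refine finsum_congr fun I => ?_
    have e : (fun q => if (I + Pi.single a 1 : Fin n → ℕ) a = 0 then 0 else
        ρ (i, I + Pi.single a 1 - Pi.single a 1) q) = ρ (i, I) := by
      ext q
      simp
    rw [e, (iterD_totalD (hρ.coeff (i, I)) a I).self_of_nhds]
    simp [Finset.sum_add_distrib, pow_succ]
  have h4 : eulerSum (fun I => lieD (jetY n ι) a ρ (i, I)) p =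
      eulerSum (fun I q => totalD (jetY n ι) a (ρ (i, I)) q +
        if I a = 0 then 0 else ρ (i, I - Pi.single a 1) q) p :=
    eulerSum_congr fun I => .of_eq (funext fun q => lieD_jet a i I)
  rw [h4, eulerSum_add h1 h2, h3, add_neg_cancel]

theorem IsLocalFormAt.lieD {ρ : VForm n (JetIdx n ι)} (hρ : IsLocalFormAt ρ p) (a : Fin n) :
    IsLocalFormAt (lieD (jetY n ι) a ρ) p := by
  obtain ⟨s, hs⟩ := hρ.exists_rep
  exact (hs.lieD (isLocalFieldAt_jetY p) a).isLocalFormAt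

theorem eulerSum_divForm {χ : Fin n → VForm n (JetIdx n ι)} (hχ : ∀ a, IsLocalFormAt (χ a) p)
    (i : ι) : eulerSum (fun I => divForm (jetY n ι) χ (i, I)) p = 0 := by
  have key : ∀ s : Finset (Fin n),
      IsLocalFormAt (fun B q => ∑ a ∈ s, lieD (jetY n ι) a (χ a) B q) p ∧
      eulerSum (fun I q => ∑ a ∈ s, lieD (jetY n ι) a (χ a) (i, I) q) p = 0 := by
    intro s
    induction s using Finset.induction_on with
    | empty =>
      refine ⟨by simpa using IsLocalFormAt.zero, ?_⟩
      simp [eulerSum, iterD_const_zero]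
    | insert a s ha ih =>
      simp only [Finset.sum_insert ha]
      refine ⟨((hχ a).lieD a).add ih.1, ?_⟩
      rw [eulerSum_add (((hχ a).lieD a).family i) (ih.1.family i), ih.2, eulerSum_lieD (hχ a),
        add_zero]
  exact (key Finset.univ).2

/-- The Euler–Lagrange derivative is determined by the first variational formula. -/
theorem euler_eq_of_variation {L B : Jet n ι → ℝ} {i : ι} {χ : Fin n → VForm n (JetIdx n ι)}
    (hB : IsLocalAt B p) (hχ : ∀ a, IsLocalFormAt (χ a) p)
    (h : ∀ I, ∀ᶠ q in 𝓝 p, vderiv (i, I) L q =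
      (if I = 0 then B q else 0) + divForm (jetY n ι) χ (i, I) q) :
    euler L i p = B p := by
  rw [euler_eq_eulerSum, eulerSum_congr h, eulerSum_add (.source hB)
    ((IsLocalFormAt.divForm (isLocalFieldAt_jetY p) hχ).family i), eulerSum_source,
    eulerSum_divForm hχ, add_zero]

/-- Repeated use of `h d_vφ_{I+a} = D_a (h d_vφ_I) - (D_a h) d_vφ_I`. The coefficients of the
boundary form are, up to sign, total derivatives of `h`, whence the last clause; it is what later
allows boundary terms to be dropped on shell. -/
theorem exists_source_add_divForm_of_single {h : Jet n ι → ℝ} (hh : IsLocalAt h p) (i : ι)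
    (I : Fin n → ℕ) :
    ∃ χ : Fin n → VForm n (JetIdx n ι), (∀ a, IsLocalFormAt (χ a) p) ∧
      ∀ᶠ q in 𝓝 p, (∀ k, h q * vderiv k (fun r => r.2 (i, I)) q =
        ((-1 : ℝ) ^ (∑ a, I a) * iterD (jetY n ι) I h q) * vderiv k (fun r => r.2 (i, 0)) q +
          divForm (jetY n ι) χ k q) ∧ (IsFlatAt h q → ∀ a k, χ a k q = 0) := by
  induction I using multiIndex_induction generalizing h with
  | zero =>
    refine ⟨fun _ _ _ => 0, fun a => .zero, .of_forall fun q => ⟨fun k => ?_, fun _ _ _ => rfl⟩⟩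
    simp [iterD_zero, divForm, lieD, totalD, lineDeriv_const_fun]
  | succ I a ih =>
    have hY := isLocalFieldAt_jetY p
    obtain ⟨χ, hχ, hχe⟩ := ih (hh.totalD hY.component a)
    let ρ : VForm n (JetIdx n ι) := fun B q => h q * vderiv B (fun r => r.2 (i, I)) q
    have hρ : FormRep ρ p (fun (_ : Unit) => h) (fun _ r => r.2 (i, I)) :=
      ⟨fun _ => hh, fun _ => .coord _, .of_forall fun q B => by simp [ρ]⟩
    let ρa : Fin n → VForm n (JetIdx n ι) := fun b B q => if b = a then ρ B q else 0
    have hρa : ∀ b, IsLocalFormAt (ρa b) p := by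
      intro b
      by_cases hb : b = a
      · simpa [ρa, hb] using hρ.isLocalFormAt
      · simpa [ρa, hb] using IsLocalFormAt.zero
    refine ⟨fun b B q => ρa b B q + -χ b B q, fun b => (hρa b).add (hχ b).neg, ?_⟩
    filter_upwards [hχe, hρ.eventually, hh.eventually,
      eventually_all.2 fun b => (hχ b).eventually, eventually_all.2 fun b => (hρa b).eventually]
      with q h1 h2 h3 h4 h5
    have hYq := isLocalFieldAt_jetY q
    refine ⟨fun k => ?_, fun hf b k => ?_⟩
    · have e1 : divForm (jetY n ι) ρa k q = lieD (jetY n ι) a ρ k q := by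
        rw [divForm, Finset.sum_eq_single a]
        · simp [ρa]
        · intro b _ hb
          simp [ρa, hb, lieD, totalD, lineDeriv_const_fun]
        · simp
      rw [divForm_add hYq h5 fun b => (h4 b).neg, divForm_neg, e1, h2.lieD_eq hYq]
      have h6 := h1.1 k
      rw [(iterD_totalD h3 a I).self_of_nhds] at h6
      simp only [Finset.univ_unique, Finset.sum_singleton, totalD_jet_coord, Pi.add_apply,
        Finset.sum_add_distrib, Finset.sum_pi_single', Finset.mem_univ, if_true, pow_succ]
      linear_combination -h6
    · have h7 := h1.2 (hf.totalD h3 a) b k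
      simp [ρa, ρ, h7, hf.eq_zero]

theorem divForm_sum {J : Type} (s : Finset J) {χ : J → Fin n → VForm n (JetIdx n ι)}
    (hχ : ∀ j a, IsLocalFormAt (χ j a) p) :
    (∀ a, IsLocalFormAt (fun B q => ∑ j ∈ s, χ j a B q) p) ∧ ∀ B,
      divForm (jetY n ι) (fun a B q => ∑ j ∈ s, χ j a B q) B p =
        ∑ j ∈ s, divForm (jetY n ι) (χ j) B p := by
  classical
  induction s using Finset.induction_on with
  | empty =>
    refine ⟨fun a => by simpa using IsLocalFormAt.zero, fun B => ?_⟩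
    simp [divForm, lieD, totalD, lineDeriv_const_fun]
  | insert j s hj ih =>
    simp only [Finset.sum_insert hj]
    refine ⟨fun a => (hχ j a).add (ih.1 a), fun B => ?_⟩
    rw [divForm_add (isLocalFieldAt_jetY p) (hχ j) ih.1, ih.2]

/-- Integration by parts: a vertical one-form on the jet space is the sum of a source form and a
horizontally exact form. -/
theorem exists_source_add_divForm {ρ : VForm n (JetIdx n ι)} (hρ : IsLocalFormAt ρ p) :
    ∃ (A : ι → Jet n ι → ℝ) (χ : Fin n → VForm n (JetIdx n ι)), (∀ i, IsLocalAt (A i) p) ∧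
      (∀ a, IsLocalFormAt (χ a) p) ∧
      ∀ᶠ q in 𝓝 p, (∀ i I, ρ (i, I) q =
        (if I = 0 then A i q else 0) + divForm (jetY n ι) χ (i, I) q) ∧
        ((∀ k, IsFlatAt (ρ k) q) → (∀ i, IsFlatAt (A i) q) ∧ ∀ a k, χ a k q = 0) := by
  classical
  obtain ⟨s, hs⟩ := hρ.exists_rep
  have hY := isLocalFieldAt_jetY p
  choose χ hχ hχe using fun k : s => exists_source_add_divForm_of_single (hs.left k) k.1.1 k.1.2
  have hterm : ∀ (i : ι) (k : s) {q : Jet n ι}, IsLocalAt (ρ k) q →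
      IsLocalAt (fun q => if k.1.1 = i then
        (-1 : ℝ) ^ (∑ a, k.1.2 a) * iterD (jetY n ι) k.1.2 (ρ k) q else 0) q := by
    intro i k q hk
    split_ifs
    · exact (IsLocalAt.const _).mul (hk.iterD (isLocalFieldAt_jetY q) _)
    · exact .const 0
  refine ⟨fun i q => ∑ k : s, if k.1.1 = i then
      (-1 : ℝ) ^ (∑ a, k.1.2 a) * iterD (jetY n ι) k.1.2 (ρ k) q else 0,
    fun a B q => ∑ k : s, χ k a B q, fun i => IsLocalAt.sum fun k _ => hterm i k (hs.left k),
    (divForm_sum Finset.univ hχ).1, ?_⟩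
  filter_upwards [eventually_all.2 hχe, hs.eventually,
    eventually_all.2 fun k => eventually_all.2 fun a => (hχ k a).eventually] with q h1 h2 h3
  refine ⟨fun i I => ?_, fun hf => ⟨fun i => ?_, fun a k => ?_⟩⟩
  · rw [(divForm_sum Finset.univ h3).2, h2.eq.self_of_nhds, Finset.sum_congr rfl fun k _ =>
      (h1 k).1 (i, I), Finset.sum_add_distrib]
    congr 1
    simp only [vderiv_coord]
    by_cases hI : I = 0
    · subst hI
      simp
    · have : ∀ k : s, ((k.1.1, (0 : Fin n → ℕ)) = (i, I)) = False := by
        intro k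
        simp [Ne.symm hI]
      simp [this, hI]
  · refine IsFlatAt.sum (fun k _ => hterm i k (h2.left k)) fun k _ => ?_
    split_ifs
    · exact ((hf k).iterD (h2.left k) _).mul_left (.const _)
        ((h2.left k).iterD (isLocalFieldAt_jetY q) _)
    · exact .zero q
  · exact Finset.sum_eq_zero fun j _ => (h1 j).2 (hf j) a k

/-- `χ` is a presymplectic potential of the Lagrangian `L` near `p`. -/
def IsPresympPotentialAt (L : Jet n ι → ℝ) (χ : Fin n → VForm n (JetIdx n ι)) (p : Jet n ι) :
    Prop :=
  (∀ a, IsLocalFormAt (χ a) p) ∧ ∀ᶠ q in 𝓝 p, ∀ (i : ι) (I : Fin n → ℕ),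
    vderiv (i, I) L q = (if I = 0 then euler L i q else 0) + divForm (jetY n ι) χ (i, I) q

theorem eventually_euler_eq {L : Jet n ι → ℝ} {A : ι → Jet n ι → ℝ} [Finite ι]
    {χ : Fin n → VForm n (JetIdx n ι)} (hA : ∀ i, IsLocalAt (A i) p)
    (hχ : ∀ a, IsLocalFormAt (χ a) p) (h : ∀ᶠ q in 𝓝 p, ∀ i I, vderiv (i, I) L q =
      (if I = 0 then A i q else 0) + divForm (jetY n ι) χ (i, I) q) :
    ∀ᶠ q in 𝓝 p, ∀ i, euler L i q = A i q := by
  filter_upwards [h.eventually_nhds, eventually_all.2 fun i => (hA i).eventually,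
    eventually_all.2 fun a => (hχ a).eventually] with q h1 h2 h3 i
  exact euler_eq_of_variation (h2 i) h3 fun I => h1.mono fun r hr => hr i I

/-- Integration by parts applied to `d_v L` gives some source form, and uniqueness of the source
identifies it with the Euler–Lagrange derivative. -/
theorem exists_isPresympPotentialAt [Finite ι] {L : Jet n ι → ℝ} (hL : IsLocalAt L p) :
    (∀ i, IsLocalAt (euler L i) p) ∧ ∃ χ, IsPresympPotentialAt L χ p := by
  obtain ⟨A, χ, hA, hχ, h⟩ := exists_source_add_divForm (IsLocalFormAt.vderiv hL)
  have he := eventually_euler_eq hA hχ (h.mono fun q hq => hq.1)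
  refine ⟨fun i => (hA i).congr (he.mono fun q hq => hq i), χ, hχ, ?_⟩
  filter_upwards [h, he] with q h1 h2 i I
  rw [h1.1 i I, h2]

/-- Transfer of presymplectic potentials and of the stationary surface along a Cartan map `F` which
relates two Lagrangians up to a total derivative and a source form. -/
theorem IsPresympPotentialAt.transfer [Finite ι] [Fintype κ] {L : Jet n ι → ℝ} {L' : Jet n κ → ℝ}
    {F : Jet n ι → Jet n κ} (hF : IsCartanMapAt (jetY n ι) (jetY n κ) F p)
    (hL' : IsLocalAt L' (F p)) {τ : ι → Jet n ι → ℝ} (hτ : ∀ i, IsLocalAt (τ i) p)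
    {J : Fin n → Jet n ι → ℝ} (hJ : ∀ a, IsLocalAt (J a) p)
    (h : ∀ᶠ q in 𝓝 p, ∀ i I, vderiv (i, I) L q = vderiv (i, I) (fun r => L' (F r)) q +
      (if I = 0 then τ i q else 0) + vderiv (i, I) (fun r => ∑ a, totalD (jetY n ι) a (J a) r) q)
    {χ' : Fin n → VForm n (JetIdx n κ)} (hχ' : IsPresympPotentialAt L' χ' (F p)) :
    ∃ χ, IsPresympPotentialAt L χ p ∧ ∀ᶠ q in 𝓝 p, F q ∈ stationary L' →
      (∀ a k, χ a k q = pullForm F (χ' a) k q + vderiv k (J a) q) ∧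
        ((∀ i, IsFlatAt (τ i) q) → q ∈ stationary L) := by
  classical
  have hFl := hF.isLocalMapAt
  have hE := (exists_isPresympPotentialAt hL').1
  have hY := isLocalFieldAt_jetY p
  have hrep : FormRep (fun B q => ∑ j, euler L' j (F q) * vderiv B (fun r => (F r).2 (j, 0)) q) p
      (fun j q => euler L' j (F q)) (fun j q => (F q).2 (j, 0)) :=
    .of_sum (fun j => (hE j).comp_map hFl) (fun j => hFl.component _)
  -- The pulled-back source `E_j(F) d_vF^j` involves derivatives of the fields and is not a source
  -- form. Integrating it by parts contributes `A` to the new equations and `χ` to the new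
  -- potential.
  obtain ⟨A, χ, hA, hχ, hAχ⟩ := exists_source_add_divForm hrep.isLocalFormAt
  have hχF : ∀ a, IsLocalFormAt (pullForm F (χ' a)) p := fun a => (hχ'.1 a).pull hFl
  have hJv : ∀ a, IsLocalFormAt (fun k => vderiv k (J a)) p := fun a => .vderiv (hJ a)
  have hvar : ∀ᶠ q in 𝓝 p, ∀ i I, vderiv (i, I) L q = (if I = 0 then A i q + τ i q else 0) +
      divForm (jetY n ι) (fun a k q => (pullForm F (χ' a) k q + χ a k q) + vderiv k (J a) q)
        (i, I) q := by
    filter_upwards [h, hAχ, hF.eventually, hF.continuousAt.eventually hL'.eventually,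
      hF.continuousAt.eventually hχ'.2, eventually_all.2 fun a => (hχF a).eventually,
      hF.continuousAt.eventually (eventually_all.2 fun j => (hE j).eventually),
      eventually_all.2 fun a => (hχ a).eventually, eventually_all.2 fun a => (hJ a).eventually,
      hF.continuousAt.eventually (eventually_all.2 fun a => (hχ'.1 a).eventually)]
      with q h1 h2 h3 h4 h5 h6 h7 h8 h9 h10 i I
    have hYq := isLocalFieldAt_jetY q
    have e1 : vderiv (i, I) (fun r => L' (F r)) q =
        ∑ j, euler L' j (F q) * vderiv (i, I) (fun r => (F r).2 (j, 0)) q +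
          divForm (jetY n ι) (fun a => pullForm F (χ' a)) (i, I) q := by
      rw [← pullForm_vderiv h3.isLocalMapAt h4]
      have e2 : ∀ k, vderiv k L' (F q) = ∑ j, euler L' j (F q) *
          vderiv k (fun r => r.2 (j, 0)) (F q) + divForm (jetY n κ) χ' k (F q) := by
        rintro ⟨j, I⟩
        rw [h5 j I]
        congr 1
        simp only [vderiv_coord]
        by_cases hI : I = 0
        · subst hI
          simp
        · simp [hI, Ne.symm hI]
      have hsrc : FormRep (fun B q => ∑ j, euler L' j q *
          vderiv B (fun r : Jet n κ => r.2 (j, 0)) q) (F q)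
          (fun j => euler L' j) (fun j r => r.2 (j, 0)) :=
        .of_sum h7 (fun j => .coord _)
      rw [pullForm_congr (ρ := fun k r => (∑ j, euler L' j r *
          vderiv k (fun r => r.2 (j, 0)) r) + divForm (jetY n κ) χ' k r) e2,
        pullForm_add hsrc.isLocalFormAt (.divForm (isLocalFieldAt_jetY _) h10),
        (hsrc.pull h3.isLocalMapAt).eq.self_of_nhds,
        divForm_pullForm hYq (isLocalFieldAt_jetY _) h3 h10]
    rw [h1, e1, h2.1 i I, divForm_add hYq (fun a => (h6 a).add (h8 a)) (fun a => .vderiv (h9 a)),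
      divForm_add hYq h6 h8, divForm_vderiv hYq h9]
    split_ifs <;> ring
  have hχtot := fun a => ((hχF a).add (hχ a)).add (hJv a)
  have hAτ := fun i => (hA i).add (hτ i)
  have heul := eventually_euler_eq hAτ hχtot hvar
  refine ⟨fun a k q => (pullForm F (χ' a) k q + χ a k q) + vderiv k (J a) q, ⟨hχtot, ?_⟩, ?_⟩
  · filter_upwards [hvar, heul] with q h1 h2 i I
    rw [h1, h2]
  · filter_upwards [heul.eventually_nhds, hAχ, hF.eventually, hrep.eventually,
      hF.continuousAt.eventually (eventually_all.2 fun j => (hE j).eventually),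
      eventually_all.2 fun i => (hA i).eventually, eventually_all.2 fun i => (hτ i).eventually]
      with q h1 h2 h3 h4 h5 h6 h7 hst
    -- Over the stationary surface of `L'` all total derivatives of `E_j ∘ F` vanish, since `F`
    -- respects total derivatives. Both correction terms `A` and `χ` then vanish as well.
    have hflat : ∀ k, IsFlatAt (fun q => ∑ j, euler L' j (F q) *
        vderiv k (fun r => (F r).2 (j, 0)) q) q := by
      intro k
      have : ∀ j, IsLocalAt (fun q => vderiv k (fun r => (F r).2 (j, 0)) q *
          euler L' j (F q)) q := fun j => ((h4.right j).vderiv k).mul (h4.left j)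
      simp only [mul_comm (euler L' _ _)]
      refine IsFlatAt.sum (fun j _ => this j) fun j _ => ?_
      exact (IsFlatAt.comp_map h3 (h5 j) (hst j)).mul_left ((h4.right j).vderiv k) (h4.left j)
    refine ⟨fun a k => by rw [(h2.2 hflat).2 a k, add_zero], fun hτf i => ?_⟩
    exact ((h2.2 hflat).1 i |>.add (h6 i) (h7 i) (hτf i)).congr (h1.mono fun r hr => hr i)

end Euler

/-! ## Equivalent Lagrangians have isomorphic stationary surfaces -/

section Equivalence

variable {n : ℕ}

/-- `F` maps the stationary surface of `S` to that of `S'`, is compatible with the total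
derivatives, and pulls presymplectic potentials of `S'` back to presymplectic potentials of `S`, up
to vertically exact forms and forms which vanish on the stationary surface. -/
structure IsTransferMap (S S' : LagSystem n) (F : Jet n S.ι → Jet n S'.ι) : Prop where
  cartan : IsCartanMapAt (jetY n S.ι) (jetY n S'.ι) F S.pt
  map_pt : F S.pt = S'.pt
  mem : ∀ᶠ p in 𝓝 S.pt, p ∈ stationary S.L → F p ∈ stationary S'.L
  potential : ∀ χ', S'.IsPresympPotential χ' → ∃ χ, S.IsPresympPotential χ ∧
    ∃ J : Fin n → Jet n S.ι → ℝ, (∀ a, IsLocalAt (J a) S.pt) ∧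
      ∀ᶠ p in 𝓝 S.pt, p ∈ stationary S.L → ∀ a k,
        χ a k p = pullForm F (χ' a) k p + vderiv k (J a) p

theorem IsTransferMap.tendsto {S S' : LagSystem n} {F : Jet n S.ι → Jet n S'.ι}
    (hF : IsTransferMap S S' F) : Tendsto F (𝓝 S.pt) (𝓝 S'.pt) := by
  have := hF.cartan.continuousAt
  rwa [ContinuousAt, hF.map_pt] at this

theorem isTransferMap_id (S : LagSystem n) : IsTransferMap S S fun p => p := by
  refine ⟨⟨.of_forall fun q => ⟨rfl, fun k => .coord k⟩, .of_forall fun q a k => ?_⟩, rfl,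
    .of_forall fun _ h => h, fun χ hχ => ⟨χ, hχ, fun _ _ => 0, fun _ => .const 0, ?_⟩⟩
  · exact totalD_coord _ _ _
  · refine .of_forall fun p _ a k => ?_
    classical
    have h1 : vderiv k (fun _ : Jet n S.ι => (0 : ℝ)) p = 0 := lineDeriv_const_fun _ _
    rw [h1, add_zero, pullForm]
    simp only [vderiv_coord]
    rw [finsum_eq_single _ k]
    · simp
    · intro k' hk'
      simp [hk']

theorem IsTransferMap.comp {S S' S'' : LagSystem n} {F : Jet n S.ι → Jet n S'.ι}
    {F' : Jet n S'.ι → Jet n S''.ι} (hF' : IsTransferMap S' S'' F') (hF : IsTransferMap S S' F) :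
    IsTransferMap S S'' fun p => F' (F p) := by
  have hc' : IsCartanMapAt (jetY n S'.ι) (jetY n S''.ι) F' (F S.pt) := by
    rw [hF.map_pt]
    exact hF'.cartan
  refine ⟨hc'.comp hF.cartan, by rw [hF.map_pt, hF'.map_pt], ?_, fun χ'' hχ'' => ?_⟩
  · filter_upwards [hF.mem, hF.tendsto.eventually hF'.mem] with p h1 h2 hp
    exact h2 (h1 hp)
  · obtain ⟨χ', hχ', J', hJ', he'⟩ := hF'.potential χ'' hχ''
    obtain ⟨χ, hχ, J, hJ, he⟩ := hF.potential χ' hχ'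
    have hJ'F : ∀ a, IsLocalAt (fun p => J' a (F p)) S.pt := fun a => by
      refine IsLocalAt.comp_map hF.cartan.isLocalMapAt ?_
      rw [hF.map_pt]
      exact hJ' a
    refine ⟨χ, hχ, fun a p => J' a (F p) + J a p, fun a => (hJ'F a).add (hJ a), ?_⟩
    have hχ''F : ∀ᶠ p in 𝓝 S.pt, ∀ a, IsLocalFormAt (χ'' a) (F' (F p)) :=
      hF.tendsto.eventually (hF'.tendsto.eventually
        (eventually_all.2 fun a => (hχ''.1 a).eventually))
    filter_upwards [he, hF.tendsto.eventually he', hF.mem, hF.cartan.eventually,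
      hF.cartan.continuousAt.eventually hc'.eventually, hχ''F,
      hF.tendsto.eventually (eventually_all.2 fun a => (hJ' a).eventually),
      eventually_all.2 fun a => (hJ a).eventually] with p h1 h2 h3 h4 h5 h6 h7 h8 hp a k
    have e1 : vderiv k (fun p => J' a (F p) + J a p) p =
        vderiv k (fun p => J' a (F p)) p + vderiv k (J a) p :=
      lineDeriv_add ((h7 a).comp_map h4.isLocalMapAt) (h8 a) _
    rw [h1 hp, pullForm_congr (ρ := fun k q => pullForm F' (χ'' a) k q + vderiv k (J' a) q)
      (h2 (h3 hp) a), pullForm_add ((h6 a).pull h5.isLocalMapAt) (.vderiv (h7 a)),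
      pullForm_comp h4.isLocalMapAt h5.isLocalMapAt (h6 a), pullForm_vderiv h4.isLocalMapAt (h7 a),
      e1, add_assoc]

/-- The stationary surfaces of `S` and `S'` are identified, together with their classes of
presymplectic potentials. -/
def AreIsomorphic (S S' : LagSystem n) : Prop :=
  ∃ F G, IsTransferMap S S' F ∧ IsTransferMap S' S G ∧
    (∀ᶠ p in 𝓝 S.pt, p ∈ stationary S.L → G (F p) = p) ∧
    ∀ᶠ p in 𝓝 S'.pt, p ∈ stationary S'.L → F (G p) = p

theorem AreIsomorphic.refl (S : LagSystem n) : AreIsomorphic S S :=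
  ⟨_, _, isTransferMap_id S, isTransferMap_id S, .of_forall fun _ _ => rfl,
    .of_forall fun _ _ => rfl⟩

theorem AreIsomorphic.symm {S S' : LagSystem n} (h : AreIsomorphic S S') : AreIsomorphic S' S := by
  obtain ⟨F, G, hF, hG, h1, h2⟩ := h
  exact ⟨G, F, hG, hF, h2, h1⟩

theorem AreIsomorphic.trans {S S' S'' : LagSystem n} (h : AreIsomorphic S S')
    (h' : AreIsomorphic S' S'') : AreIsomorphic S S'' := by
  obtain ⟨F, G, hF, hG, h1, h2⟩ := h
  obtain ⟨F', G', hF', hG', h1', h2'⟩ := h'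
  refine ⟨_, _, hF'.comp hF, hG.comp hG', ?_, ?_⟩
  · filter_upwards [h1, hF.tendsto.eventually h1', hF.mem] with p e1 e2 e3 hp
    rw [e2 (e3 hp), e1 hp]
  · filter_upwards [h2', hG'.tendsto.eventually h2, hG'.mem] with p e1 e2 e3 hp
    rw [e2 (e3 hp), e1 hp]

/-- Field redefinitions are transfer maps. -/
theorem isTransferMap_of_redefinition {S S' : LagSystem n} {F : Jet n S.ι → Jet n S'.ι}
    {G : Jet n S'.ι → Jet n S.ι} (hF : IsCartanMapAt (jetY n S.ι) (jetY n S'.ι) F S.pt)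
    (hG : IsCartanMapAt (jetY n S'.ι) (jetY n S.ι) G S'.pt) (hFpt : F S.pt = S'.pt)
    (hGpt : G S'.pt = S.pt) {J : Fin n → Jet n S.ι → ℝ} {J' : Fin n → Jet n S'.ι → ℝ}
    (hJ : ∀ a, IsLocalAt (J a) S.pt) (hJ' : ∀ a, IsLocalAt (J' a) S'.pt)
    (hGF : ∀ᶠ p in 𝓝 S.pt, G (F p) = p)
    (hL : ∀ᶠ p in 𝓝 S.pt, S.L p = S'.L (F p) + ∑ a, totalD (jetY n S.ι) a (J a) p)
    (hL' : ∀ᶠ p in 𝓝 S'.pt, S'.L p = S.L (G p) + ∑ a, totalD (jetY n S'.ι) a (J' a) p) :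
    IsTransferMap S S' F := by
  have key : ∀ {S S' : LagSystem n} {F : Jet n S.ι → Jet n S'.ι},
      IsCartanMapAt (jetY n S.ι) (jetY n S'.ι) F S.pt → F S.pt = S'.pt →
      ∀ {J : Fin n → Jet n S.ι → ℝ}, (∀ a, IsLocalAt (J a) S.pt) →
      (∀ᶠ p in 𝓝 S.pt, S.L p = S'.L (F p) + ∑ a, totalD (jetY n S.ι) a (J a) p) →
      ∀ χ', S'.IsPresympPotential χ' → ∃ χ, S.IsPresympPotential χ ∧ ∀ᶠ p in 𝓝 S.pt,
        F p ∈ stationary S'.L → (∀ a k, χ a k p = pullForm F (χ' a) k p + vderiv k (J a) p) ∧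
          p ∈ stationary S.L := by
    intro S S' F hF hFpt J hJ hL χ' hχ'
    have hL'F : IsLocalAt S'.L (F S.pt) := by
      rw [hFpt]
      exact S'.isLocal
    have hχ'F : IsPresympPotentialAt S'.L χ' (F S.pt) := by
      rw [hFpt]
      exact hχ'
    obtain ⟨χ, hχ, he⟩ := IsPresympPotentialAt.transfer hF hL'F (τ := fun _ _ => 0)
      (fun _ => .const 0) hJ (L := S.L) (by
        filter_upwards [hL.eventually_nhds, hF.eventually,
          hF.continuousAt.eventually hL'F.eventually,
          eventually_all.2 fun a => (hJ a).eventually] with q h1 h2 h3 h4 i I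
        rw [(vderiv_congr (i, I) h1).self_of_nhds, ite_self, add_zero]
        exact lineDeriv_add (h3.comp_map h2.isLocalMapAt) (IsLocalAt.sum fun a _ =>
          (h4 a).totalD (isLocalFieldAt_jetY q).component a) _) hχ'F
    refine ⟨χ, hχ, he.mono fun q hq hst => ⟨(hq hst).1, (hq hst).2 fun i => .zero q⟩⟩
  -- The transfer lemma carries stationarity from `F p` back to `p`. The forward implication comes
  -- from applying it to `G` at the point `F p`, because `G (F p) = p`.
  have hmem : ∀ᶠ p in 𝓝 S.pt, p ∈ stationary S.L → F p ∈ stationary S'.L := by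
    obtain ⟨χ, hχ⟩ := (exists_isPresympPotentialAt S.isLocal).2
    obtain ⟨_, _, he⟩ := key hG hGpt hJ' hL' χ hχ
    have hFt : Tendsto F (𝓝 S.pt) (𝓝 S'.pt) := by
      have := hF.continuousAt
      rwa [ContinuousAt, hFpt] at this
    filter_upwards [hFt.eventually he, hGF] with p h1 h2 hp
    exact (h1 (by rwa [h2])).2
  refine ⟨hF, hFpt, hmem, fun χ' hχ' => ?_⟩
  obtain ⟨χ, hχ, he⟩ := key hF hFpt hJ hL χ' hχ'
  refine ⟨χ, hχ, J, hJ, ?_⟩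
  filter_upwards [he, hmem] with p h1 h2 hp
  exact (h1 (h2 hp)).1

theorem totalD_neg_fun {K : Type} (Y : Fin n → K → Pt n K → ℝ) (a : Fin n) (f : Pt n K → ℝ)
    (q : Pt n K) : totalD Y a (fun r => -f r) q = -totalD Y a f q :=
  lineDeriv_neg_fun f _

theorem IsRedefinition.areIsomorphic {S S' : LagSystem n} (h : IsRedefinition S S') :
    AreIsomorphic S S' := by
  obtain ⟨f, g, J, hf, hg, hJ, hfpt, hgpt, hgf, hfg, hL⟩ := h
  have hF := isCartanMapAt_prolong (eventually_all.2 fun j => (hf j).eventually)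
  have hG := isCartanMapAt_prolong (eventually_all.2 fun i => (hg i).eventually)
  have hGt : Tendsto (prolong g) (𝓝 S'.pt) (𝓝 S.pt) := by
    have := hG.continuousAt
    rwa [ContinuousAt, hgpt] at this
  have hJg : ∀ a, IsLocalAt (J a) (prolong g S'.pt) := by
    rw [hgpt]
    exact hJ
  have hL1 : ∀ᶠ p in 𝓝 S.pt, S.L p = S'.L (prolong f p) +
      ∑ a, totalD (jetY n S.ι) a (fun q => -J a q) p := by
    filter_upwards [hL] with p hp
    rw [hp]
    simp [totalD_neg_fun]
  have hL2 : ∀ᶠ p in 𝓝 S'.pt, S'.L p = S.L (prolong g p) +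
      ∑ a, totalD (jetY n S'.ι) a (fun q => J a (prolong g q)) p := by
    filter_upwards [hGt.eventually hL, hfg, hG.eventually,
      hG.continuousAt.eventually (eventually_all.2 fun a => (hJg a).eventually)]
      with p h1 h2 h3 h4
    rw [h2] at h1
    rw [h1, Finset.sum_congr rfl fun a _ => (totalD_comp_map h3 (h4 a) a).symm]
  have hJ1 := fun a => (hJ a).neg
  have hJ2 := fun a => (hJg a).comp_map hG.isLocalMapAt
  exact ⟨_, _, isTransferMap_of_redefinition hF hG hfpt hgpt hJ1 hJ2 hgf hL1 hL2,
    isTransferMap_of_redefinition hG hF hgpt hfpt hJ2 hJ1 hfg hL2 hL1,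
    hgf.mono fun _ h _ => h, hfg.mono fun _ h _ => h⟩

theorem isLocalAt_of_contDiff {α : Type} [Fintype α] {g : Pt n α → ℝ} (hg : ContDiff ℝ ∞ g)
    (y : Pt n α) : IsLocalAt g y :=
  isLocalAt_iff.2 ⟨Finset.univ, fun z => g (z.1, fun j => z.2 ⟨j, Finset.mem_univ j⟩),
    hg.comp (by fun_prop), .rfl⟩

theorem vderiv_of_fst {K : Type} (A : K) (k : (Fin n → ℝ) → ℝ) (q : Pt n K) :
    vderiv A (fun r : Pt n K => k r.1) q = 0 := by
  simp [vderiv, lineDeriv]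

/-- The projection forgetting `v` and the section `v = v₀(x)` are inverse to each other only on
shell, where the equations of the auxiliary fields and their total derivatives fix the whole jet of
`v`. This is why `AreIsomorphic` asks for inverses on the stationary surfaces only. -/
theorem IsAuxiliaryExtension.areIsomorphic {S S' : LagSystem n} (h : IsAuxiliaryExtension S S') :
    AreIsomorphic S S' := by
  classical
  obtain ⟨α, _, e, La₀, v₀, hu, hL, hLa₀, hv₀, hcrit, hhess⟩ := h
  set u : Jet n S'.ι → Jet n S.ι := fun p => (p.1, fun k => p.2 (e.symm (Sum.inl k.1), k.2))
    with hudef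
  set Φ : Jet n S'.ι → Pt n α := fun p => (p.1, fun j => p.2 (e.symm (Sum.inr j), 0)) with hΦdef
  obtain ⟨La, hLa, hLae⟩ := exists_contDiff_eventuallyEq hLa₀
  change La =ᶠ[𝓝 (Φ S'.pt)] La₀ at hLae
  have hx : S.pt.1 = S'.pt.1 := by rw [← hu]
  have hΦ : ∀ p, IsLocalMapAt Φ p := fun p => .of_forall fun q => ⟨rfl, fun j => .coord _⟩
  have hΦt : Tendsto Φ (𝓝 S'.pt) (𝓝 (Φ S'.pt)) := (hΦ _).continuousAt
  -- the fibre gradient of `La`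
  let H : Pt n α → α → ℝ := fun y j => vderiv j La y
  have hHf : ∀ y j, H y j = fderiv ℝ La y (0, Pi.single j 1) := by
    intro y j
    have : vderiv j La y = fderiv ℝ La y (0, Pi.single j 1) := by
      rw [vderiv, (hLa.differentiable (by simp) y).lineDeriv_eq_fderiv]
    exact this
  have hH : ContDiff ℝ ∞ H := by
    rw [contDiff_pi]
    intro j
    simp only [hHf]
    exact (hLa.fderiv_right (by simp)).clm_apply contDiff_const
  have hfib : ∀ x v, fderiv ℝ (fun w => La (x, w)) v =
      (fderiv ℝ La (x, v)).comp (ContinuousLinearMap.inr ℝ _ _) := fun x v =>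
    ((hLa.differentiable (by simp) (x, v)).hasFDerivAt.comp v (hasFDerivAt_prodMk_right x v)).fderiv
  have hfibj : ∀ x v j, fderiv ℝ (fun w => La (x, w)) v (Pi.single j 1) = H (x, v) j := by
    intro x v j
    rw [hfib, hHf]
    simp
  have hcrit' : ∀ᶠ y in 𝓝 (Φ S'.pt), H y = 0 ↔ y.2 = v₀ y.1 := by
    filter_upwards [hcrit, hLae.eventually_nhds] with y h1 h2
    rw [← h1]
    have e1 : fderiv ℝ (fun w => La₀ (y.1, w)) y.2 = fderiv ℝ (fun w => La (y.1, w)) y.2 := by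
      apply Filter.EventuallyEq.fderiv_eq
      have : Tendsto (fun w : α → ℝ => (y.1, w)) (𝓝 y.2) (𝓝 y) :=
        (Continuous.prodMk_right y.1).tendsto y.2
      exact (this.eventually h2).mono fun w hw => hw.symm
    rw [e1]
    constructor
    · intro h0
      refine ContinuousLinearMap.coe_injective (LinearMap.pi_ext' fun j => LinearMap.ext_ring ?_)
      change fderiv ℝ (fun w => La (y.1, w)) y.2 (Pi.single j 1) = 0
      rw [hfibj, Prod.mk.eta, h0]
      rfl
    · intro h0
      ext j
      rw [← hfibj, h0]
      simp
  -- the Euler-Lagrange equations of the auxiliary fields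
  have hLl : ∀ y, IsLocalAt La y := fun y => isLocalAt_of_contDiff hLa y
  have hu_prolong : u = prolong fun i (q : Jet n S'.ι) => q.2 (e.symm (Sum.inl i), 0) := by
    ext p k
    · rfl
    · change _ = iterD _ _ _ _
      rw [iterD_coord, zero_add]
  have hucart : ∀ p, IsCartanMapAt (jetY n S'.ι) (jetY n S.ι) u p := by
    intro p
    rw [hu_prolong]
    exact isCartanMapAt_prolong (.of_forall fun q j => .coord _)
  have huloc : IsLocalAt S.L (u S'.pt) := by
    rw [hu]
    exact S.isLocal
  have hut : Tendsto u (𝓝 S'.pt) (𝓝 S.pt) := by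
    have := (hucart S'.pt).continuousAt
    rwa [ContinuousAt, hu] at this
  let τ : S'.ι → Jet n S'.ι → ℝ := fun i q => Sum.elim (fun _ => 0) (fun j => H (Φ q) j) (e i)
  have hHl : ∀ j p, IsLocalAt (fun q => H (Φ q) j) p := fun j p =>
    IsLocalAt.comp_map (hΦ p) ((hLl _).vderiv j)
  have hτ : ∀ i p, IsLocalAt (τ i) p := by
    intro i p
    rcases hi : e i with i' | j
    · simpa [τ, hi] using IsLocalAt.const 0
    · simpa [τ, hi] using hHl j p
  have hvar : ∀ᶠ q in 𝓝 S'.pt, ∀ i I, vderiv (i, I) S'.L q =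
      vderiv (i, I) (fun r => S.L (u r)) q + if I = 0 then τ i q else 0 := by
    filter_upwards [hL.eventually_nhds, (hΦt.eventually hLae).eventually_nhds,
      (hucart S'.pt).continuousAt.eventually huloc.eventually] with q h1 h2 h3 i I
    have e1 : S'.L =ᶠ[𝓝 q] fun r => S.L (u r) + La (Φ r) := by
      filter_upwards [h1, h2] with r hr1 hr2
      rw [hr1, hr2]
    rw [(vderiv_congr (i, I) e1).self_of_nhds]
    refine (lineDeriv_add (h3.comp_map (hucart q).isLocalMapAt)
      ((hLl _).comp_map (hΦ q)) _).trans (congrArg₂ _ rfl ?_)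
    refine (vderiv_comp_map (hΦ q) (hLl _) (i, I)).trans ?_
    rw [finsum_eq_sum_of_fintype]
    simp only [hΦdef, vderiv_coord, τ]
    rcases hi : e i with i' | j
    · have : ∀ j, e.symm (Sum.inr j) ≠ i := by
        intro j hj
        rw [← hj] at hi
        simp at hi
      simp [this]
    · have : i = e.symm (Sum.inr j) := by rw [← hi, e.symm_apply_apply]
      subst this
      by_cases hI : I = 0
      · subst hI
        simp [H]
      · simp [hI, Ne.symm hI]
  have heul : ∀ᶠ q in 𝓝 S'.pt, ∀ j, euler S'.L (e.symm (Sum.inr j)) q = H (Φ q) j := by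
    filter_upwards [hvar.eventually_nhds,
      ((hucart S'.pt).continuousAt.eventually huloc.eventually).eventually_nhds] with q h1 h2 j
    refine euler_eq_of_variation (hHl j q) (χ := fun _ _ _ => 0) (fun _ => .zero) fun I => ?_
    filter_upwards [h1, h2] with r hr1 hr2
    rw [hr1, vderiv_comp_map (hucart r).isLocalMapAt hr2]
    have : ∀ k : JetIdx n S.ι, vderiv (e.symm (Sum.inr j), I)
        (fun q : Jet n S'.ι => (u q).2 k) r = 0 := by
      intro k
      simp only [hudef]
      rw [vderiv_coord]
      simp
    simp [this, τ, divForm, lieD, totalD, lineDeriv_const_fun]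
  have hEon : H (Φ S'.pt) = 0 := by
    ext j
    rw [← heul.self_of_nhds j]
    simpa [iterD_zero] using S'.onShell (e.symm (Sum.inr j)) 0
  have hv₀pt : (Φ S'.pt).2 = v₀ S'.pt.1 := hcrit'.self_of_nhds.1 hEon
  -- the auxiliary fields are determined by their equations
  have hbij : Function.Bijective (fun v : α → ℝ => fderiv ℝ H (Φ S'.pt) (0, v)) := by
    let T : (α → ℝ) →ₗ[ℝ] (α → ℝ) :=
      ((fderiv ℝ H (Φ S'.pt)).comp (ContinuousLinearMap.inr ℝ (Fin n → ℝ) (α → ℝ))).toLinearMap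
    -- Injectivity of the fibre derivative of the gradient is the nondegeneracy of the Hessian;
    -- surjectivity follows by dimension.
    have hinj : Function.Injective T := by
      rw [← LinearMap.ker_eq_bot, LinearMap.ker_eq_bot']
      intro w hw
      refine hhess w ?_
      have e2 : (fun w' => fderiv ℝ (fun w'' => La₀ (S'.pt.1, w'')) w') =ᶠ[𝓝 (Φ S'.pt).2]
          fun w' => fderiv ℝ (fun w'' => La (S'.pt.1, w'')) w' := by
        have : Tendsto (fun w : α → ℝ => (S'.pt.1, w)) (𝓝 (Φ S'.pt).2) (𝓝 (Φ S'.pt)) :=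
          (Continuous.prodMk_right S'.pt.1).tendsto _
        filter_upwards [(this.eventually hLae).eventually_nhds] with w' hw'
        exact Filter.EventuallyEq.fderiv_eq (hw'.mono fun w hw => hw.symm)
      change fderiv ℝ _ (Φ S'.pt).2 w = 0
      rw [e2.fderiv_eq]
      simp only [hfib]
      have hd : ContDiff ℝ ∞ (fderiv ℝ La) := hLa.fderiv_right (by simp)
      have h3 : HasFDerivAt (fun w' : α → ℝ => fderiv ℝ La (S'.pt.1, w'))
          ((fderiv ℝ (fderiv ℝ La) (Φ S'.pt)).comp (ContinuousLinearMap.inr ℝ _ _))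
          (Φ S'.pt).2 := by
        have h : HasFDerivAt (fderiv ℝ La) (fderiv ℝ (fderiv ℝ La) (Φ S'.pt))
            (S'.pt.1, (Φ S'.pt).2) := (hd.differentiable (by simp) (Φ S'.pt)).hasFDerivAt
        exact h.comp (Φ S'.pt).2 (hasFDerivAt_prodMk_right _ _)
      have h4 := h3.clm_comp (hasFDerivAt_const
        (ContinuousLinearMap.inr ℝ (Fin n → ℝ) (α → ℝ)) (Φ S'.pt).2)
      rw [h4.fderiv]
      refine ContinuousLinearMap.coe_injective (LinearMap.pi_ext' fun j => LinearMap.ext_ring ?_)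
      have h5 : fderiv ℝ H (Φ S'.pt) (0, w) j =
          fderiv ℝ (fderiv ℝ La) (Φ S'.pt) (0, w) (0, Pi.single j 1) := by
        have h6 : HasFDerivAt H (ContinuousLinearMap.pi fun j =>
            (fderiv ℝ (fderiv ℝ La) (Φ S'.pt)).flip (0, Pi.single j 1)) (Φ S'.pt) := by
          rw [hasFDerivAt_pi]
          intro j
          have := ((hd.differentiable (by simp) (Φ S'.pt)).hasFDerivAt).clm_apply
            (hasFDerivAt_const ((0, Pi.single j 1) : (Fin n → ℝ) × (α → ℝ)) (Φ S'.pt))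
          rw [show vderiv j La = fun y => fderiv ℝ La y (0, Pi.single j 1) from
            funext fun y => hHf y j]
          simpa using this
        rw [h6.fderiv]
        rfl
      have h7 : fderiv ℝ H (Φ S'.pt) (0, w) j = 0 := congrFun hw j
      rw [h5] at h7
      simpa using h7
    exact ⟨hinj, LinearMap.injective_iff_surjective.1 hinj⟩
  -- `R` recovers `v` from `x` and the value of the fibre gradient `H`; in particular `R (x, 0) = v₀
  -- x`.
  obtain ⟨R, hR, -, hRH, -⟩ := exists_parametric_inverse hH (Φ S'.pt).1 (Φ S'.pt).2 hbij
  change ∀ᶠ z in 𝓝 (Φ S'.pt), _ at hRH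
  have hv₀l : ∀ᶠ x in 𝓝 S'.pt.1, ∀ j, ContDiffAt ℝ ∞ (fun x => v₀ x j) x := by
    filter_upwards [hv₀] with x hx j
    exact contDiffAt_pi.1 hx j
  have hv₀t : Tendsto (fun x => (x, v₀ x)) (𝓝 S'.pt.1) (𝓝 (Φ S'.pt)) := by
    have h1 : ContinuousAt v₀ S'.pt.1 := hv₀.self_of_nhds.continuousAt
    have h2 : ((S'.pt.1, v₀ S'.pt.1) : Pt n α) = Φ S'.pt := Prod.ext rfl hv₀pt.symm
    have := (continuousAt_id (x := S'.pt.1)).prodMk h1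
    rw [ContinuousAt] at this
    simp only [id] at this
    rwa [h2] at this
  have hHv₀ : ∀ᶠ x in 𝓝 S'.pt.1, H (x, v₀ x) = 0 := by
    filter_upwards [hv₀t.eventually hcrit'] with x hx
    exact hx.2 rfl
  have hR0 : ∀ᶠ x in 𝓝 S'.pt.1, R (x, 0) = v₀ x := by
    filter_upwards [hv₀t.eventually hRH, hHv₀] with x h1 h2
    simpa [h2] using h1
  have hfstt : Tendsto (fun q : Jet n S'.ι => q.1) (𝓝 S'.pt) (𝓝 S'.pt.1) := continuousAt_fst
  -- the section of the projection `u` over the solution of the auxiliary equations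
  let f : S'.ι → Jet n S.ι → ℝ := fun k =>
    Sum.elim (fun i p => p.2 (i, 0)) (fun j p => v₀ p.1 j) (e k)
  -- Stated for an arbitrary family `κ` of fields, since it is used on the jet spaces of both
  -- systems.
  have hv₀loc : ∀ᶠ x in 𝓝 S'.pt.1, ∀ (κ : Type) (q : Jet n κ), q.1 = x → ∀ j,
      IsLocalAt (fun p : Jet n κ => v₀ p.1 j) q := by
    filter_upwards [hv₀l.eventually_nhds] with x hx κ q hq j
    exact IsLocalAt.of_fst (k := fun x => v₀ x j) (by rw [hq]; exact hx.mono fun z hz => hz j)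
  have hfstt' : Tendsto (fun q : Jet n S.ι => q.1) (𝓝 S.pt) (𝓝 S'.pt.1) := by
    rw [← hx]
    exact continuousAt_fst
  have hf : ∀ᶠ q in 𝓝 S.pt, ∀ k, IsLocalAt (f k) q := by
    filter_upwards [hfstt'.eventually hv₀loc] with q hq k
    rcases hk : e k with i | j
    · simpa [f, hk] using IsLocalAt.coord (i, 0)
    · simpa [f, hk] using hq S.ι q rfl j
  have hF := isCartanMapAt_prolong hf
  have hFu : ∀ᶠ q in 𝓝 S'.pt, q ∈ stationary S'.L → prolong f (u q) = q := by
    filter_upwards [hfstt.eventually hv₀loc, heul.eventually_nhds,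
      (hΦt.eventually hRH).eventually_nhds, (hfstt.eventually hR0).eventually_nhds]
      with q h1 h2 h3 h4 hst
    refine Prod.ext rfl (funext fun k => ?_)
    obtain ⟨i, I⟩ := k
    change iterD _ I (f i) (u q) = _
    rcases hi : e i with i' | j
    · have hii : i = e.symm (Sum.inl i') := by rw [← hi, e.symm_apply_apply]
      simp only [f, hi, Sum.elim_inl]
      rw [iterD_coord, zero_add, hii]
    · have hii : i = e.symm (Sum.inr j) := by rw [← hi, e.symm_apply_apply]
      simp only [f, hi, Sum.elim_inr]
      have hloc := h1 S'.ι q rfl j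
      rw [← iterD_comp_map (h := fun p : Jet n S.ι => v₀ p.1 j) (isLocalFieldAt_jetY _) (hucart q)
        (h1 S.ι (u q) rfl j)]
      -- Near the point `v - v₀(x) = R (x, H) - R (x, 0)`, a smooth function of `H` vanishing at `H
      -- = 0`. As `H` is flat on shell, so is `v - v₀(x)`.
      have hflat : IsFlatAt (fun r : Jet n S'.ι => r.2 (i, 0) - v₀ r.1 j) q := by
        have hRl : IsLocalAt (fun y : Pt n α => R y j - R (y.1, 0) j) (q.1, 0) := by
          refine isLocalAt_of_contDiff (ContDiff.sub ?_ ?_) _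
          · exact (contDiff_pi.1 hR) j
          · exact ((contDiff_pi.1 hR) j).comp (by fun_prop)
        refine (IsFlatAt.comp_fields (h := fun j r => H (Φ r) j) hRl
          (.of_forall fun x => by simp) (fun j => hHl j q) fun j' => ?_).congr ?_
        · exact IsFlatAt.congr (hst (e.symm (Sum.inr j'))) (h2.mono fun r hr => (hr j').symm)
        · filter_upwards [h3, h4] with r hr3 hr4
          have : R (r.1, H (Φ r)) = (Φ r).2 := hr3
          rw [this, hr4]
          simp [hΦdef, hii]
      have h5 := iterD_add (isLocalFieldAt_jetY q)
        ((IsLocalAt.coord (p := q) (i, 0)).sub hloc) hloc I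
      simp only [sub_add_cancel] at h5
      rw [iterD_coord, hflat, zero_add, zero_add] at h5
      rw [h5]
  have hFpt : prolong f S.pt = S'.pt := by
    have := hFu.self_of_nhds S'.onShell
    rwa [hu] at this
  have hFt : Tendsto (prolong f) (𝓝 S.pt) (𝓝 S'.pt) := by
    have := hF.continuousAt
    rwa [ContinuousAt, hFpt] at this
  have huF : ∀ p, u (prolong f p) = p := by
    intro p
    refine Prod.ext rfl (funext fun k => ?_)
    change iterD _ k.2 (f (e.symm (Sum.inl k.1))) p = _
    simp only [f, e.apply_symm_apply, Sum.elim_inl]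
    rw [iterD_coord, zero_add]
  have hΦF : ∀ p, Φ (prolong f p) = (p.1, v₀ p.1) := by
    intro p
    refine Prod.ext rfl (funext fun j => ?_)
    change iterD _ 0 (f (e.symm (Sum.inr j))) p = _
    simp only [f, e.apply_symm_apply, Sum.elim_inr, iterD_zero]
  -- transfer of potentials along the section
  have hT1 : ∀ χ', S'.IsPresympPotential χ' → ∃ χ, S.IsPresympPotential χ ∧
      ∀ᶠ q in 𝓝 S.pt, prolong f q ∈ stationary S'.L →
        (∀ a k, χ a k q = pullForm (prolong f) (χ' a) k q) ∧ q ∈ stationary S.L := by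
    intro χ' hχ'
    have hL'F : IsLocalAt S'.L (prolong f S.pt) := by
      rw [hFpt]
      exact S'.isLocal
    have hχ'F : IsPresympPotentialAt S'.L χ' (prolong f S.pt) := by
      rw [hFpt]
      exact hχ'
    obtain ⟨χ, hχ, he⟩ := IsPresympPotentialAt.transfer hF hL'F (τ := fun _ _ => 0)
      (fun _ => .const 0) (J := fun _ _ => 0) (fun _ => .const 0) (L := S.L) (by
        filter_upwards [(hFt.eventually hL).eventually_nhds, S.isLocal.eventually,
          (hFt.eventually (hΦt.eventually hLae)).eventually_nhds,
          hF.eventually, hFt.eventually S'.isLocal.eventually] with q h1 h2 h3 h4 h5 i I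
        -- Along the section the two Lagrangians differ by `La (x, v₀ x)`, which depends on `x`
        -- alone and is invisible to vertical derivatives.
        have e1 : (fun r => S'.L (prolong f r)) =ᶠ[𝓝 q] fun r => S.L r + La (r.1, v₀ r.1) := by
          filter_upwards [h1, h3] with r hr1 hr3
          rw [hr1, huF, ← hΦF, hr3]
        have e2 : S.L =ᶠ[𝓝 q] fun r => S'.L (prolong f r) - La (r.1, v₀ r.1) :=
          e1.mono fun r hr => by dsimp only at hr ⊢; rw [hr]; ring
        have e3 : vderiv (i, I) (fun r => S'.L (prolong f r)) q = vderiv (i, I) S.L q := by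
          rw [(vderiv_congr (i, I) e1).self_of_nhds]
          have hl : IsLocalAt (fun r : Jet n S.ι => La (r.1, v₀ r.1)) q := by
            have := (h5.comp_map h4.isLocalMapAt).sub h2
            refine this.congr (e1.mono fun r hr => ?_)
            dsimp only at hr ⊢
            rw [hr]
            ring
          refine (lineDeriv_add h2 hl _).trans ?_
          have := vderiv_of_fst (i, I) (fun x => La (x, v₀ x)) q
          rw [vderiv] at this
          rw [this, add_zero]
          rfl
        have e4 : vderiv (i, I) (fun r : Jet n S.ι =>
            ∑ a, totalD (jetY n S.ι) a (fun _ => (0 : ℝ)) r) q = 0 := by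
          simp only [totalD, lineDeriv_const_fun, Finset.sum_const_zero, vderiv]
        rw [e3, e4, ite_self, add_zero, add_zero]) hχ'F
    refine ⟨χ, hχ, he.mono fun q hq hst => ⟨fun a k => ?_, (hq hst).2 fun i => .zero q⟩⟩
    have : vderiv k (fun _ : Jet n S.ι => (0 : ℝ)) q = 0 := lineDeriv_const_fun _ _
    rw [(hq hst).1 a k, this, add_zero]
  -- transfer of potentials along the projection
  have hT2 : ∀ χ', S.IsPresympPotential χ' → ∃ χ, S'.IsPresympPotential χ ∧
      ∀ᶠ q in 𝓝 S'.pt, u q ∈ stationary S.L →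
        (∀ a k, χ a k q = pullForm u (χ' a) k q) ∧
          ((∀ j, IsFlatAt (fun r => H (Φ r) j) q) → q ∈ stationary S'.L) := by
    intro χ' hχ'
    have hχ'u : IsPresympPotentialAt S.L χ' (u S'.pt) := by
      rw [hu]
      exact hχ'
    obtain ⟨χ, hχ, he⟩ := IsPresympPotentialAt.transfer (hucart S'.pt) huloc (τ := τ)
      (fun i => hτ i _) (J := fun _ _ => 0) (fun _ => .const 0) (L := S'.L) (by
        filter_upwards [hvar] with q hq i I
        have e4 : vderiv (i, I) (fun r : Jet n S'.ι =>
            ∑ a, totalD (jetY n S'.ι) a (fun _ => (0 : ℝ)) r) q = 0 := by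
          simp only [totalD, lineDeriv_const_fun, Finset.sum_const_zero, vderiv]
        rw [hq, e4, add_zero]) hχ'u
    refine ⟨χ, hχ, he.mono fun q hq hst => ⟨fun a k => ?_, fun hflat => (hq hst).2 fun i => ?_⟩⟩
    · have : vderiv k (fun _ : Jet n S'.ι => (0 : ℝ)) q = 0 := lineDeriv_const_fun _ _
      rw [(hq hst).1 a k, this, add_zero]
    · rcases hi : e i with i' | j
      · simpa [τ, hi] using IsFlatAt.zero q
      · simpa [τ, hi] using hflat j
  have hmem1 : ∀ᶠ p in 𝓝 S.pt, p ∈ stationary S.L → prolong f p ∈ stationary S'.L := by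
    obtain ⟨χ', hχ'⟩ := (exists_isPresympPotentialAt S.isLocal).2
    obtain ⟨_, _, he⟩ := hT2 χ' hχ'
    filter_upwards [hFt.eventually he, hF.eventually, (hfstt'.eventually hHv₀).eventually_nhds]
      with p h1 h2 h3 hp
    refine (h1 (by rwa [huF])).2 fun j I => ?_
    rw [← iterD_comp_map (isLocalFieldAt_jetY _) h2 (hHl j _)]
    have : (fun q => H (Φ (prolong f q)) j) =ᶠ[𝓝 p] fun _ => 0 := by
      filter_upwards [h3] with r hr
      rw [hΦF, hr]
      rfl
    rw [(iterD_congr I this).self_of_nhds, iterD_const_zero]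
  have hmem2 : ∀ᶠ q in 𝓝 S'.pt, q ∈ stationary S'.L → u q ∈ stationary S.L := by
    obtain ⟨χ', hχ'⟩ := (exists_isPresympPotentialAt S'.isLocal).2
    obtain ⟨_, _, he⟩ := hT1 χ' hχ'
    filter_upwards [hut.eventually he, hFu] with q h1 h2 hq
    exact (h1 (by rwa [h2 hq])).2
  have hzero : ∀ {κ : Type} (k : JetIdx n κ) (q : Jet n κ),
      vderiv k (fun _ : Jet n κ => (0 : ℝ)) q = 0 := fun k q => lineDeriv_const_fun _ _
  refine ⟨prolong f, u, ⟨hF, hFpt, hmem1, fun χ' hχ' => ?_⟩,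
    ⟨hucart _, hu, hmem2, fun χ' hχ' => ?_⟩, .of_forall fun p _ => huF p, hFu⟩
  · obtain ⟨χ, hχ, he⟩ := hT1 χ' hχ'
    refine ⟨χ, hχ, fun _ _ => 0, fun _ => .const 0, ?_⟩
    filter_upwards [he, hmem1] with p h1 h2 hp a k
    rw [(h1 (h2 hp)).1 a k, hzero, add_zero]
  · obtain ⟨χ, hχ, he⟩ := hT2 χ' hχ'
    refine ⟨χ, hχ, fun _ _ => 0, fun _ => .const 0, ?_⟩
    filter_upwards [he, hmem2] with p h1 h2 hp a k
    rw [(h1 (h2 hp)).1 a k, hzero, add_zero]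

theorem LagEquiv.areIsomorphic {S S' : LagSystem n} (h : LagEquiv S S') : AreIsomorphic S S' := by
  induction h with
  | rel S S' h => exact h.elim IsRedefinition.areIsomorphic IsAuxiliaryExtension.areIsomorphic
  | refl S => exact .refl S
  | symm _ _ _ ih => exact ih.symm
  | trans _ _ _ _ _ ih ih' => exact ih.trans ih'

end Equivalence

/-! ## Primitives and coordinate changes -/

section Primitives

variable {n : ℕ} {K : Type} {p : Pt n K}

/-- The Poincaré lemma for local vertical one-forms. -/
theorem exists_vderiv_eq {ρ : VForm n K} (hρ : IsLocalFormAt ρ p)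
    (hcl : ∀ᶠ q in 𝓝 p, ∀ A B, dvForm ρ A B q = 0) :
    ∃ J : Pt n K → ℝ, IsLocalAt J p ∧ ∀ᶠ q in 𝓝 p, ∀ A, vderiv A J q = ρ A q := by
  classical
  have hcoeff := hρ.coeff
  obtain ⟨s, hs⟩ := hρ
  obtain ⟨t₀, g₀, hg₀, he₀⟩ := IsCylindricalAt.pi fun A : s => isLocalAt_iff.1 (hcoeff A)
  -- `t` contains the indices of the possibly nonzero components and all coordinates on which they
  -- depend, so that `ρ` becomes a one-form in finitely many variables.
  obtain ⟨t, ht⟩ : ∃ t, t = t₀ ∪ s := ⟨_, rfl⟩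
  obtain ⟨g₁, hg₁, he₁⟩ : ∃ g₁ : (Fin n → ℝ) × (t → ℝ) → s → ℝ, ContDiff ℝ ∞ g₁ ∧
      ∀ q, g₁ (proj t q) = g₀ (proj t₀ q) :=
    ⟨fun y => g₀ (y.1, fun A => y.2 ⟨A, by simp [ht]⟩), hg₀.comp (by fun_prop), fun _ => rfl⟩
  let G : (Fin n → ℝ) × (t → ℝ) → t → ℝ := fun e A => if h : A.1 ∈ s then g₁ e ⟨A, h⟩ else 0
  have hG : ContDiff ℝ ∞ G := by
    rw [contDiff_pi]
    intro A
    by_cases h : A.1 ∈ s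
    · simp only [G, h, dite_true]
      exact contDiff_pi.1 hg₁ _
    · simp only [G, h, dite_false]
      exact contDiff_const
  have hGA : ∀ A, ContDiff ℝ ∞ fun e => G e A := fun A => contDiff_pi.1 hG A
  have hρG : ∀ᶠ q in 𝓝 p, ∀ A : t, ρ A q = G (proj t q) A := by
    filter_upwards [hs, he₀] with q h1 h2 A
    by_cases h : A.1 ∈ s
    · simp only [G, h, dite_true]
      exact (congrFun h2 ⟨A, h⟩).trans (congrFun (he₁ q).symm _)
    · simp only [G, h, dite_false]
      exact (h1 A).2 h
  let α : (Fin n → ℝ) × (t → ℝ) → (Fin n → ℝ) × (t → ℝ) →L[ℝ] ℝ := fun e =>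
    ∑ A, G e A • (ContinuousLinearMap.proj (R := ℝ) (φ := fun _ : t => ℝ) A).comp
      (ContinuousLinearMap.snd ℝ _ _)
  have hα : ContDiff ℝ ∞ α := ContDiff.sum fun A _ => (hGA A).smul contDiff_const
  -- Projection onto the fibre directions: the `x^a` are mere parameters of the Poincaré lemma.
  let P : (Fin n → ℝ) × (t → ℝ) →L[ℝ] (Fin n → ℝ) × (t → ℝ) :=
    (ContinuousLinearMap.inr ℝ _ _).comp (ContinuousLinearMap.snd ℝ _ _)
  have hαd : ∀ e u v, fderiv ℝ α e u v = ∑ A, fderiv ℝ (fun e => G e A) e u * v.2 A := by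
    intro e u v
    have h1 : HasFDerivAt α _ e := HasFDerivAt.fun_sum fun A _ =>
      (((hGA A).differentiable (by simp) e).hasFDerivAt).smul_const
        ((ContinuousLinearMap.proj (R := ℝ) (φ := fun _ : t => ℝ) A).comp
          (ContinuousLinearMap.snd ℝ (Fin n → ℝ) _))
    rw [h1.fderiv]
    simp
  have hclosed : ∀ᶠ e in 𝓝 (proj t p), ∀ u v,
      fderiv ℝ α e (P u) (P v) = fderiv ℝ α e (P v) (P u) := by
    refine eventually_nhds_proj ?_
    filter_upwards [hcl, hρG.eventually_nhds, eventually_all.2 fun A : t => (hcoeff A).eventually]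
      with q h1 h2 h3
    have key : ∀ (A : t) u, fderiv ℝ (fun e => G e A) (proj t q) (P u) =
        ∑ B : t, u.2 B * vderiv B.1 (ρ A.1) q := by
      intro A u
      let w : K → ℝ := fun B => if h : B ∈ t then u.2 ⟨B, h⟩ else 0
      have hw : proj t ((0, w) : Pt n K) = P u := by
        ext <;> simp [proj_apply, w, P]
      rw [← hw, ← (hasLineDerivAt_of_eventuallyEq (hGA A)
        (h2.mono fun r hr => hr A) (0, w)).lineDeriv, (h3 A).lineDeriv_eq_finsum,
        finsum_eq_sum_of_support_subset (s := t), ← Finset.sum_coe_sort]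
      · refine Finset.sum_congr rfl fun B _ => ?_
        simp [w]
      · intro B hB
        by_contra hBt
        exact hB (by simp [w, show B ∉ t from hBt])
    intro u v
    rw [hαd, hαd]
    simp only [key, Finset.sum_mul]
    rw [Finset.sum_comm]
    refine Finset.sum_congr rfl fun A _ => Finset.sum_congr rfl fun B _ => ?_
    have : vderiv A.1 (ρ B) q = vderiv B.1 (ρ A) q := sub_eq_zero.1 (h1 A B)
    rw [this]
    change u.2 A * _ * v.2 B = v.2 B * _ * u.2 A
    ring
  obtain ⟨J, hJ, hJe⟩ := exists_primitive_along hα P (fun v => by simp [P]) (proj t p) hclosed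
  refine ⟨fun q => J (proj t q), isLocalAt_iff.2 ⟨t, J, hJ, .rfl⟩, ?_⟩
  filter_upwards [hs, hρG, (proj t).continuous.continuousAt.eventually hJe] with q h1 h2 h3 A
  rw [vderiv, (hasLineDerivAt_of_eventuallyEq hJ .rfl _).lineDeriv]
  have hA : P (proj t ((0, Pi.single A 1) : Pt n K)) = proj t ((0, Pi.single A 1) : Pt n K) := by
    ext <;> simp [proj_apply, P]
  have h4 := h3 (proj t ((0, Pi.single A 1) : Pt n K))
  rw [hA] at h4
  have h5 : α (proj t q) (proj t ((0, Pi.single A 1) : Pt n K)) = ρ A q := by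
    simp only [α, _root_.sum_apply, proj_apply]
    by_cases hAt : A ∈ t
    · rw [Finset.sum_eq_single (⟨A, hAt⟩ : t)]
      · have := h2 ⟨A, hAt⟩
        simp only [proj_apply] at this
        simp [this]
      · intro B _ hB
        have : B.1 ≠ A := fun h => hB (Subtype.ext h)
        simp [this]
      · simp
    · have h6 : ρ A q = 0 := (h1 A).2 fun h => hAt (by rw [ht]; exact Finset.mem_union_right _ h)
      rw [h6]
      refine Finset.sum_eq_zero fun B _ => ?_
      have : B.1 ≠ A := fun h => hAt (h ▸ B.2)
      simp [this]
  rw [← h5, ← h4]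

/-- A local function without vertical derivatives is the derivative, in a given direction, of a
function of the independent variables. -/
theorem exists_primitive_of_vderiv_eq_zero {k : Pt n K → ℝ} (hk : IsLocalAt k p)
    (hv : ∀ᶠ q in 𝓝 p, ∀ A, vderiv A k q = 0) (a : Fin n) :
    ∃ k₁ : (Fin n → ℝ) → ℝ, ContDiff ℝ ∞ k₁ ∧
      ∀ᶠ q in 𝓝 p, ∀ w, lineDeriv ℝ (fun r : Pt n K => k₁ r.1) q (Pi.single a 1, w) = k q := by
  obtain ⟨s, g, hg, he⟩ := isLocalAt_iff.1 hk
  -- The fibre coordinates are frozen at the base point. Integrating along the single axis `a`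
  -- imposes no closedness condition.
  let κ : (Fin n → ℝ) → ℝ := fun x => g (x, (proj s p).2)
  have hκ : ContDiff ℝ ∞ κ := hg.comp (by fun_prop)
  let α : (Fin n → ℝ) → (Fin n → ℝ) →L[ℝ] ℝ := fun x =>
    κ x • ContinuousLinearMap.proj (R := ℝ) (φ := fun _ : Fin n => ℝ) a
  let P : (Fin n → ℝ) →L[ℝ] (Fin n → ℝ) :=
    (ContinuousLinearMap.single ℝ (fun _ : Fin n => ℝ) a).comp
      (ContinuousLinearMap.proj (R := ℝ) (φ := fun _ : Fin n => ℝ) a)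
  have hP : ∀ v, P v = v a • Pi.single a 1 := by
    intro v
    ext b
    simp [P, Pi.single_apply]
  obtain ⟨k₁, hk₁, hk₁e⟩ := exists_primitive_along (α := α) (hκ.smul contDiff_const) P
    (fun v => by simp [hP]) p.1 (.of_forall fun e u v => by
      have h1 : HasFDerivAt α _ e :=
        ((hκ.differentiable (by simp) e).hasFDerivAt).smul_const
          (ContinuousLinearMap.proj (R := ℝ) (φ := fun _ : Fin n => ℝ) a)
      rw [h1.fderiv]
      simp [hP]
      ring)
  have hconst : ∀ᶠ q in 𝓝 p, k q = κ q.1 := by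
    have h1 : ∀ᶠ y in 𝓝 (proj s p), ∀ u, fderiv ℝ g y (0, u) = 0 := by
      classical
      refine eventually_nhds_proj ?_
      filter_upwards [hv, he.eventually_nhds, hk.eventually] with q h1 h2 h3 u
      let w : K → ℝ := fun B => if h : B ∈ s then u ⟨B, h⟩ else 0
      have hw : proj s ((0, w) : Pt n K) = (0, u) := by
        ext <;> simp [proj_apply, w]
      rw [← hw, ← (hasLineDerivAt_of_eventuallyEq hg h2 (0, w)).lineDeriv, h3.lineDeriv_eq_finsum]
      simp [h1]
    obtain ⟨r, hr, hball⟩ := Metric.eventually_nhds_iff_ball.1 h1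
    filter_upwards [he, (proj s).continuous.continuousAt.eventually (Metric.ball_mem_nhds _ hr)]
      with q h2 h3
    rw [h2]
    -- `g` is constant along the segment joining the fibre coordinates of `p` to those of `q`, which
    -- stays within the ball where its fibre derivatives vanish.
    let γ : ℝ → ℝ := fun t => g (q.1, (proj s p).2 + t • ((proj s q).2 - (proj s p).2))
    have hγ : ∀ t, HasDerivAt γ (fderiv ℝ g
        (q.1, (proj s p).2 + t • ((proj s q).2 - (proj s p).2))
        (0, (proj s q).2 - (proj s p).2)) t := by
      intro t
      have h4 : HasDerivAt (fun t : ℝ => (q.1, (proj s p).2 + t • ((proj s q).2 - (proj s p).2)))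
          (0, (proj s q).2 - (proj s p).2) t := by
        have := ((hasDerivAt_id t).smul_const ((proj s q).2 - (proj s p).2)).const_add (proj s p).2
        simpa using (hasDerivAt_const t q.1).prodMk this
      exact ((hg.differentiable (by simp) _).hasFDerivAt).comp_hasDerivAt t h4
    have h5 : γ 1 = γ 0 := by
      refine constant_of_has_deriv_right_zero (a := 0) (b := 1)
        (fun t _ => (hγ t).continuousAt.continuousWithinAt) (fun t ht => ?_) 1 (by simp)
      have h6 : (q.1, (proj s p).2 + t • ((proj s q).2 - (proj s p).2)) ∈
          Metric.ball (proj s p) r := by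
        rw [dist_eq_norm, Prod.norm_def, max_lt_iff] at h3
        rw [Metric.mem_ball, dist_eq_norm, Prod.norm_def, max_lt_iff]
        refine ⟨h3.1, ?_⟩
        have h8 : ‖t • ((proj s q).2 - (proj s p).2)‖ ≤ ‖(proj s q).2 - (proj s p).2‖ := by
          rw [norm_smul, Real.norm_of_nonneg ht.1]
          exact mul_le_of_le_one_left (norm_nonneg _) ht.2.le
        simpa using h8.trans_lt h3.2
      have h7 := (hγ t).hasDerivWithinAt (s := Set.Ici t)
      rwa [hball _ h6] at h7
    simp only [γ, one_smul, zero_smul, add_zero, add_sub_cancel] at h5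
    exact h5
  refine ⟨k₁, hk₁, ?_⟩
  filter_upwards [hconst, continuousAt_fst.eventually hk₁e] with q h1 h2 w
  have h3 : HasDerivAt (fun t : ℝ => (q + t • ((Pi.single a 1, w) : Pt n K)).1)
      (Pi.single a 1) 0 := by
    simpa using ((hasDerivAt_id (0 : ℝ)).smul_const (Pi.single a 1 : Fin n → ℝ)).const_add q.1
  have h4 : HasFDerivAt k₁ (fderiv ℝ k₁ q.1) (q + (0 : ℝ) • ((Pi.single a 1, w) : Pt n K)).1 := by
    simpa using (hk₁.differentiable (by simp) q.1).hasFDerivAt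
  have h5 := h2 (Pi.single a 1)
  have h6 : P (Pi.single a 1) = Pi.single a 1 := by simp [hP]
  rw [h6] at h5
  rw [h1]
  refine (HasLineDerivAt.lineDeriv (h4.comp_hasDerivAt 0 h3)).trans (h5.trans ?_)
  simp [α]

/-- Independent local functions are part of a coordinate system. -/
theorem exists_isCoordChange {ι : Type} [Fintype ι] {φ : ι → Pt n K → ℝ}
    (hφ : ∀ i, IsLocalAt (φ i) p) (hli : LinearIndependent ℝ fun i A => vderiv A (φ i) p) :
    ∃ (M : Type) (θ : Pt n K → Pt n (ι ⊕ M)) (η : Pt n (ι ⊕ M) → Pt n K),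
      IsCoordChange θ η p ∧ (∀ q, (θ q).1 = q.1) ∧ (∀ q i, (θ q).2 (Sum.inl i) = φ i q) ∧
        ∀ μ, (θ p).2 (Sum.inr μ) = 0 := by
  classical
  let w : K → ι → ℝ := fun A i => vderiv A (φ i) p
  -- Row rank equals column rank: a functional killing all columns would be a linear relation among
  -- the rows, that is, among the differentials `d_vφ^i`.
  have hspan : Submodule.span ℝ (Set.range w) = ⊤ := by
    by_contra hne
    obtain ⟨f, hf, hle⟩ := Submodule.exists_le_ker_of_lt_top _ (lt_top_iff_ne_top.2 hne)
    have h1 : ∀ i, f (Pi.single i 1) = 0 := by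
      refine Fintype.linearIndependent_iff.1 hli (fun i => f (Pi.single i 1)) ?_
      ext A
      have h2 : f (w A) = 0 := hle (Submodule.subset_span ⟨A, rfl⟩)
      have h3 : w A = ∑ i, w A i • (Pi.single i 1 : ι → ℝ) := by
        ext i
        simp [Finset.sum_apply, Pi.single_apply]
      rw [h3, map_sum] at h2
      simpa [Finset.sum_apply, w, mul_comm] using h2
    refine hf (LinearMap.pi_ext' fun i => LinearMap.ext_ring ?_)
    simpa using h1 i
  -- A basis among the columns selects the finitely many coordinates `a k` that are traded for the
  -- functions `φ^i`; all others are kept.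
  obtain ⟨κ, a, ha, hsp, hlw⟩ := exists_linearIndependent' ℝ w
  rw [hspan] at hsp
  have : Finite κ := hlw.finite
  have : Fintype κ := Fintype.ofFinite κ
  have hT : Function.Bijective (Fintype.linearCombination ℝ (w ∘ a)) := by
    refine ⟨hlw.fintypeLinearCombination_injective, LinearMap.range_eq_top.1 ?_⟩
    rw [Fintype.range_linearCombination, hsp]
  obtain ⟨s, g, hg, he⟩ := IsCylindricalAt.pi fun i => isLocalAt_iff.1 (hφ i)
  -- `r` overwrites the selected coordinates by independent variables, so that `g ∘ r` exhibits the
  -- `φ^i` as functions of these with everything else a parameter.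
  let r : ((Fin n → ℝ) × (s → ℝ)) × (κ → ℝ) → (Fin n → ℝ) × (s → ℝ) := fun z =>
    (z.1.1, fun A => if h : ∃ k, a k = A then z.2 h.choose else z.1.2 A)
  have hr : ContDiff ℝ ∞ r := by
    refine (by fun_prop : ContDiff ℝ ∞ fun z : ((Fin n → ℝ) × (s → ℝ)) × (κ → ℝ) =>
      z.1.1).prodMk (contDiff_pi.2 fun A => ?_)
    by_cases h : ∃ k, a k = A
    · simp only [h, dite_true]
      fun_prop
    · simp only [h, dite_false]
      fun_prop
  have hr_eq : ∀ (b q : Pt n K) (u : κ → ℝ), b.1 = q.1 → (∀ k, q.2 (a k) = u k) →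
      (∀ A, (¬∃ k, a k = A) → q.2 A = b.2 A) → r (proj s b, u) = proj s q := by
    intro b q u h1 h2 h3
    refine Prod.ext h1 (funext fun A => ?_)
    by_cases h : ∃ k, a k = A.1
    · simp only [r, h, dite_true, proj_apply]
      rw [← h2, h.choose_spec]
    · simp only [r, h, dite_false, proj_apply]
      exact (h3 A h).symm
  let h : ((Fin n → ℝ) × (s → ℝ)) × (κ → ℝ) → ι → ℝ := fun z => g (r z)
  have hh : ContDiff ℝ ∞ h := hg.comp hr
  let u₀ : κ → ℝ := fun k => p.2 (a k)
  have hderiv : ∀ v : κ → ℝ, fderiv ℝ h (proj s p, u₀) (0, v) =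
      Fintype.linearCombination ℝ (w ∘ a) v := by
    intro v
    let V : K → ℝ := fun A => if h : ∃ k, a k = A then v h.choose else 0
    have hVa : ∀ k, V (a k) = v k := by
      intro k
      have hk : ∃ k', a k' = a k := ⟨k, rfl⟩
      simp only [V, hk, dite_true]
      rw [ha hk.choose_spec]
    have hV0 : ∀ A, (¬∃ k, a k = A) → V A = 0 := fun A hA => by simp only [V, hA, dite_false]
    have h1 : HasDerivAt (fun t : ℝ => h (proj s p, u₀ + t • v))
        (fderiv ℝ h (proj s p, u₀) (0, v)) 0 := by
      have h2 : HasDerivAt (fun t : ℝ => (proj s p, u₀ + t • v)) (0, v) 0 := by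
        have := ((hasDerivAt_id (0 : ℝ)).smul_const v).const_add u₀
        simpa using (hasDerivAt_const (0 : ℝ) (proj s p)).prodMk this
      have h3 : HasFDerivAt h (fderiv ℝ h (proj s p, u₀)) (proj s p, u₀ + (0 : ℝ) • v) := by
        simpa using (hh.differentiable (by simp) (proj s p, u₀)).hasFDerivAt
      exact h3.comp_hasDerivAt 0 h2
    have h4 : (fun t : ℝ => h (proj s p, u₀ + t • v)) = fun t =>
        g (proj s (p + t • ((0, V) : Pt n K))) := by
      ext1 t
      refine congrArg g (hr_eq _ _ _ (by simp) (fun k => ?_) fun A hA => ?_)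
      · simp [u₀, hVa]
      · simp [hV0 A hA]
    have h5 := hasLineDerivAt_of_eventuallyEq hg he ((0, V) : Pt n K)
    have h6 : HasDerivAt (fun t : ℝ => g (proj s (p + t • ((0, V) : Pt n K))))
        (fderiv ℝ g (proj s p) (proj s ((0, V) : Pt n K))) 0 :=
      hasLineDerivAt_of_eventuallyEq (F := fun q => g (proj s q)) hg .rfl _
    rw [h4] at h1
    rw [h1.unique h6]
    ext i
    have h7 : HasLineDerivAt ℝ (φ i) (fderiv ℝ g (proj s p) (proj s ((0, V) : Pt n K)) i) p
        (0, V) := hasDerivAt_pi.1 h5 i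
    rw [← h7.lineDeriv, (hφ i).lineDeriv_eq_finsum,
      finsum_eq_sum_of_support_subset (s := Finset.univ.image a), Finset.sum_image ha.injOn]
    · simp [Fintype.linearCombination_apply, hVa, w]
    · intro A hA
      by_contra hA'
      refine hA ?_
      simp only
      rw [hV0 A fun ⟨k, hk⟩ => hA' (by simp [← hk]), zero_mul]
  have hbij : Function.Bijective fun v : κ → ℝ => fderiv ℝ h (proj s p, u₀) (0, v) := by
    simp only [hderiv]
    exact hT
  obtain ⟨R, hR, -, hRh, hhR⟩ := exists_parametric_inverse hh (proj s p) u₀ hbij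
  have hbase : h (proj s p, u₀) = fun i => φ i p := by
    rw [show (fun i => φ i p) = g (proj s p) from he.self_of_nhds]
    exact congrArg g (hr_eq _ _ _ rfl (fun _ => rfl) fun _ _ => rfl)
  let M : Type := {A : K // ¬∃ k, a k = A}
  let θ : Pt n K → Pt n (ι ⊕ M) := fun q =>
    (q.1, Sum.elim (fun i => φ i q) fun μ => q.2 μ.1 - p.2 μ.1)
  -- The parameter of `R` nominally includes the selected coordinates, which are unknown when
  -- inverting. As `r` overwrites them, they may be reset to their values at `p`.
  let b : Pt n (ι ⊕ M) → Pt n K := fun y =>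
    (y.1, fun A => if hA : ∃ k, a k = A then p.2 A else y.2 (Sum.inr ⟨A, hA⟩) + p.2 A)
  let η : Pt n (ι ⊕ M) → Pt n K := fun y => (y.1, fun A => if hA : ∃ k, a k = A then
    R (proj s (b y), fun i => y.2 (Sum.inl i)) hA.choose else y.2 (Sum.inr ⟨A, hA⟩) + p.2 A)
  have hb : ∀ y, IsLocalMapAt b y := by
    refine fun y => .of_forall fun z => ⟨rfl, fun A => ?_⟩
    by_cases hA : ∃ k, a k = A
    · simpa only [b, hA, dite_true] using IsLocalAt.const _
    · simpa only [b, hA, dite_false] using (IsLocalAt.coord _).add (.const _)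
  have hη : ∀ y, IsLocalMapAt η y := by
    refine fun y => .of_forall fun z => ⟨rfl, fun A => ?_⟩
    by_cases hA : ∃ k, a k = A
    · simp only [η, hA, dite_true]
      exact isLocalAt_iff.2 ((((hb z).isCylindricalAt_proj s).prodMk
        (IsCylindricalAt.pi fun i => .coord (Sum.inl i))).comp (contDiff_pi.1 hR _))
    · simpa only [η, hA, dite_false] using (IsLocalAt.coord _).add (.const _)
  have hθ : IsLocalMapAt θ p := by
    filter_upwards [eventually_all.2 fun i => (hφ i).eventually] with q hq
    refine ⟨rfl, fun k => ?_⟩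
    rcases k with i | μ
    · exact hq i
    · exact (IsLocalAt.coord _).sub (.const _)
  have hbθ1 : ∀ q A, (¬∃ k, a k = A) → (b (θ q)).2 A = q.2 A := by
    intro q A hA
    simp [b, θ, hA]
  have hbθp : b (θ p) = p := by
    refine Prod.ext rfl (funext fun A => ?_)
    by_cases hA : ∃ k, a k = A
    · simp [b, hA]
    · exact hbθ1 p A hA
  have hηa : ∀ y k, (η y).2 (a k) = R (proj s (b y), fun i => y.2 (Sum.inl i)) k := by
    intro y k
    have hk : ∃ k', a k' = a k := ⟨k, rfl⟩
    simp only [η, hk, dite_true]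
    rw [ha hk.choose_spec]
  have hηb : ∀ y A, (¬∃ k, a k = A) → (η y).2 A = (b y).2 A := by
    intro y A hA
    simp [η, b, hA]
  have hleft : ∀ᶠ q in 𝓝 p, η (θ q) = q := by
    have ht : Tendsto (fun q => (proj s (b (θ q)), fun k => q.2 (a k))) (𝓝 p)
        (𝓝 (proj s p, u₀)) := by
      have h1 : ContinuousAt (fun q => b (θ q)) p := ((hb _).comp hθ).continuousAt
      have h2 : ContinuousAt (fun q => (proj s (b (θ q)), fun k => q.2 (a k))) p :=
        ((proj s).continuous.continuousAt.comp h1).prodMk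
          (continuousAt_pi.2 fun k => (IsLocalAt.coord (a k)).continuousAt)
      rw [ContinuousAt, hbθp] at h2
      exact h2
    filter_upwards [ht.eventually hRh, he] with q h1 h2
    have h3 : h (proj s (b (θ q)), fun k => q.2 (a k)) = fun i => φ i q := by
      rw [h2]
      exact congrArg g (hr_eq _ _ _ rfl (fun _ => rfl) fun A hA => (hbθ1 q A hA).symm)
    simp only [h3] at h1
    refine Prod.ext rfl (funext fun A => ?_)
    by_cases hA : ∃ k, a k = A
    · obtain ⟨k, rfl⟩ := hA
      rw [hηa]
      exact congrFun h1 k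
    · rw [hηb _ _ hA, hbθ1 _ _ hA]
  have hright : ∀ᶠ y in 𝓝 (θ p), θ (η y) = y := by
    have ht1 : Tendsto η (𝓝 (θ p)) (𝓝 p) := by
      have := (hη (θ p)).continuousAt
      rwa [ContinuousAt, hleft.self_of_nhds] at this
    have ht2 : Tendsto (fun y : Pt n (ι ⊕ M) => (proj s (b y), fun i => y.2 (Sum.inl i)))
        (𝓝 (θ p)) (𝓝 (proj s p, h (proj s p, u₀))) := by
      have h2 : ContinuousAt (fun y : Pt n (ι ⊕ M) =>
          (proj s (b y), fun i => y.2 (Sum.inl i))) (θ p) :=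
        ((proj s).continuous.continuousAt.comp (hb _).continuousAt).prodMk
          (continuousAt_pi.2 fun i => (IsLocalAt.coord (Sum.inl i)).continuousAt)
      rw [ContinuousAt, hbθp] at h2
      rw [hbase]
      exact h2
    filter_upwards [ht1.eventually he, ht2.eventually hhR] with y h1 h2
    have h3 : h (proj s (b y), R (proj s (b y), fun i => y.2 (Sum.inl i))) =
        fun i => φ i (η y) := by
      rw [h1]
      exact congrArg g (hr_eq _ _ _ rfl (fun k => hηa y k) fun A hA => hηb y A hA)
    refine Prod.ext rfl (funext fun k => ?_)
    rcases k with i | μ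
    · have h4 := congrFun (h3.symm.trans h2) i
      exact h4
    · have : (η y).2 μ.1 = y.2 (Sum.inr μ) + p.2 μ.1 := by
        simp only [η, μ.2, dite_false]
        rfl
      change (η y).2 μ.1 - p.2 μ.1 = _
      rw [this, add_sub_cancel_right]
  exact ⟨M, θ, η, ⟨hθ, hη _, hleft, hright⟩, fun _ => rfl, fun _ _ => rfl,
    fun μ => sub_self _⟩

end Primitives

/-! ## Intrinsic Lagrangians of first-order systems -/

section Potentials

variable {n : ℕ} {K K' : Type} {p : Pt n K} {Y : Fin n → K → Pt n K → ℝ}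

theorem vderiv_add {f g : Pt n K → ℝ} (hf : IsLocalAt f p) (hg : IsLocalAt g p) (A : K) :
    vderiv A (fun q => f q + g q) p = vderiv A f p + vderiv A g p :=
  lineDeriv_add hf hg _

theorem vderiv_sub {f g : Pt n K → ℝ} (hf : IsLocalAt f p) (hg : IsLocalAt g p) (A : K) :
    vderiv A (fun q => f q - g q) p = vderiv A f p - vderiv A g p :=
  lineDeriv_sub hf hg _

theorem vderiv_mul {f g : Pt n K → ℝ} (hf : IsLocalAt f p) (hg : IsLocalAt g p) (A : K) :
    vderiv A (fun q => f q * g q) p = vderiv A f p * g p + f p * vderiv A g p :=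
  lineDeriv_mul hf hg _

theorem vderiv_sum {ι : Type} [Fintype ι] {f : ι → Pt n K → ℝ} (hf : ∀ i, IsLocalAt (f i) p)
    (A : K) : vderiv A (fun q => ∑ i, f i q) p = ∑ i, vderiv A (f i) p :=
  lineDeriv_sum (fun i _ => hf i) _

theorem dvForm_vderiv {f : Pt n K → ℝ} (hf : IsLocalAt f p) (A B : K) :
    dvForm (fun C => vderiv C f) A B p = 0 :=
  sub_eq_zero.2 (lineDeriv_comm hf _ _)

theorem dvForm_congr {ρ ρ' : VForm n K} (h : ∀ᶠ q in 𝓝 p, ∀ B, ρ' B q = ρ B q) (A B : K) :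
    dvForm ρ' A B p = dvForm ρ A B p := by
  have h1 : ∀ A B, vderiv A (ρ' B) p = vderiv A (ρ B) p := fun A B =>
    (vderiv_congr A (h.mono fun q hq => hq B)).self_of_nhds
  rw [dvForm, dvForm, h1, h1]

theorem dvForm_add {ρ ρ' : VForm n K} (h : IsLocalFormAt ρ p) (h' : IsLocalFormAt ρ' p) (A B : K) :
    dvForm (fun C q => ρ C q + ρ' C q) A B p = dvForm ρ A B p + dvForm ρ' A B p := by
  have h1 : ∀ A B, vderiv A (fun q => ρ B q + ρ' B q) p = vderiv A (ρ B) p + vderiv A (ρ' B) p :=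
    fun A B => vderiv_add (h.coeff B) (h'.coeff B) _
  rw [dvForm, dvForm, dvForm, h1, h1]
  ring

theorem dvForm_neg {ρ : VForm n K} (A B : K) :
    dvForm (fun C q => -ρ C q) A B p = -dvForm ρ A B p := by
  have h1 : ∀ A B, vderiv A (fun q => -ρ B q) p = -vderiv A (ρ B) p :=
    fun A B => lineDeriv_neg_fun _ _
  rw [dvForm, dvForm, h1, h1]
  ring

/-- Two potentials of the same presymplectic structure differ by an exact form. -/
theorem exists_eq_add_of_potentials (hn : 0 < n) (hY : IsLocalFieldAt Y p)
    {χ χ₀ : Fin n → VForm n K} {l l₀ : Pt n K → ℝ} (hχ : ∀ a, IsLocalFormAt (χ a) p)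
    (hχ₀ : ∀ a, IsLocalFormAt (χ₀ a) p) (hl : IsLocalAt l p) (hl₀ : IsLocalAt l₀ p)
    (hd : ∀ᶠ q in 𝓝 p, ∀ a A B, dvForm (χ a) A B q = dvForm (χ₀ a) A B q)
    (h : ∀ᶠ q in 𝓝 p, ∀ B, divForm Y χ B q = vderiv B l q)
    (h₀ : ∀ᶠ q in 𝓝 p, ∀ B, divForm Y χ₀ B q = vderiv B l₀ q) :
    ∃ J : Fin n → Pt n K → ℝ, (∀ a, IsLocalAt (J a) p) ∧
      ∀ᶠ q in 𝓝 p, (∀ a A, χ a A q = χ₀ a A q + vderiv A (J a) q) ∧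
        l q = l₀ q + ∑ a, totalD Y a (J a) q := by
  classical
  have hχ' := eventually_all.2 fun a => (hχ a).eventually
  have hχ₀' := eventually_all.2 fun a => (hχ₀ a).eventually
  -- Having equal vertical differentials, the components `χ a` and `χ₀ a` differ by a vertically
  -- closed form, to which the vertical Poincaré lemma applies.
  have hex : ∀ a, ∃ J : Pt n K → ℝ, IsLocalAt J p ∧
      ∀ᶠ q in 𝓝 p, ∀ A, vderiv A J q = χ a A q + -χ₀ a A q := by
    intro a
    refine exists_vderiv_eq (ρ := fun A q => χ a A q + -χ₀ a A q) ((hχ a).add (hχ₀ a).neg) ?_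
    filter_upwards [hd, hχ', hχ₀'] with q h1 h2 h3 A B
    rw [dvForm_add (h2 a) (h3 a).neg, dvForm_neg, h1 a, add_neg_cancel]
  choose J hJ hJe using hex
  have hJ' := eventually_all.2 fun a => (hJ a).eventually
  have hχe : ∀ᶠ q in 𝓝 p, ∀ a A, χ a A q = χ₀ a A q + vderiv A (J a) q := by
    filter_upwards [eventually_all.2 hJe] with q h1 a A
    rw [h1]
    ring
  have hdJ : IsLocalAt (fun q => ∑ a, totalD Y a (J a) q) p :=
    IsLocalAt.sum fun a _ => (hJ a).totalD hY.component a
  have hm : IsLocalAt (fun q => l q - l₀ q - ∑ a, totalD Y a (J a) q) p := (hl.sub hl₀).sub hdJ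
  -- Subtracting the two horizontal equations and moving `d_v` past `D_a` shows that the remaining
  -- mismatch has no vertical derivatives.
  have hm0 : ∀ᶠ q in 𝓝 p, ∀ A, vderiv A (fun q => l q - l₀ q - ∑ a, totalD Y a (J a) q) q = 0 := by
    filter_upwards [h, h₀, hχe.eventually_nhds, hl.eventually, hl₀.eventually, hdJ.eventually,
      hJ', hY.eventually, hχ₀'] with q h1 h2 h3 h4 h5 h6 h7 h8 h9 A
    have e1 : vderiv A (fun q => l q - l₀ q - ∑ a, totalD Y a (J a) q) q =
        vderiv A l q - vderiv A l₀ q - vderiv A (fun q => ∑ a, totalD Y a (J a) q) q :=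
      by rw [vderiv_sub (h4.sub h5) h6, vderiv_sub h4 h5]
    rw [e1, ← h1, ← h2, ← divForm_vderiv h8 h7, divForm_congr h3,
      divForm_add h8 h9 fun a => IsLocalFormAt.vderiv (h7 a)]
    ring
  -- The mismatch is a function of `x` only. Since `n ≥ 1` it is a derivative along the first axis,
  -- and adding its primitive to one component of `J` leaves `d_v J` unchanged.
  obtain ⟨k, hk, hke⟩ := exists_primitive_of_vderiv_eq_zero hm hm0 ⟨0, hn⟩
  have hkl : ∀ q : Pt n K, IsLocalAt (fun r : Pt n K => k r.1) q := fun q =>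
    .of_fst (.of_forall fun _ => hk.contDiffAt)
  let a₀ : Fin n := ⟨0, hn⟩
  refine ⟨fun a q => J a q + if a = a₀ then k q.1 else 0, fun a => (hJ a).add ?_, ?_⟩
  · by_cases ha : a = a₀
    · simpa only [ha, if_true] using hkl p
    · simpa only [ha, if_false] using IsLocalAt.const 0
  · filter_upwards [hχe, hke, hJ'] with q h1 h2 h3
    have h4 : ∀ a v, lineDeriv ℝ (fun q => J a q + if a = a₀ then k q.1 else 0) q v =
        lineDeriv ℝ (J a) q v + if a = a₀ then lineDeriv ℝ (fun r : Pt n K => k r.1) q v else 0 := by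
      intro a v
      by_cases ha : a = a₀
      · simp only [ha, if_true]
        exact lineDeriv_add (h3 _) (hkl q) v
      · simp only [ha, if_false, add_zero]
    refine ⟨fun a A => ?_, ?_⟩
    · rw [h1 a A, vderiv, vderiv, h4]
      have : lineDeriv ℝ (fun r : Pt n K => k r.1) q (0, Pi.single A 1) = 0 := vderiv_of_fst A k q
      simp only [this, ite_self, add_zero]
    · have h5 : ∀ a, totalD Y a (fun q => J a q + if a = a₀ then k q.1 else 0) q =
          totalD Y a (J a) q + if a = a₀ then l q - l₀ q - ∑ a, totalD Y a (J a) q else 0 := by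
        intro a
        rw [totalD, h4]
        by_cases ha : a = a₀
        · simp only [ha, if_true]
          rw [h2]
          rfl
        · simp only [ha, if_false]
          rfl
      simp only [h5, Finset.sum_add_distrib, Finset.sum_ite_eq', Finset.mem_univ, if_true]
      ring

end Potentials

/-! ### Charts of the equation manifold -/

section Charts

variable {n : ℕ} {S S₁ : LagSystem n}

theorem EqChart.tendsto_emb (c : EqChart S) : Tendsto c.emb (𝓝 c.q₀) (𝓝 S.pt) := by
  have := c.emb_local.continuousAt
  rwa [ContinuousAt, c.emb_base] at this

theorem EqChart.isLocalFieldAt_Y (c : EqChart S) : IsLocalFieldAt c.Y c.q₀ := by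
  filter_upwards [c.emb_local.eventually, c.tendsto_emb.eventually c.ψ_local] with q h1 h2 a A
  exact IsLocalAt.comp_map (h := totalD (jetY n S.ι) a fun p => (c.ψ p).2 A) h1
    ((h2.2 A).totalD (isLocalFieldAt_jetY _).component a)

theorem EqChart.isCartanMapAt_emb (c : EqChart S) :
    IsCartanMapAt c.Y (jetY n S.ι) c.emb c.q₀ :=
  ⟨c.emb_local, c.tangent⟩

theorem vderiv_linearCombination {K ι : Type} [Fintype ι] {p : Pt n K} {φ : ι → Pt n K → ℝ}
    (hφ : ∀ i, IsLocalAt (φ i) p) (t : ι → ℝ) (A : K) :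
    vderiv A (fun q => ∑ i, t i * φ i q) p = ∑ i, t i * vderiv A (φ i) p := by
  rw [vderiv_sum fun i => (IsLocalAt.const (t i)).mul (hφ i)]
  refine Finset.sum_congr rfl fun i _ => ?_
  rw [vderiv_mul (.const _) (hφ i), vderiv, lineDeriv_const_fun, zero_mul, zero_add]

/-- Independence of functions can be checked after composition with a local map. -/
theorem linearIndependent_vderiv_of_comp {K K' ι : Type} [Fintype ι] {p : Pt n K}
    {m : Pt n K → Pt n K'} (hm : IsLocalMapAt m p) {φ : ι → Pt n K' → ℝ}
    (hφ : ∀ i, IsLocalAt (φ i) (m p))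
    (h : LinearIndependent ℝ fun i B => vderiv B (fun q => φ i (m q)) p) :
    LinearIndependent ℝ fun i A => vderiv A (φ i) (m p) := by
  rw [Fintype.linearIndependent_iff] at h ⊢
  intro t ht
  refine h t (funext fun B => ?_)
  have h1 : ∀ A, vderiv A (fun q => ∑ i, t i * φ i q) (m p) = 0 := by
    intro A
    rw [vderiv_linearCombination hφ]
    simpa using congrFun ht A
  have h2 := vderiv_comp_map (h := fun q => ∑ i, t i * φ i q) hm
    (IsLocalAt.sum fun i _ => (IsLocalAt.const (t i)).mul (hφ i)) B
  simp only [h1, zero_mul, finsum_zero] at h2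
  rw [vderiv_linearCombination fun i => (hφ i).comp_map hm] at h2
  simpa using h2

end Charts

/-! ### First-order Lagrangians and their presymplectic potential -/

section FirstOrder

variable {n : ℕ} {ι : Type} [Fintype ι]

/-- The first-order Lagrangian `V^a_i(φ,x) φ^i_a - H(φ,x)`. -/
def firstOrderLag (V : Fin n → ι → Pt n ι → ℝ) (H : Pt n ι → ℝ) (p : Jet n ι) : ℝ :=
  ∑ a, ∑ i, V a i (jetProj p) * p.2 (i, Pi.single a 1) - H (jetProj p)

/-- The form `V^a_i(φ,x) d_vφ^i`. -/
def firstOrderForm (V : Fin n → ι → Pt n ι → ℝ) (a : Fin n) : VForm n (JetIdx n ι) :=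
  fun B q => ∑ i, V a i (jetProj q) * vderiv B (fun r : Jet n ι => r.2 (i, 0)) q

theorem isLocalMapAt_jetProj {κ : Type} (p : Jet n κ) : IsLocalMapAt jetProj p :=
  .of_forall fun _ => ⟨rfl, fun i => .coord (i, 0)⟩

theorem vderiv_comp_jetProj {κ : Type} (h : Pt n κ → ℝ) {k : JetIdx n κ} (hk : k.2 ≠ 0)
    (p : Jet n κ) : vderiv k (fun q => h (jetProj q)) p = 0 := by
  classical
  have h1 : ∀ t : ℝ, jetProj (p + t • ((0, Pi.single k 1) : Jet n κ)) = jetProj p := by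
    intro t
    refine Prod.ext (by simp [jetProj]) (funext fun i => ?_)
    have : (i, (0 : Fin n → ℕ)) ≠ k := fun h => hk (by rw [← h])
    simp [jetProj, this]
  rw [vderiv, lineDeriv]
  have h2 : (fun t : ℝ => h (jetProj (p + t • ((0, Pi.single k 1) : Jet n κ)))) =
      fun _ => h (jetProj p) := funext fun t => by rw [h1]
  convert deriv_const (0 : ℝ) (h (jetProj p)) using 2
  convert h2

variable {V : Fin n → ι → Pt n ι → ℝ} {H : Pt n ι → ℝ} {p : Jet n ι}

theorem isLocalAt_firstOrderLag (hV : ∀ a i, IsLocalAt (V a i) (jetProj p))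
    (hH : IsLocalAt H (jetProj p)) : IsLocalAt (firstOrderLag V H) p :=
  (IsLocalAt.sum fun a _ => IsLocalAt.sum fun i _ =>
    ((hV a i).comp_map (isLocalMapAt_jetProj p)).mul (.coord _)).sub
      (hH.comp_map (isLocalMapAt_jetProj p))

theorem formRep_firstOrderForm (hV : ∀ a i, IsLocalAt (V a i) (jetProj p)) (a : Fin n) :
    FormRep (firstOrderForm V a) p (fun i q => V a i (jetProj q)) (fun i q => q.2 (i, 0)) :=
  FormRep.of_sum (fun i => (hV a i).comp_map (isLocalMapAt_jetProj p)) fun _ => .coord _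

/-- Only the coefficients with `I ≠ 0` need checking: there `d_v L` consists of the terms `V^a_i
d_vφ^i_a`, which are the part of `D_a (V^a_i d_vφ^i)` where the derivative falls on `d_vφ^i`. The
discrepancy at `I = 0` is a source, hence the Euler–Lagrange derivative by uniqueness. -/
theorem isPresympPotentialAt_firstOrderForm (hV : ∀ a i, IsLocalAt (V a i) (jetProj p))
    (hH : IsLocalAt H (jetProj p)) :
    IsPresympPotentialAt (firstOrderLag V H) (firstOrderForm V) p := by
  have hχ : ∀ a, IsLocalFormAt (firstOrderForm V a) p := fun a =>
    (formRep_firstOrderForm hV a).isLocalFormAt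
  have hloc : ∀ᶠ q in 𝓝 p, (∀ a i, IsLocalAt (V a i) (jetProj q)) ∧ IsLocalAt H (jetProj q) :=
    (isLocalMapAt_jetProj p).continuousAt.eventually
      ((eventually_all.2 fun a => eventually_all.2 fun i => (hV a i).eventually).and hH.eventually)
  have hA : ∀ i, IsLocalAt (fun q => vderiv (i, 0) (firstOrderLag V H) q -
      divForm (jetY n ι) (firstOrderForm V) (i, 0) q) p := fun i =>
    ((isLocalAt_firstOrderLag hV hH).vderiv _).sub
      ((IsLocalFormAt.divForm (isLocalFieldAt_jetY p) hχ).coeff _)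
  have key : ∀ᶠ q in 𝓝 p, ∀ i I, vderiv (i, I) (firstOrderLag V H) q =
      (if I = 0 then vderiv (i, 0) (firstOrderLag V H) q -
        divForm (jetY n ι) (firstOrderForm V) (i, 0) q else 0) +
          divForm (jetY n ι) (firstOrderForm V) (i, I) q := by
    filter_upwards [hloc] with q hq i I
    by_cases hI : I = 0
    · subst hI
      simp
    · have h1 : ∀ a j, IsLocalAt (fun r : Jet n ι => V a j (jetProj r)) q := fun a j =>
        (hq.1 a j).comp_map (isLocalMapAt_jetProj q)
      have h2 : ∀ j, vderiv (i, I) (fun r : Jet n ι => r.2 (j, 0)) q = 0 := fun j =>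
        vderiv_comp_jetProj (fun y => y.2 j) hI q
      have h3 : vderiv (i, I) (firstOrderLag V H) q = ∑ a, ∑ j,
          V a j (jetProj q) * vderiv (i, I) (fun r : Jet n ι => r.2 (j, Pi.single a 1)) q := by
        have h4 : ∀ a j, IsLocalAt (fun r : Jet n ι =>
            V a j (jetProj r) * r.2 (j, Pi.single a 1)) q := fun a j => (h1 a j).mul (.coord _)
        unfold firstOrderLag
        rw [vderiv_sub (IsLocalAt.sum fun a _ => IsLocalAt.sum fun j _ => h4 a j)
          (hq.2.comp_map (isLocalMapAt_jetProj q)), vderiv_comp_jetProj H hI, sub_zero,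
          vderiv_sum fun a => IsLocalAt.sum fun j _ => h4 a j]
        refine Finset.sum_congr rfl fun a _ => ?_
        rw [vderiv_sum (h4 a)]
        refine Finset.sum_congr rfl fun j _ => ?_
        rw [vderiv_mul (h1 a j) (.coord _), vderiv_comp_jetProj (V a j) hI, zero_mul, zero_add]
      rw [h3, if_neg hI, zero_add, divForm]
      refine Finset.sum_congr rfl fun a _ => ?_
      rw [(formRep_firstOrderForm hq.1 a).lieD_eq (isLocalFieldAt_jetY q)]
      refine Finset.sum_congr rfl fun j _ => ?_
      rw [h2, mul_zero, zero_add, totalD_jet_coord, zero_add]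
  refine ⟨hχ, ?_⟩
  filter_upwards [key, eventually_euler_eq hA hχ key] with q h1 h2 i I
  rw [h1, h2]

end FirstOrder

/-! ## Gauging away the Stueckelberg variables -/

section Gauging

variable {n : ℕ} {S S₁ : LagSystem n}

theorem lineDeriv_linearCombination_add {K ι : Type} [Fintype ι] {p : Pt n K}
    {φ : ι → Pt n K → ℝ} {f : Pt n K → ℝ} (hφ : ∀ i, IsLocalAt (φ i) p) (hf : IsLocalAt f p)
    (t : ι → ℝ) (v : Pt n K) : lineDeriv ℝ (fun q => ∑ i, t i * φ i q + f q) p v =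
      ∑ i, t i * lineDeriv ℝ (φ i) p v + lineDeriv ℝ f p v := by
  have h1 : ∀ i, IsLocalAt (fun q => t i * φ i q) p := fun i => (IsLocalAt.const (t i)).mul (hφ i)
  rw [lineDeriv_add (IsLocalAt.sum fun i _ => h1 i) hf, lineDeriv_sum fun i _ => h1 i]
  congr 1
  refine Finset.sum_congr rfl fun i _ => ?_
  rw [lineDeriv_mul (.const _) (hφ i), lineDeriv_const_fun, zero_mul, zero_add]

/-- The intrinsic Lagrangian along the prolongation of a map to the equation manifold. -/
theorem EqChart.intrinsicLagrangian_prolong (c : EqChart S) {κ ι : Type} [Fintype ι]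
    {η : Pt n κ → Pt n c.A} {p : Jet n κ} (hη : IsLocalMapAt η (jetProj p))
    {χ : Fin n → VForm n c.A} {l : Pt n c.A → ℝ} {φ : ι → Pt n c.A → ℝ}
    {J : Fin n → Pt n c.A → ℝ} (hφ : ∀ i, IsLocalAt (φ i) (η (jetProj p)))
    (hJ : ∀ a, IsLocalAt (J a) (η (jetProj p))) {v : Fin n → ι → ℝ} {l₀ : ℝ}
    (hχ : ∀ a A, χ a A (η (jetProj p)) =
      ∑ i, v a i * vderiv A (φ i) (η (jetProj p)) + vderiv A (J a) (η (jetProj p)))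
    (hl : l (η (jetProj p)) = l₀ + ∑ a, totalD c.Y a (J a) (η (jetProj p))) :
    c.intrinsicLagrangian χ l (prolong (fun A p' => (η (jetProj p')).2 A) p) =
      ∑ a, ∑ i, v a i * (totalD (jetY n κ) a (fun q => φ i (η (jetProj q))) p -
        totalD c.Y a (φ i) (η (jetProj p))) + l₀ +
          ∑ a, totalD (jetY n κ) a (fun q => J a (η (jetProj q))) p := by
  have hm : IsLocalMapAt (fun q : Jet n κ => η (jetProj q)) p := hη.comp (isLocalMapAt_jetProj p)
  set q := η (jetProj p) with hq
  have hP : jetProj (prolong (fun A p' => (η (jetProj p')).2 A) p) = q :=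
    Prod.ext hη.fst_eq.symm (funext fun A => by simp [jetProj, prolong, iterD_zero, hq])
  let Z : Fin n → c.A → ℝ := fun a A => totalD (jetY n κ) a (fun r => (η (jetProj r)).2 A) p
  have hZ : ∀ a A, (prolong (fun A p' => (η (jetProj p')).2 A) p).2 (A, Pi.single a 1) = Z a A :=
    fun a A => iterD_single a (hm.component A)
  have hD : ∀ a {f : Pt n c.A → ℝ}, IsLocalAt f q →
      totalD (jetY n κ) a (fun r => f (η (jetProj r))) p = lineDeriv ℝ f q (Pi.single a 1, Z a) :=
    fun a f hf => lineDeriv_comp_map hm hf _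
  -- The jet-space `D_a` and the `D_a` of the equation manifold have the same `x`-part, so their
  -- difference is a vertical vector, which is contracted with `d_v f`.
  have hsub : ∀ a {f : Pt n c.A → ℝ}, IsLocalAt f q →
      lineDeriv ℝ f q (0, fun A => Z a A - c.Y a A q) =
        totalD (jetY n κ) a (fun r => f (η (jetProj r))) p - totalD c.Y a f q := by
    intro a f hf
    rw [hD a hf, totalD, ← hf.lineDeriv_sub_right]
    congr 1
    exact Prod.ext (sub_self _).symm rfl
  have hsum : ∀ a, ∑ᶠ A, (Z a A - c.Y a A q) * χ a A q =
      ∑ i, v a i * (totalD (jetY n κ) a (fun r => φ i (η (jetProj r))) p -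
        totalD c.Y a (φ i) q) +
      (totalD (jetY n κ) a (fun r => J a (η (jetProj r))) p - totalD c.Y a (J a) q) := by
    intro a
    have hF : IsLocalAt (fun r => ∑ i, v a i * φ i r + J a r) q :=
      (IsLocalAt.sum fun i _ => (IsLocalAt.const (v a i)).mul (hφ i)).add (hJ a)
    -- The coefficients `v a i` are frozen at the point, which makes `χ a` there the differential of
    -- a single function.
    have h1 : ∀ A, χ a A q = vderiv A (fun r => ∑ i, v a i * φ i r + J a r) q := fun A =>
      (hχ a A).trans (lineDeriv_linearCombination_add hφ (hJ a) (v a) _).symm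
    simp only [h1]
    rw [← hF.lineDeriv_eq_finsum fun A => Z a A - c.Y a A q,
      lineDeriv_linearCombination_add hφ (hJ a), hsub a (hJ a)]
    simp only [hsub a (hφ _)]
  unfold EqChart.intrinsicLagrangian
  simp only [hP, hZ, hsum, hl, Finset.sum_add_distrib, Finset.sum_sub_distrib]
  ring

/-- The projection of jet spaces which forgets the second family of fields. -/
def forgetFields {ι M : Type} (p : Jet n (ι ⊕ M)) : Jet n ι :=
  (p.1, fun k => p.2 (Sum.inl k.1, k.2))

/-- The section of jet spaces along which the second family of fields vanishes. -/
def zeroFields {ι : Type} (M : Type) (p : Jet n ι) : Jet n (ι ⊕ M) :=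
  (p.1, fun k => Sum.elim (fun i => p.2 (i, k.2)) (fun _ => 0) k.1)

theorem isLocalMapAt_forgetFields {ι M : Type} (p : Jet n (ι ⊕ M)) :
    IsLocalMapAt forgetFields p :=
  .of_forall fun _ => ⟨rfl, fun _ => .coord _⟩

theorem isCartanMapAt_zeroFields {ι M : Type} (p : Jet n ι) :
    IsCartanMapAt (jetY n ι) (jetY n (ι ⊕ M)) (zeroFields M) p := by
  refine ⟨.of_forall fun q => ⟨rfl, ?_⟩, .of_forall fun q a => ?_⟩
  · rintro ⟨i | μ, I⟩
    · exact .coord (i, I)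
    · exact .const 0
  · rintro ⟨i | μ, I⟩
    · exact totalD_coord _ _ (i, I)
    · exact lineDeriv_const_fun 0 _

theorem vderiv_comp_forgetFields {ι M : Type} (h : Jet n ι → ℝ) (μ : M) (I : Fin n → ℕ)
    (p : Jet n (ι ⊕ M)) : vderiv (Sum.inr μ, I) (fun q => h (forgetFields q)) p = 0 := by
  classical
  have h1 : ∀ t : ℝ, forgetFields (p + t • ((0, Pi.single (Sum.inr μ, I) 1) : Jet n (ι ⊕ M))) =
      forgetFields p := by
    intro t
    refine Prod.ext (by simp [forgetFields]) (funext fun k => ?_)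
    simp [forgetFields]
  rw [vderiv, lineDeriv]
  have h2 : (fun t : ℝ => h (forgetFields (p + t •
      ((0, Pi.single (Sum.inr μ, I) 1) : Jet n (ι ⊕ M))))) = fun _ => h (forgetFields p) :=
    funext fun t => by rw [h1]
  convert deriv_const (0 : ℝ) (h (forgetFields p)) using 2
  convert h2

/-- Lagrangians which agree up to a divergence define the same stationary surface. -/
theorem mem_stationary_of_eq_add_divergence {ι : Type} [Fintype ι] {L L' : Jet n ι → ℝ}
    {p : Jet n ι} {J : Fin n → Jet n ι → ℝ} (hL : IsLocalAt L p) (hJ : ∀ a, IsLocalAt (J a) p)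
    (h : ∀ᶠ q in 𝓝 p, L' q = L q + ∑ a, totalD (jetY n ι) a (J a) q) (hp : p ∈ stationary L) :
    p ∈ stationary L' := by
  have hF : IsCartanMapAt (jetY n ι) (jetY n ι) (fun q => q) p :=
    ⟨.of_forall fun q => ⟨rfl, fun k => .coord k⟩, .of_forall fun q a k => totalD_coord _ a k⟩
  obtain ⟨χ, hχ⟩ := (exists_isPresympPotentialAt hL).2
  have hdiv : IsLocalAt (fun q => ∑ a, totalD (jetY n ι) a (J a) q) p :=
    IsLocalAt.sum fun a _ => (hJ a).totalD (isLocalFieldAt_jetY _).component a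
  obtain ⟨_, -, h1⟩ := IsPresympPotentialAt.transfer (L := L') (τ := fun _ _ => 0) hF hL
    (fun _ => .const 0) hJ (by
      filter_upwards [h.eventually_nhds, hL.eventually, hdiv.eventually] with q h1 h2 h3 i I
      rw [(vderiv_congr (i, I) h1).self_of_nhds, vderiv_add h2 h3, ite_self, add_zero]) hχ
  exact (h1.self_of_nhds hp).2 fun _ => IsFlatAt.zero _

/-- If the potential is the pullback of `V^a_i d_vφ^i + L₁` up to an exact form, gauging away
the Stueckelberg variables yields the first-order Lagrangian `L₁` up to a divergence. -/
theorem EqChart.exists_gaugesAwayTo (c : EqChart S) {V : Fin n → S₁.ι → Pt n S₁.ι → ℝ}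
    {H : Pt n S₁.ι → ℝ} (hV : ∀ a i, IsLocalAt (V a i) (jetProj S₁.pt))
    (hH : IsLocalAt H (jetProj S₁.pt)) (hL : ∀ᶠ p in 𝓝 S₁.pt, S₁.L p = firstOrderLag V H p)
    {e : Pt n c.A → Jet n S₁.ι} (he : IsCartanMapAt c.Y (jetY n S₁.ι) e c.q₀)
    (he₀ : e c.q₀ = S₁.pt)
    (hli : LinearIndependent ℝ fun i A => vderiv A (fun q => (e q).2 (i, 0)) c.q₀)
    {χ : Fin n → VForm n c.A} {l : Pt n c.A → ℝ} {J : Fin n → Pt n c.A → ℝ}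
    (hJ : ∀ a, IsLocalAt (J a) c.q₀)
    (hpot : ∀ᶠ q in 𝓝 c.q₀,
      (∀ a A, χ a A q = pullForm e (firstOrderForm V a) A q + vderiv A (J a) q) ∧
        l q = S₁.L (e q) + ∑ a, totalD c.Y a (J a) q) :
    ∃ S' : LagSystem n, c.GaugesAwayTo (c.intrinsicLagrangian χ l) S' ∧ IsRedefinition S₁ S' := by
  let φ : S₁.ι → Pt n c.A → ℝ := fun i q => (e q).2 (i, 0)
  obtain ⟨M, θ, η, hcc, hθ1, hθφ, hθ0⟩ :=
    exists_isCoordChange (fun i => he.isLocalMapAt.component (i, 0)) hli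
  obtain ⟨hθ, hη, hηθ, hθη⟩ := id hcc
  have tη : Tendsto η (𝓝 (θ c.q₀)) (𝓝 c.q₀) := by
    have := hη.continuousAt
    rwa [ContinuousAt, hηθ.self_of_nhds] at this
  have te : Tendsto e (𝓝 c.q₀) (𝓝 S₁.pt) := by
    have := he.continuousAt
    rwa [ContinuousAt, he₀] at this
  let LC' : Jet n (S₁.ι ⊕ M) → ℝ := fun p =>
    c.intrinsicLagrangian χ l (prolong (fun A p' => (η (jetProj p')).2 A) p)
  let N : Fin n → Jet n (S₁.ι ⊕ M) → ℝ := fun a p => J a (η (jetProj p))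
  -- The neighbourhood constrains only the undifferentiated fields, as derivative coordinates are
  -- free when gauging away.
  have hformula : ∀ᶠ r in 𝓝 (θ c.q₀), ∀ p : Jet n (S₁.ι ⊕ M), jetProj p = r →
      LC' p = firstOrderLag V H (forgetFields p) +
        ∑ a, totalD (jetY n (S₁.ι ⊕ M)) a (N a) p := by
    filter_upwards [hη.eventually, hθη.eventually_nhds, tη.eventually hpot,
      tη.eventually he.eventually, tη.eventually (te.eventually hL),
      tη.eventually (eventually_all.2 fun a => (hJ a).eventually)] with r h1 h2 h3 h4 h5 h6 p hp
    subst hp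
    have hφη : ∀ᶠ q in 𝓝 p, ∀ i, φ i (η (jetProj q)) = q.2 (Sum.inl i, 0) := by
      filter_upwards [(isLocalMapAt_jetProj p).continuousAt.eventually h2] with q hq i
      have := hθφ (η (jetProj q)) i
      rw [hq] at this
      exact this.symm
    have hξ : jetProj (e (η (jetProj p))) = jetProj (forgetFields p) :=
      Prod.ext (h4.isLocalMapAt.fst_eq.trans h1.fst_eq) (funext fun i => hφη.self_of_nhds i)
    refine (c.intrinsicLagrangian_prolong (φ := φ) (J := J)
      (v := fun a i => V a i (jetProj (e (η (jetProj p)))))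
      (l₀ := firstOrderLag V H (e (η (jetProj p)))) h1
      (fun i => h4.isLocalMapAt.component (i, 0)) h6 (fun a A => ?_) ?_).trans ?_
    · rw [h3.1 a A, pullForm_eq_sum h4.isLocalMapAt (fun i => .coord _) fun k => rfl]
    · rw [h3.2, h5]
    · have h7 : ∀ a i, totalD (jetY n (S₁.ι ⊕ M)) a (fun q => φ i (η (jetProj q))) p =
          p.2 (Sum.inl i, Pi.single a 1) := by
        intro a i
        rw [(totalD_congr a (hφη.mono fun q hq => hq i)).self_of_nhds, totalD_jet_coord, zero_add]
      -- These are the on-shell derivatives. In `V (φ_a - D_aφ) + L₁` they cancel against the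
      -- velocities in the restriction of `L₁`.
      have h8 : ∀ a i, totalD c.Y a (φ i) (η (jetProj p)) =
          (e (η (jetProj p))).2 (i, Pi.single a 1) := by
        intro a i
        rw [h4.comm.self_of_nhds a (i, 0), jetY, zero_add]
      simp only [h7, h8, firstOrderLag, hξ, mul_sub, Finset.sum_sub_distrib]
      simp only [forgetFields, N]
      ring
  have hbase : jetProj (zeroFields M S₁.pt) = θ c.q₀ := by
    refine Prod.ext ?_ (funext fun k => ?_)
    · rw [hθ1, ← he.isLocalMapAt.fst_eq, he₀]
      rfl
    · rcases k with i | μ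
      · rw [hθφ, he₀]
        rfl
      · exact (hθ0 μ).symm
  have tz : Tendsto (fun p : Jet n S₁.ι => jetProj (zeroFields M p)) (𝓝 S₁.pt) (𝓝 (θ c.q₀)) := by
    have := ((isLocalMapAt_jetProj _).comp
      (isCartanMapAt_zeroFields (M := M) S₁.pt).isLocalMapAt).continuousAt
    rwa [ContinuousAt, hbase] at this
  have hNr : ∀ᶠ r in 𝓝 (θ c.q₀), ∀ p : Jet n (S₁.ι ⊕ M), jetProj p = r → ∀ a,
      IsLocalAt (N a) p := by
    filter_upwards [hη.eventually, tη.eventually (eventually_all.2 fun a => (hJ a).eventually)]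
      with r h1 h2 p hp a
    subst hp
    exact IsLocalAt.comp_map (h := J a) (h1.comp (isLocalMapAt_jetProj p)) (h2 a)
  have hVr : ∀ᶠ r in 𝓝 (θ c.q₀), ∀ p : Jet n (S₁.ι ⊕ M), jetProj p = r →
      IsLocalAt (fun q : Jet n (S₁.ι ⊕ M) => firstOrderLag V H (forgetFields q)) p := by
    have h1 : IsLocalMapAt (fun r : Pt n (S₁.ι ⊕ M) =>
        ((r.1, fun i => r.2 (Sum.inl i)) : Pt n S₁.ι)) (θ c.q₀) :=
      .of_forall fun _ => ⟨rfl, fun _ => .coord _⟩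
    have h2 : Tendsto (fun r : Pt n (S₁.ι ⊕ M) =>
        ((r.1, fun i => r.2 (Sum.inl i)) : Pt n S₁.ι)) (𝓝 (θ c.q₀)) (𝓝 (jetProj S₁.pt)) := by
      have := h1.continuousAt
      rw [ContinuousAt, ← hbase] at this
      rw [← hbase]
      exact this
    filter_upwards [h2.eventually hH.eventually, h2.eventually
      (eventually_all.2 fun a => eventually_all.2 fun i => (hV a i).eventually)] with r h3 h4 p hp
    subst hp
    exact (isLocalAt_firstOrderLag (p := forgetFields p) h4 h3).comp_map
      (isLocalMapAt_forgetFields p)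
  -- Up to a divergence `LC'` does not contain the `w^μ`, so in these directions its variation is
  -- purely a boundary term `d_v N` with zero source.
  have heuler : ∀ᶠ r in 𝓝 (θ c.q₀), ∀ p : Jet n (S₁.ι ⊕ M), jetProj p = r → ∀ μ,
      euler LC' (Sum.inr μ) p = 0 := by
    filter_upwards [hformula.eventually_nhds, hNr.eventually_nhds, hVr.eventually_nhds]
      with r h1 h2 h3 p hp μ
    subst hp
    have hc := (isLocalMapAt_jetProj p).continuousAt
    refine euler_eq_of_variation (B := fun _ => 0) (χ := fun a k => vderiv k (N a)) (.const 0)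
      (fun a => IsLocalFormAt.vderiv (h2.self_of_nhds p rfl a)) fun I => ?_
    filter_upwards [(hc.eventually h1).eventually_nhds, hc.eventually h2, hc.eventually h3]
      with q h4 h5 h6
    have h7 := fun a => h5 q rfl a
    rw [(vderiv_congr (Sum.inr μ, I) (h4.mono fun q' hq' => hq' q' rfl)).self_of_nhds,
      vderiv_add (h6 q rfl) (IsLocalAt.sum fun a _ =>
        (h7 a).totalD (isLocalFieldAt_jetY q).component a), vderiv_comp_forgetFields,
      ← divForm_vderiv (isLocalFieldAt_jetY q) h7, ite_self]
  have hN₀ : ∀ a, IsLocalAt (fun p => N a (zeroFields M p)) S₁.pt := fun a =>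
    (hNr.self_of_nhds _ hbase a).comp_map (isCartanMapAt_zeroFields S₁.pt).isLocalMapAt
  have hL' : ∀ᶠ p in 𝓝 S₁.pt, LC' (zeroFields M p) =
      S₁.L p + ∑ a, totalD (jetY n S₁.ι) a (fun q => N a (zeroFields M q)) p := by
    filter_upwards [tz.eventually hformula, tz.eventually hNr, hL] with p h1 h2 h3
    rw [h1 _ rfl, h3]
    congr 1
    exact Finset.sum_congr rfl fun a _ =>
      (totalD_comp_map (isCartanMapAt_zeroFields p) (h2 _ rfl a) a).symm
  -- The fields and the base point are those of `S₁`, and the Lagrangian is `L₁` plus a divergence;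
  -- the redefinition relating the two is the identity on fields.
  let S' : LagSystem n :=
    { ι := S₁.ι
      fintype := S₁.fintype
      L := fun p => LC' (zeroFields M p)
      pt := S₁.pt
      isLocal := (S₁.isLocal.add (IsLocalAt.sum fun a _ =>
        (hN₀ a).totalD (isLocalFieldAt_jetY _).component a)).congr hL'
      onShell := mem_stationary_of_eq_add_divergence S₁.isLocal hN₀ hL' S₁.onShell }
  refine ⟨S', ⟨M, θ, η, hcc, hθ0, heuler, ?_, .of_forall fun _ => rfl⟩, ?_⟩
  · change S₁.pt = _
    refine Prod.ext ?_ (funext fun k => ?_)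
    · rw [← he₀, he.isLocalMapAt.fst_eq]
    · have h1 : (fun q => (θ q).2 (Sum.inl k.1)) = fun q => (e q).2 (k.1, 0) :=
        funext fun q => hθφ q k.1
      have h2 := iterD_comp_map (h := fun q => q.2 (k.1, 0)) (isLocalFieldAt_jetY _) he (.coord _)
        k.2
      rw [iterD_coord, he₀, zero_add] at h2
      change _ = iterD c.Y k.2 (fun q => (θ q).2 (Sum.inl k.1)) c.q₀
      rw [h1]
      exact h2.symm
  · refine ⟨fun i q => q.2 (i, 0), fun i q => q.2 (i, 0), fun a p => N a (zeroFields M p),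
      fun _ => .coord _, fun _ => .coord _, hN₀, prolong_coord _, prolong_coord _,
      .of_forall fun p => ?_, .of_forall fun p => ?_, ?_⟩
    · exact (prolong_coord _).trans (prolong_coord p)
    · exact (prolong_coord _).trans (prolong_coord p)
    · filter_upwards [hL'] with p hp
      exact (congrArg (fun q => LC' (zeroFields M q)) (prolong_coord p)).trans hp

end Gauging

/-! ### The theorem for natural systems -/

section Main

variable {n : ℕ} {S S₁ : LagSystem n}

/-- The intrinsic Lagrangian of a system which is equivalent to a first-order one with
algebraically unconstrained fields. -/
theorem EqChart.exists_intrinsic_presymplectic (hn : 0 < n) (c : EqChart S)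
    (hequiv : LagEquiv S S₁) (hfirst : S₁.IsFirstOrder) (hfree : S₁.FieldsUnconstrained) :
    ∃ σ : Fin n → c.A → c.A → Pt n c.A → ℝ, c.IsPresymplectic σ ∧
      (∃ χ l, c.IsPotential σ χ l) ∧ ∀ χ l, c.IsPotential σ χ l →
        ∃ S' : LagSystem n, c.GaugesAwayTo (c.intrinsicLagrangian χ l) S' ∧ LagEquiv S' S := by
  obtain ⟨V, H, hV, hH, hL⟩ := hfirst
  obtain ⟨c₁, hli₁⟩ := hfree
  obtain ⟨F, G, hF, hG, -, hFG⟩ := hequiv.areIsomorphic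
  let e : Pt n c.A → Jet n S₁.ι := fun q => F (c.emb q)
  have he : IsCartanMapAt c.Y (jetY n S₁.ι) e c.q₀ :=
    IsCartanMapAt.comp (by rw [c.emb_base]; exact hF.cartan) c.isCartanMapAt_emb
  have he₀ : e c.q₀ = S₁.pt := by
    simp only [e, c.emb_base, hF.map_pt]
  have te : Tendsto e (𝓝 c.q₀) (𝓝 S₁.pt) := hF.tendsto.comp c.tendsto_emb
  have hemem : ∀ᶠ q in 𝓝 c.q₀, e q ∈ stationary S₁.L := by
    filter_upwards [c.emb_mem, c.tendsto_emb.eventually hF.mem] with q h1 h2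
    exact h2 h1
  have hχ₁ : S₁.IsPresympPotential (firstOrderForm V) := by
    have h1 := isPresympPotentialAt_firstOrderForm hV hH
    have h2 : ∀ᶠ q in 𝓝 S₁.pt, ∀ i I, vderiv (i, I) S₁.L q =
        (if I = 0 then euler (firstOrderLag V H) i q else 0) +
          divForm (jetY n S₁.ι) (firstOrderForm V) (i, I) q := by
      filter_upwards [h1.2, hL.eventually_nhds] with q h2 h3 i I
      exact (vderiv_congr (i, I) h3).self_of_nhds.trans (h2 i I)
    refine ⟨h1.1, ?_⟩
    filter_upwards [h2, eventually_euler_eq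
      (exists_isPresympPotentialAt (isLocalAt_firstOrderLag hV hH)).1 h1.1 h2] with q h3 h4 i I
    rw [h3, h4]
  have hχ₁l : ∀ a, IsLocalFormAt (firstOrderForm V a) (e c.q₀) := fun a => by
    rw [he₀]
    exact hχ₁.1 a
  obtain ⟨χ', hχ', J', hJ', hχJ⟩ := hF.potential _ hχ₁
  let χ₀ : Fin n → VForm n c.A := fun a => pullForm e (firstOrderForm V a)
  have hχ₀ : ∀ a, IsLocalFormAt (χ₀ a) c.q₀ := fun a => (hχ₁l a).pull he.isLocalMapAt
  have hl₀ : IsLocalAt (fun q => S₁.L (e q)) c.q₀ :=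
    IsLocalAt.comp_map he.isLocalMapAt (by rw [he₀]; exact S₁.isLocal)
  -- On shell the source term of the variational formula vanishes, so its pullback along `e` is the
  -- horizontal half of the potential equation, with `l = L₁ ∘ e`.
  have hdiv : ∀ᶠ q in 𝓝 c.q₀, ∀ B, divForm c.Y χ₀ B q = vderiv B (fun q => S₁.L (e q)) q := by
    filter_upwards [he.eventually, c.isLocalFieldAt_Y.eventually, te.eventually hχ₁.2, hemem,
      te.eventually (eventually_all.2 fun a => (hχ₁.1 a).eventually),
      te.eventually S₁.isLocal.eventually] with q h1 h2 h3 h4 h5 h6 B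
    rw [divForm_pullForm h2 (isLocalFieldAt_jetY _) h1 h5, ← pullForm_vderiv h1.isLocalMapAt h6]
    refine pullForm_congr (fun k => ?_) B
    have h7 : euler S₁.L k.1 (e q) = 0 := by simpa [iterD_zero] using h4 k.1 0
    have h8 := h3 k.1 k.2
    rw [h7, ite_self, zero_add] at h8
    exact h8.symm
  -- Independence is assumed on a chart of the stationary surface of `S₁`. The map `m` to the
  -- present chart satisfies `e ∘ m = c₁.emb`, and a relation among the differentials of the `φ^i ∘
  -- e` would pull back along `m`.
  have hli : LinearIndependent ℝ fun i A => vderiv A (fun q => (e q).2 (i, 0)) c.q₀ := by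
    let m : Pt n c₁.A → Pt n c.A := fun q => c.ψ (G (c₁.emb q))
    have hG₁ : IsLocalMapAt (fun q => G (c₁.emb q)) c₁.q₀ :=
      IsLocalMapAt.comp (by rw [c₁.emb_base]; exact hG.cartan.isLocalMapAt) c₁.emb_local
    have hbase : G (c₁.emb c₁.q₀) = S.pt := by rw [c₁.emb_base, hG.map_pt]
    have hm : IsLocalMapAt m c₁.q₀ := IsLocalMapAt.comp (by rw [hbase]; exact c.ψ_local) hG₁
    have hm₀ : m c₁.q₀ = c.q₀ := by
      simp only [m, hbase, ← c.emb_base]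
      exact c.ψ_emb.self_of_nhds
    have tG : Tendsto (fun q => G (c₁.emb q)) (𝓝 c₁.q₀) (𝓝 S.pt) :=
      hG.tendsto.comp c₁.tendsto_emb
    have hem : ∀ᶠ q in 𝓝 c₁.q₀, e (m q) = c₁.emb q := by
      filter_upwards [c₁.emb_mem, c₁.tendsto_emb.eventually hG.mem, tG.eventually c.emb_ψ,
        c₁.tendsto_emb.eventually hFG] with q h1 h2 h3 h4
      simp only [e, m]
      rw [h3 (h2 h1), h4 h1]
    have h1 : LinearIndependent ℝ fun (i : S₁.ι) B =>
        vderiv B (fun q => (e (m q)).2 (i, 0)) c₁.q₀ := by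
      convert hli₁ using 3 with i B
      exact (vderiv_congr B (hem.mono fun q hq => by rw [hq])).self_of_nhds
    have h2 := linearIndependent_vderiv_of_comp hm (φ := fun i q => (e q).2 (i, 0))
      (fun i => by rw [hm₀]; exact he.isLocalMapAt.component (i, 0)) h1
    rwa [hm₀] at h2
  -- `σ = d_v χ₀` is in the class of presymplectic structures with `β = 0`: the transported
  -- potential `χ'` restricts to `χ₀` plus a vertically exact form, which `d_v` annihilates.
  refine ⟨fun a A B => dvForm (χ₀ a) A B, ⟨χ', fun _ _ _ _ => 0, hχ', fun _ _ => .zero,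
    fun _ _ => by ext; simp, ?_⟩, ⟨χ₀, fun q => S₁.L (e q), hχ₀, hl₀, ?_⟩, ?_⟩
  · have h0 : ∀ (B : c.A) (q : Pt n c.A),
        divForm c.Y (fun _ _ _ => (0 : ℝ)) B q = 0 := by
      intro B q
      refine Finset.sum_eq_zero fun a _ => ?_
      simp [lieD, totalD, lineDeriv_const_fun]
    have hpull : ∀ᶠ q in 𝓝 c.q₀, ∀ a B, pullForm c.emb (χ' a) B q =
        χ₀ a B q + vderiv B (fun r => J' a (c.emb r)) q := by
      filter_upwards [c.emb_local.eventually, c.emb_mem, c.tendsto_emb.eventually hχJ,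
        c.tendsto_emb.eventually hF.cartan.eventually,
        c.tendsto_emb.eventually (eventually_all.2 fun a => (hJ' a).eventually),
        te.eventually (eventually_all.2 fun a => (hχ₁.1 a).eventually)] with q h1 h2 h3 h4 h5 h6 a B
      rw [pullForm_congr (ρ' := χ' a) (ρ := fun k p =>
          pullForm F (firstOrderForm V a) k p + vderiv k (J' a) p) (h3 h2 a), pullForm_add ((h6 a).pull h4.isLocalMapAt)
        (IsLocalFormAt.vderiv (h5 a)), pullForm_comp h1 h4.isLocalMapAt (h6 a),
        pullForm_vderiv h1 (h5 a)]
    filter_upwards [hpull.eventually_nhds, eventually_all.2 fun a => (hχ₀ a).eventually,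
      c.emb_local.eventually,
      c.tendsto_emb.eventually (eventually_all.2 fun a => (hJ' a).eventually)]
      with q h1 h2 h3 h4 a A B
    have h5 : IsLocalAt (fun r => J' a (c.emb r)) q := (h4 a).comp_map h3
    have h6 : dvForm (divForm c.Y fun _ _ _ => (0 : ℝ)) A B q = 0 := by
      have : (divForm c.Y fun _ _ _ => (0 : ℝ)) = fun B q => 0 :=
        funext fun B => funext fun q => h0 B q
      rw [this, dvForm, vderiv, vderiv, lineDeriv_const_fun, lineDeriv_const_fun, sub_zero]
    rw [h6, add_zero, dvForm_congr (h1.mono fun r hr => hr a),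
      dvForm_add (h2 a) (IsLocalFormAt.vderiv h5), dvForm_vderiv h5, add_zero]
  · filter_upwards [hdiv] with q hq
    exact ⟨fun _ _ _ => rfl, hq⟩
  · rintro χ l ⟨hχ, hl, hpot⟩
    obtain ⟨J, hJ, hJe⟩ := exists_eq_add_of_potentials hn c.isLocalFieldAt_Y hχ hχ₀ hl hl₀
      (hpot.mono fun q hq => hq.1) (hpot.mono fun q hq => hq.2) hdiv
    obtain ⟨S', hS', hred⟩ := c.exists_gaugesAwayTo hV hH hL he he₀ hli hJ hJe
    exact ⟨S', hS', ((Relation.EqvGen.rel _ _ (.inl hred)).symm _ _).trans _ _ _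
      (hequiv.symm _ _)⟩

end Main

end

end IntrinsicLagrangian

theorem mainTheorem1 {n : ℕ} (hn : 0 < n) (S : IntrinsicLagrangian.LagSystem n)
    (hS : S.IsNatural) (c : IntrinsicLagrangian.EqChart S) :
    ∃ σ : Fin n → c.A → c.A → IntrinsicLagrangian.Pt n c.A → ℝ,
      c.IsPresymplectic σ ∧
      (∃ χ l, c.IsPotential σ χ l) ∧
      ∀ χ l, c.IsPotential σ χ l →
        ∃ S' : IntrinsicLagrangian.LagSystem n,
          c.GaugesAwayTo (c.intrinsicLagrangian χ l) S' ∧ IntrinsicLagrangian.LagEquiv S' S := by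
  obtain ⟨S₁, hequiv, hfirst, hfree⟩ := hS
  exact c.exists_intrinsic_presymplectic hn hequiv hfirst hfree
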